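/- Let $\omega=\tfrac{-1+\sqrt{-3}}2$, $\theta=\omega-\bar\omega=\sqrt{-3}$, $\mathcal E=\mathbb Z[\omega]$, and let $\Lambda=\mathcal E^5$ carry the Hermitian form $h(x,y)=-x_0\bar y_0+x_1\bar y_1+\dots+x_4\bar y_4$. Let $\Gamma=\operatorname{Aut}\Lambda$, let $P\Gamma$ be its quotient by scalars, and let $\mathbb{CH}^4\subset P(\Lambda\otimes_{\mathcal E}\mathbb C)$ be the set of negative lines. For $0\le j\le 4$ let $\xi_j$ be the anti-involution of $\Lambda$ that conjugates all coordinates and negates the last $j$ of them, $\Lambda_j=\mathbb Z^{5-j}\oplus\theta\mathbb Z^j$ the lattice of its fixed vectors, $H^4_j$ its fixed-point set in $\mathbb{CH}^4$ (a real hyperbolic 4-space), $P\Gamma_j^{\mathbb R}$ the stabilizer of $H^4_j$ in $P\Gamma$, and $W_j$ the subgroup of $P\Gamma^{\mathbb R}_j$ generated by the elements that act on $H^4_j$ as reflections in hyperplanes. A Weyl chamber is the closure in $H_j^4$ of a component of the complement of the mirrors of the reflections in $W_j$. A root of $\Lambda_j$ is a primitive vector of positive norm whose reflection preserves $\Lambda_j$.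 A set of simple roots for $W_j$ is a set of roots of $\Lambda_j$ with pairwise non-positive inner products whose polyhedron, the image in $H^4_j$ of $\{v\in\Lambda_j\otimes\mathbb R: v^2<0,\ v\cdot r\le 0\text{ for all } r \text{ in the set}\}$, is a Weyl chamber. The diagrams $\Delta_j$ are as follows. Nodes $r_1,r_2,\dots$ are labelled by vectors, and $a\overset{t}{-}b$ denotes a bond of type $t$ between $r_a$ and $r_b$; $t$ is $1,2,3$ (single, double, triple bond), $s$ (strong) or $w$ (weak); pairs that are not listed are not joined. - $\Delta_0$: $(0,1,-1,0,0)$, $(0,0,1,-1,0)$, $(0,0,0,1,-1)$, $(0,0,0,0,1)$, $(1,-1,-1,-1,0)$, of norms $2,2,2,1,2$; bonds $5\overset1-3$, $3\overset1-2$, $2\overset1-1$, $3\overset2-4$. - $\Delta_1$: $(0,1,-1,0,0)$, $(0,0,1,-1,0)$, $(0,0,0,1,0)$, $(0,0,0,0,\theta)$, $(1,0,0,0,-\theta)$, $(1,-1,-1,-1,0)$, $(3,-3,0,0,-\theta)$, of norms $2,2,1,3,2,2,3$; bonds $3\overset2-6$, $3\overset2-2$, $6\overset1-5$, $2\overset1-1$,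 $4\overset s-7$, $5\overset w-4$, $7\overset w-1$. - $\Delta_2$: $(0,1,-1,0,0)$, $(0,0,1,0,0)$, $(0,0,0,-\theta,\theta)$, $(0,0,0,\theta,0)$, $(1,0,0,0,-\theta)$, $(1,-1,-1,0,0)$, $(3,-3,0,-\theta,-\theta)$, of norms $2,1,6,3,2,1,6$; bonds $4\overset2-3$, $4\overset2-7$, $3\overset3-5$, $7\overset3-1$, $6\overset s-2$, $5\overset2-6$, $2\overset2-1$. - $\Delta_3$: $(0,1,0,0,0)$, $(0,0,0,-\theta,\theta)$, $(0,0,-\theta,\theta,0)$, $(0,0,\theta,0,0)$, $(1,0,0,0,-\theta)$, $(3,-3,0,-\theta,-\theta)$, $(3,-1,-\theta,-\theta,-\theta)$, of norms $1,6,6,3,2,6,1$; bonds $5\overset3-2$, $2\overset1-3$, $3\overset2-4$, $4\overset w-7$, $7\overset s-1$, $1\overset w-6$, $6\overset1-3$. - $\Delta_4$: $(0,0,0,-\theta,\theta)$, $(0,0,-\theta,\theta,0)$, $(0,-\theta,\theta,0,0)$, $(0,\theta,0,0,0)$, $(1,0,0,0,-\theta)$, $(3,-\theta,-\theta,-\theta,-\theta)$,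 of norms $6,6,6,3,2,3$; bonds $5\overset3-1$, $1\overset1-2$, $2\overset1-3$, $3\overset2-4$, $4\overset s-6$. Theorem. For each $j=0,\dots,4$: 1. The vectors labelling $\Delta_j$ have the norms listed and form a set of simple roots for $W_j$; each of them is orthogonal to a facet of the Weyl chamber $C_j$ that is their polyhedron. For two distinct nodes, the corresponding facets of $C_j$ meet orthogonally if there is no bond; meet with interior angle $\pi/3$, $\pi/4$, $\pi/6$ if the bond is single, double, triple; are parallel (the walls do not meet in $H^4_j$, but the facets meet at infinity) if it is strong; and are ultraparallel (the walls do not meet even at infinity) if it is weak. 2. $W_j$ is a Coxeter group whose simple generators are the reflections $s_a$ in the $r_a$: the products $s_as_b$ ($a\ne b$) have order $2,3,4,6$ for no, a single, a double, a triple bond and infinite order for a strong or weak bond, and the relations $s_a^2=1$, $(s_as_b)^{m_{ab}}=1$ for the finite orders $m_{ab}$ present $W_j$. 3. $P\Gamma_j^{\mathbb R}$ is the semidirect product $W_j\rtimes\operatorname{Aut}(\Delta_j)$, where $\operatorname{Aut}(\Delta_j)$ is the group of permutations of the nodes that preserve the bonds; $\sigma\in \operatorname{Aut}(\Delta_j)$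 acts on $W_j$ by $s_a\mapsto s_{\sigma(a)}$, and as an element of $P\Gamma_j^{\mathbb R}$ it maps $C_j$ to itself and the facet of $r_a$ to the facet of $r_{\sigma(a)}$. 4. $\operatorname{Aut}(\Delta_j)\cong\mathbb Z/2$ if $j=1$ or $2$, and it is trivial otherwise. -/

import Mathlib

open scoped LinearAlgebra.Projectivization

noncomputable section

namespace RealCubic

/-! ### The Eisenstein lattice, its projective automorphism group, and complex hyperbolic space -/

/-- The complexification `Λ ⊗ ℂ` of the Eisenstein lattice `Λ` of signature `(4,1)`. -/
abbrev V : Type := Fin 5 → ℂ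

/-- The primitive cube root of unity `ω = (-1 + √-3) / 2`. -/
def omega : ℂ := (-1 + (Real.sqrt 3 : ℂ) * Complex.I) / 2

/-- `θ = ω - ω̄ = √-3`. -/
def theta : ℂ := omega - (starRingEnd ℂ) omega

/-- The Eisenstein integers `ℤ[ω]`, as a subset of `ℂ`. -/
def eisenstein : Set ℂ := {z | ∃ a b : ℤ, z = a + b * omega}

/-- The lattice `Λ = ℤ[ω]⁵` inside `ℂ⁵`. -/
def Lam : Set V := {x | ∀ i, x i ∈ eisenstein}

/-- The Hermitian form `h(x,y) = -x₀ȳ₀ + x₁ȳ₁ + ⋯ + x₄ȳ₄`. -/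
def herm (x y : V) : ℂ :=
  -(x 0 * (starRingEnd ℂ) (y 0)) + x 1 * (starRingEnd ℂ) (y 1) + x 2 * (starRingEnd ℂ) (y 2)
    + x 3 * (starRingEnd ℂ) (y 3) + x 4 * (starRingEnd ℂ) (y 4)

/-- `Γ = Aut Λ`: the linear automorphisms of `Λ ⊗ ℂ` that preserve `h` and `Λ`. -/
def Gam : Subgroup (V ≃ₗ[ℂ] V) where
  carrier := {g | (∀ x y, herm (g x) (g y) = herm x y) ∧ ∀ x, g x ∈ Lam ↔ x ∈ Lam}
  mul_mem' := by
    rintro a b ⟨ha, ha'⟩ ⟨hb, hb'⟩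
    refine ⟨fun x y => ?_, fun x => ?_⟩
    · rw [LinearEquiv.mul_apply, LinearEquiv.mul_apply, ha, hb]
    · rw [LinearEquiv.mul_apply, ha', hb']
  one_mem' := ⟨fun _ _ => rfl, fun _ => Iff.rfl⟩
  inv_mem' := by
    rintro a ⟨ha, ha'⟩
    have key : ∀ x, a (a⁻¹ x) = x := fun x => a.apply_symm_apply x
    refine ⟨fun x y => ?_, fun x => ?_⟩
    · rw [← ha, key, key]
    · rw [← ha', key]

/-- The scalars in `Γ`. -/
def scalars : Subgroup Gam where
  carrier := {g | ∃ c : ℂ, ∀ x, g.1 x = c • x}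
  mul_mem' := by
    rintro a b ⟨c, hc⟩ ⟨d, hd⟩
    refine ⟨c * d, fun x => ?_⟩
    change a.1 (b.1 x) = _
    rw [hd, hc, mul_smul]
  one_mem' := ⟨1, fun x => (one_smul ℂ x).symm⟩
  inv_mem' := by
    rintro a ⟨c, hc⟩
    refine ⟨c⁻¹, fun x => ?_⟩
    have key : a.1 (a.1.symm x) = x := a.1.apply_symm_apply x
    change a.1.symm x = _
    by_cases h0 : c = 0
    · have h1 : x = 0 := by rw [← key, hc, h0, zero_smul]
      rw [h1, map_zero, smul_zero]
    · rw [hc] at key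
      rw [← key, smul_smul, inv_mul_cancel₀ h0, one_smul, key]

instance scalars_normal : scalars.Normal where
  conj_mem := by
    rintro n ⟨c, hc⟩ g
    refine ⟨c, fun x => ?_⟩
    change g.1 (n.1 (g.1.symm x)) = _
    rw [hc, map_smul, LinearEquiv.apply_symm_apply]

/-- `PΓ = PAut Λ`. -/
abbrev PGam : Type := Gam ⧸ scalars

/-- The action of `PΓ` on the projective space of lines in `Λ ⊗ ℂ`. -/
def act : PGam →* Equiv.Perm (ℙ ℂ V) :=
  QuotientGroup.lift scalars ((MulAction.toPermHom (V ≃ₗ[ℂ] V) (ℙ ℂ V)).comp Gam.subtype) (by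
    rintro g ⟨c, hc⟩
    ext p
    induction p using Projectivization.ind with
    | h v hv =>
      change (g.1 • Projectivization.mk ℂ v hv) = Projectivization.mk ℂ v hv
      rw [Projectivization.smul_mk, Projectivization.mk_eq_mk_iff']
      exact ⟨c, (hc v).symm⟩)

/-- Complex hyperbolic space: the negative lines for `h`. -/
def CH4 : Set (ℙ ℂ V) := {p | (herm p.rep p.rep).re < 0}

/-- The projective space carries the quotient topology. -/
instance : TopologicalSpace (ℙ ℂ V) :=
  TopologicalSpace.coinduced (Projectivization.mk' ℂ) inferInstance

/-! ### The anti-involutions and the associated real objects -/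

/-- The anti-involution `ξⱼ` of `ℂ⁵`: it conjugates all coordinates and negates the last `j`. -/
def xi (j : Fin 5) : V →ₛₗ[starRingEnd ℂ] V where
  toFun x i := if 5 ≤ (i : ℕ) + (j : ℕ) then -(starRingEnd ℂ) (x i) else (starRingEnd ℂ) (x i)
  map_add' x y := by
    ext i
    by_cases hi : 5 ≤ (i : ℕ) + (j : ℕ)
    · simp only [hi, if_true, Pi.add_apply, map_add, neg_add]
    · simp only [hi, if_false, Pi.add_apply, map_add]
  map_smul' c x := by
    ext i
    by_cases hi : 5 ≤ (i : ℕ) + (j : ℕ) <;> simp [hi]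

theorem xi_xi (j : Fin 5) (x : V) : xi j (xi j x) = x := by
  ext i
  by_cases hi : 5 ≤ (i : ℕ) + (j : ℕ) <;> simp [xi, hi]

theorem xi_injective (j : Fin 5) : Function.Injective (xi j) :=
  Function.LeftInverse.injective (xi_xi j)

/-- `H⁴ⱼ`, the fixed-point set of `ξⱼ` in complex hyperbolic space. -/
def H4 (j : Fin 5) : Set (ℙ ℂ V) :=
  {p | p ∈ CH4 ∧ Projectivization.map (xi j) (xi_injective j) p = p}

/-- `PΓⱼᴿ`, the stabilizer of `H⁴ⱼ` in `PΓ`. -/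
def PGamR (j : Fin 5) : Subgroup PGam where
  carrier := {g | act g '' H4 j = H4 j}
  mul_mem' := by
    intro a b ha hb
    change act (a * b) '' H4 j = H4 j
    rw [map_mul, Equiv.Perm.coe_mul, Set.image_comp, hb, ha]
  one_mem' := by
    change act 1 '' H4 j = H4 j
    rw [map_one, Equiv.Perm.coe_one, Set.image_id]
  inv_mem' := by
    intro a ha
    change act a⁻¹ '' H4 j = H4 j
    conv_lhs => rw [← show act a '' H4 j = H4 j from ha]
    rw [← Set.image_comp, ← Equiv.Perm.coe_mul, ← map_mul, inv_mul_cancel, map_one,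
      Equiv.Perm.coe_one, Set.image_id]

/-- The real vectors for `ξⱼ`, i.e. `Λⱼ ⊗ ℝ`. On it `h` is real, of signature `(4,1)`. -/
def VR (j : Fin 5) : Set V := {v | xi j v = v}

/-- The `ℤ`-lattice `Λⱼ` of `ξⱼ`-invariant vectors of `Λ`. -/
def LamR (j : Fin 5) : Set V := {v | v ∈ Lam ∧ v ∈ VR j}

/-- The real number `x · y`; on `VR j` the form `herm` takes real values. -/
def ip (x y : V) : ℝ := (herm x y).re

/-- The reflection `x ↦ x - 2 (x·r)/(r·r) r`. -/
def refl (r : V) : V →ₗ[ℂ] V where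
  toFun x := x - (2 * herm x r / herm r r) • r
  map_add' x y := by
    have : herm (x + y) r = herm x r + herm y r := by simp [herm]; ring
    rw [this, mul_add, add_div, add_smul]
    abel
  map_smul' c x := by
    have : herm (c • x) r = c * herm x r := by simp [herm]; ring
    simp only [RingHom.id_apply]
    rw [this, smul_sub, smul_smul]
    congr 2
    ring

theorem refl_refl (r x : V) : refl r (refl r x) = x := by
  have h1 : ∀ c : ℂ, herm (x - c • r) r = herm x r - c * herm r r := by
    intro c; simp [herm]; ring
  change (x - (2 * herm x r / herm r r) • r)
    - (2 * herm (x - (2 * herm x r / herm r r) • r) r / herm r r) • r = x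
  rw [h1]
  by_cases h0 : herm r r = 0
  · simp [h0]
  · rw [div_mul_cancel₀ _ h0, sub_sub, ← add_smul]
    have : 2 * herm x r / herm r r + 2 * (herm x r - 2 * herm x r) / herm r r = 0 := by
      field_simp; ring
    rw [this, zero_smul, sub_zero]

/-- The reflection in `r`, acting on lines. -/
def reflP (r : V) : ℙ ℂ V → ℙ ℂ V :=
  Projectivization.map (refl r) (Function.LeftInverse.injective (refl_refl r))

/-- `g ∈ PΓⱼᴿ` acts on `H⁴ⱼ` as the reflection in the real vector `r`. -/
def ActsAsReflection (j : Fin 5) (r : V) (g : PGamR j) : Prop :=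
  ∀ p ∈ H4 j, act g.1 p = reflP r p

/-- `g ∈ PΓⱼᴿ` acts on `H⁴ⱼ` as a hyperbolic reflection in some hyperplane. -/
def IsReflection (j : Fin 5) (g : PGamR j) : Prop :=
  ∃ r ∈ VR j, 0 < ip r r ∧ ActsAsReflection j r g

/-- The reflection subgroup `Wⱼ` of `PΓⱼᴿ`. -/
def W (j : Fin 5) : Subgroup (PGamR j) := Subgroup.closure {g | IsReflection j g}

/-- The union of the mirrors (fixed-point sets in `H⁴ⱼ`) of the reflections in `Wⱼ`. -/
def mirrors (j : Fin 5) : Set (ℙ ℂ V) :=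
  {p | p ∈ H4 j ∧ ∃ g ∈ W j, IsReflection j g ∧ act g.1 p = p}

/-- A Weyl chamber: the closure in `H⁴ⱼ` of a component of the complement of the mirrors. -/
def IsWeylChamber (j : Fin 5) (C : Set (ℙ ℂ V)) : Prop :=
  ∃ x ∈ H4 j \ mirrors j,
    C = closure (connectedComponentIn (H4 j \ mirrors j) x) ∩ H4 j

/-- A root of `Λⱼ`: a primitive vector of positive norm whose reflection preserves `Λⱼ`. -/
def IsRoot (j : Fin 5) (r : V) : Prop :=
  r ∈ LamR j ∧ (∀ (m : ℤ), ∀ s ∈ LamR j, r = (m : ℂ) • s → IsUnit m) ∧ 0 < ip r r ∧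
    ∀ x ∈ LamR j, refl r x ∈ LamR j

/-- The polyhedron of a family of vectors: the image in `H⁴ⱼ` of
`{v ∈ Λⱼ ⊗ ℝ : v² < 0, v·rᵢ ≤ 0 for all i}`. -/
def polyhedron (j : Fin 5) {n : ℕ} (r : Fin n → V) : Set (ℙ ℂ V) :=
  {p | ∃ (v : V) (hv : v ≠ 0), p = Projectivization.mk ℂ v hv ∧ v ∈ VR j ∧ ip v v < 0 ∧
    ∀ i, ip v (r i) ≤ 0}

/-- The part of the polyhedron on the wall orthogonal to `rₐ`. -/
def face (j : Fin 5) {n : ℕ} (r : Fin n → V) (a : Fin n) : Set (ℙ ℂ V) :=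
  {p | ∃ (v : V) (hv : v ≠ 0), p = Projectivization.mk ℂ v hv ∧ v ∈ VR j ∧ ip v v < 0 ∧
    (∀ i, ip v (r i) ≤ 0) ∧ ip v (r a) = 0}

/-- A set of simple roots for `Wⱼ`: roots of `Λⱼ` with pairwise non-positive inner products
whose polyhedron is a Weyl chamber. -/
def IsSimpleSystem (j : Fin 5) {n : ℕ} (r : Fin n → V) : Prop :=
  (∀ a, IsRoot j (r a)) ∧ (∀ a b, a ≠ b → ip (r a) (r b) ≤ 0) ∧ IsWeylChamber j (polyhedron j r)

/-- `rₐ` defines a facet (3-dimensional face): some point of the wall `rₐ^⊥` lies strictly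
inside all the other half-spaces. -/
def DefinesFacet (j : Fin 5) {n : ℕ} (r : Fin n → V) (a : Fin n) : Prop :=
  ∃ v ∈ VR j, ip v v < 0 ∧ ip v (r a) = 0 ∧ ∀ b, b ≠ a → ip v (r b) < 0

/-! ### Bonds and their geometric meaning -/

inductive Bond
  | none | single | double | triple | strong | weak
  deriving DecidableEq

/-- The order of the product of two reflections with the given bond; `0` stands for `∞`. -/
def Bond.order : Bond → ℕ
  | .none => 2
  | .single => 3
  | .double => 4
  | .triple => 6
  | .strong => 0
  | .weak => 0

/-- The facets of the polyhedron in the walls `rₐ^⊥` and `r_b^⊥` meet in `H⁴ⱼ`, with interior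
angle `φ`. Since `rₐ`, `r_b` are outward normals, `cos φ = -(rₐ·r_b)/√(rₐ² r_b²)`. -/
def MeetAtAngle (j : Fin 5) {n : ℕ} (r : Fin n → V) (a b : Fin n) (φ : ℝ) : Prop :=
  (face j r a ∩ face j r b).Nonempty ∧
    Real.arccos (-ip (r a) (r b) / Real.sqrt (ip (r a) (r a) * ip (r b) (r b))) = φ

/-- The walls `rₐ^⊥` and `r_b^⊥` do not meet in `H⁴ⱼ`, but the corresponding facets of the
polyhedron meet at infinity, i.e. in an isotropic line. -/
def Parallel (j : Fin 5) {n : ℕ} (r : Fin n → V) (a b : Fin n) : Prop :=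
  (¬ ∃ v ∈ VR j, ip v v < 0 ∧ ip v (r a) = 0 ∧ ip v (r b) = 0) ∧
    ∃ v ∈ VR j, v ≠ 0 ∧ ip v v = 0 ∧ ip v (r a) = 0 ∧ ip v (r b) = 0 ∧ ∀ i, ip v (r i) ≤ 0

/-- The walls `rₐ^⊥` and `r_b^⊥` meet neither in `H⁴ⱼ` nor at infinity. -/
def Ultraparallel (j : Fin 5) {n : ℕ} (r : Fin n → V) (a b : Fin n) : Prop :=
  ¬ ∃ v ∈ VR j, v ≠ 0 ∧ ip v v ≤ 0 ∧ ip v (r a) = 0 ∧ ip v (r b) = 0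

/-- The geometric meaning of the bond joining the nodes `a` and `b`. -/
def Realizes (j : Fin 5) {n : ℕ} (r : Fin n → V) (a b : Fin n) : Bond → Prop
  | .none => MeetAtAngle j r a b (Real.pi / 2)
  | .single => MeetAtAngle j r a b (Real.pi / 3)
  | .double => MeetAtAngle j r a b (Real.pi / 4)
  | .triple => MeetAtAngle j r a b (Real.pi / 6)
  | .strong => Parallel j r a b
  | .weak => Ultraparallel j r a b

/-! ### The diagrams

The node called `rᵢ` in the diagram of `Wⱼ` has index `i - 1` in `Fin (numNodes j)`. -/

def numNodes : Fin 5 → ℕ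
  | 0 => 5
  | 1 => 7
  | 2 => 7
  | 3 => 7
  | 4 => 6

/-- The vectors labelling the nodes. -/
def simpleRoot : (j : Fin 5) → Fin (numNodes j) → V
  | 0 => ![![0, 1, -1, 0, 0], ![0, 0, 1, -1, 0], ![0, 0, 0, 1, -1], ![0, 0, 0, 0, 1],
      ![1, -1, -1, -1, 0]]
  | 1 => ![![0, 1, -1, 0, 0], ![0, 0, 1, -1, 0], ![0, 0, 0, 1, 0], ![0, 0, 0, 0, theta],
      ![1, 0, 0, 0, -theta], ![1, -1, -1, -1, 0], ![3, -3, 0, 0, -theta]]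
  | 2 => ![![0, 1, -1, 0, 0], ![0, 0, 1, 0, 0], ![0, 0, 0, -theta, theta], ![0, 0, 0, theta, 0],
      ![1, 0, 0, 0, -theta], ![1, -1, -1, 0, 0], ![3, -3, 0, -theta, -theta]]
  | 3 => ![![0, 1, 0, 0, 0], ![0, 0, 0, -theta, theta], ![0, 0, -theta, theta, 0],
      ![0, 0, theta, 0, 0], ![1, 0, 0, 0, -theta], ![3, -3, 0, -theta, -theta],
      ![3, -1, -theta, -theta, -theta]]
  | 4 => ![![0, 0, 0, -theta, theta], ![0, 0, -theta, theta, 0], ![0, -theta, theta, 0, 0],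
      ![0, theta, 0, 0, 0], ![1, 0, 0, 0, -theta], ![3, -theta, -theta, -theta, -theta]]

/-- The norms indicated by the node symbols. -/
def nodeNorm : (j : Fin 5) → Fin (numNodes j) → ℕ
  | 0 => ![2, 2, 2, 1, 2]
  | 1 => ![2, 2, 1, 3, 2, 2, 3]
  | 2 => ![2, 1, 6, 3, 2, 1, 6]
  | 3 => ![1, 6, 6, 3, 2, 6, 1]
  | 4 => ![6, 6, 6, 3, 2, 3]

/-- The bonds drawn in the diagrams: `(a, b, t)` is a bond of type `t` between `rₐ` and `r_b`. -/
def edges : Fin 5 → List (ℕ × ℕ × Bond)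
  | 0 => [(5, 3, .single), (3, 2, .single), (2, 1, .single), (3, 4, .double)]
  | 1 => [(3, 6, .double), (3, 2, .double), (6, 5, .single), (2, 1, .single), (4, 7, .strong),
      (5, 4, .weak), (7, 1, .weak)]
  | 2 => [(4, 3, .double), (4, 7, .double), (3, 5, .triple), (7, 1, .triple), (6, 2, .strong),
      (5, 6, .double), (2, 1, .double)]
  | 3 => [(5, 2, .triple), (2, 3, .single), (3, 4, .double), (4, 7, .weak), (7, 1, .strong),
      (1, 6, .weak), (6, 3, .single)]
  | 4 => [(5, 1, .triple), (1, 2, .single), (2, 3, .single), (3, 4, .double), (4, 6, .strong)]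

/-- The bond between two nodes of the diagram of `Wⱼ`. -/
def bond (j : Fin 5) (a b : Fin (numNodes j)) : Bond :=
  match (edges j).find? (fun e =>
    decide ((e.1 = a.1 + 1 ∧ e.2.1 = b.1 + 1) ∨ (e.1 = b.1 + 1 ∧ e.2.1 = a.1 + 1))) with
  | some e => e.2.2
  | Option.none => Bond.none

theorem bond_symm (j : Fin 5) (a b : Fin (numNodes j)) : bond j a b = bond j b a := by
  unfold bond
  simp only [or_comm]

theorem Bond.order_ne_one (t : Bond) : t.order ≠ 1 := by
  cases t <;> decide

/-- The Coxeter matrix of the diagram of `Wⱼ`. -/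
def coxeterMatrix (j : Fin 5) : CoxeterMatrix (Fin (numNodes j)) where
  M := fun a b => if a = b then 1 else (bond j a b).order
  isSymm := by
    ext a b
    change (if b = a then 1 else (bond j b a).order) = if a = b then 1 else (bond j a b).order
    rw [bond_symm j b a]
    simp only [eq_comm]
  diagonal a := by simp
  off_diagonal a b hab := by
    simpa [hab] using Bond.order_ne_one (bond j a b)

/-- The automorphism group of the diagram of `Wⱼ`. -/
def DiagramAut (j : Fin 5) : Subgroup (Equiv.Perm (Fin (numNodes j))) where
  carrier := {σ | ∀ a b, bond j (σ a) (σ b) = bond j a b}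
  mul_mem' := by
    intro σ τ hσ hτ a b
    rw [Equiv.Perm.mul_apply, Equiv.Perm.mul_apply, hσ, hτ]
  one_mem' := fun _ _ => rfl
  inv_mem' := by
    intro σ hσ a b
    have key : ∀ x, σ (σ⁻¹ x) = x := fun x => σ.apply_symm_apply x
    rw [← hσ, key, key]

end RealCubic

end

open RealCubic

open scoped LinearAlgebra.Projectivization

/-! ### Reflection representations of Coxeter groups over `ℤ` -/

/-! Everything is moved to the integral quadratic form `bil j` of signature (4,1), which is the form
of Λⱼ in coordinates. The stabilizer PΓⱼᴿ turns out to be the group `OPlus j` of isometries of this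
form that preserve the future cone, and `OPlus j` turns out to be the Coxeter group of the diagram
extended by `flip j`.

From the stabilizer to lattices. An element G of Γ that preserves H⁴ⱼ multiplies all real vectors by
a common complex scalar, so ξⱼ G = u G ξⱼ for an Eisenstein unit u. Every such unit is plus or minus
a square, so rescaling G by a unit makes u = 1 or u = -1. The value -1 is impossible: in odd rank it
forces the determinants of G and of its inverse to be multiples of θ. Hence G restricts to Λⱼ
(`exists_lift`). Conversely, every isometry of Λⱼ extends to Λ (`exists_isLift`), because its matrix
entries satisfy the divisibility `wt_dvd_bil`.

The Coxeter group. The simple roots have the Cartan integers prescribed by the diagram, so the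
abstract Coxeter group acts on Λⱼ. The classical length argument shows that w maps a simple root to
a nonnegative combination of simple roots or to the negative of one, according to whether the length
of w s_a exceeds that of w (`CartanRealization.rho_root_mem_cone`). So a nontrivial w never maps an
interior point of the chamber into the closed chamber, and the action is faithful.

Generation. The vector `e0` has norm -1. An isometry L maps it to a future vector of norm -1, which
simple reflections move into the chamber. An elementary classification (`eq_corner`) leaves `e0`,
its image under `flip j`, and one further vector for j = 2 that a parity argument excludes. The
stabilizer of `e0` consists of signed permutations and is generated by the simple reflections that
it contains. This gives `exists_rho_mul_flip`.

Reflections. As Wⱼ is generated by all reflections in PΓⱼᴿ, those in the coset of the flip must be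
controlled too. By `CartanRealization.exists_conj_eq_or_root_neg`, an involution there is conjugate
either to the flip, which is not a reflection, or to an isometry negating a simple root; a
reflection of the latter kind is a simple reflection. So Wⱼ is exactly the Coxeter group, and the
semidirect product follows.

Geometry. The open chamber is the image of a convex cone and misses all mirrors, while every wall is
a mirror; hence it is a component of the complement. Angles and (ultra)parallelism come from Gram
determinants of pairs of roots and from a finite table of vertices and cusps. -/

/-- The Cartan integers `x`, `y` of two roots are those prescribed by the order `m` of the product
of the two reflections, where `m = 0` stands for infinite order. -/
def CartanCompat (m : ℕ) (x y : ℤ) : Prop :=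
  (m = 2 ∧ x = 0 ∧ y = 0) ∨ (m = 3 ∧ x = -1 ∧ y = -1) ∨
  (m = 4 ∧ ((x = -1 ∧ y = -2) ∨ (x = -2 ∧ y = -1))) ∨
  (m = 6 ∧ ((x = -1 ∧ y = -3) ∨ (x = -3 ∧ y = -1))) ∨ (m = 0 ∧ x < 0 ∧ y < 0 ∧ 4 ≤ x * y)

instance (m : ℕ) (x y : ℤ) : Decidable (CartanCompat m x y) := by
  unfold CartanCompat; infer_instance

/-- Roots and coroots in a `ℤ`-module whose Cartan integers are compatible with a Coxeter matrix. -/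
structure CartanRealization {ι : Type} (cm : CoxeterMatrix ι) (M : Type) [AddCommGroup M] where
  root : ι → M
  coroot : ι → M →ₗ[ℤ] ℤ
  coroot_root : ∀ a, coroot a (root a) = 2
  compat : ∀ a b, a ≠ b → CartanCompat (cm a b) (coroot a (root b)) (coroot b (root a))

namespace CartanRealization

variable {ι : Type} {cm : CoxeterMatrix ι} {M : Type} [AddCommGroup M]
  (D : CartanRealization cm M)

/-- The reflection in a simple root. -/
def s (a : ι) : M ≃ₗ[ℤ] M := Module.reflection (D.coroot_root a)

theorem s_apply (a : ι) (x : M) : D.s a x = x - D.coroot a x • D.root a := rfl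

theorem s_root (a : ι) : D.s a (D.root a) = -D.root a :=
  Module.reflection_apply_self _

theorem s_mul_s (a : ι) : D.s a * D.s a = 1 := by
  ext x
  exact Module.involutive_reflection (D.coroot_root a) x

theorem root_ne_zero (a : ι) : D.root a ≠ 0 := by
  intro h
  have := D.coroot_root a
  rw [h, map_zero] at this
  norm_num at this

theorem s_mul_s_apply (a b : ι) (x : M) (p q : ℤ) :
    (D.s a * D.s b) (x + p • D.root a + q • D.root b) =
      x + (-p - D.coroot a x - D.coroot a (D.root b) *
        (-q - D.coroot b x - p * D.coroot b (D.root a))) • D.root a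
        + (-q - D.coroot b x - p * D.coroot b (D.root a)) • D.root b := by
  rw [LinearEquiv.mul_apply, s_apply, s_apply]
  simp only [map_add, map_sub, map_smul, coroot_root, smul_eq_mul]
  module

/-- A power of `D.s a * D.s b` changes a vector only by multiples of the two roots, so by
`s_mul_s_apply` the relation amounts to iterating an affine map on the pair of coefficients. Started
at (0, 0), it returns there after 2, 3, 4 or 6 steps. Infinite order asks nothing, since the
relation is then a zeroth power. -/
theorem isLiftable : cm.IsLiftable D.s := by
  intro a b
  by_cases hab : a = b
  · subst hab
    rw [cm.diagonal, pow_one, s_mul_s]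
  have key : ∀ x : M, ∀ m : ℕ, ∀ p q : ℤ, ((D.s a * D.s b) ^ (m + 1))
      (x + p • D.root a + q • D.root b) = ((D.s a * D.s b) ^ m)
      (x + (-p - D.coroot a x - D.coroot a (D.root b) *
        (-q - D.coroot b x - p * D.coroot b (D.root a))) • D.root a
        + (-q - D.coroot b x - p * D.coroot b (D.root a)) • D.root b) := by
    intro x m p q
    rw [pow_succ, LinearEquiv.mul_apply, s_mul_s_apply]
  ext x
  have hx : x = x + (0 : ℤ) • D.root a + (0 : ℤ) • D.root b := by simp
  rw [LinearEquiv.coe_one, id]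
  rcases D.compat a b hab with ⟨h, h1, h2⟩ | ⟨h, h1, h2⟩ | ⟨h, ⟨h1, h2⟩ | ⟨h1, h2⟩⟩ |
    ⟨h, ⟨h1, h2⟩ | ⟨h1, h2⟩⟩ | ⟨h, -⟩
  all_goals rw [h]
  all_goals first
    | (rw [pow_zero]; rfl)
    | (conv_lhs => rw [hx]
       simp only [key, pow_zero, h1, h2]
       rw [LinearEquiv.coe_one, id]
       module)

/-- The representation of the Coxeter group generated by the reflections in the simple roots. -/
noncomputable def rho : cm.Group →* (M ≃ₗ[ℤ] M) :=
  cm.toCoxeterSystem.lift ⟨D.s, D.isLiftable⟩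

theorem rho_simple (a : ι) : D.rho (cm.toCoxeterSystem.simple a) = D.s a :=
  cm.toCoxeterSystem.lift_apply_simple D.isLiftable a

/-- The monoid of nonnegative combinations of simple roots. -/
def cone : AddSubmonoid M := AddSubmonoid.closure (Set.range D.root)

theorem root_mem_cone (a : ι) : D.root a ∈ D.cone := AddSubmonoid.subset_closure ⟨a, rfl⟩

-- Nonnegativity of the coefficients alone does not survive the induction. The added inequality says
-- that the next reflection does not decrease the coefficient it changes; it passes from one root to
-- the other because the product of the Cartan integers is at least 4.
open CoxeterSystem in
theorem rho_alternatingWord_infinite (a t : ι) (hx : D.coroot a (D.root t) < 0)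
    (hy : D.coroot t (D.root a) < 0)
    (hxy : 4 ≤ D.coroot a (D.root t) * D.coroot t (D.root a)) (k : ℕ) :
    ∃ x y : ℤ, 0 ≤ x ∧ 0 ≤ y ∧
      (if Even k then 2 * y ≤ -D.coroot t (D.root a) * x else 2 * x ≤ -D.coroot a (D.root t) * y) ∧
      D.rho (cm.toCoxeterSystem.wordProd (alternatingWord a t k)) (D.root a) =
        x • D.root a + y • D.root t := by
  induction k with
  | zero =>
    refine ⟨1, 0, by norm_num, le_rfl, ?_, ?_⟩
    · simp only [Even.zero, if_true]; linarith
    · simp [alternatingWord]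
  | succ k ih =>
    obtain ⟨x, y, h0, h1, h2, h3⟩ := ih
    rw [alternatingWord_succ', wordProd_cons, map_mul, LinearEquiv.mul_apply, h3]
    by_cases hk : Even k
    · simp only [hk, if_true, Nat.even_add_one, not_true, if_false] at h2 ⊢
      refine ⟨x, -D.coroot t (D.root a) * x - y, h0, by linarith, ?_, ?_⟩
      · nlinarith
      · rw [rho_simple, s_apply]
        simp only [map_add, map_smul, coroot_root, smul_eq_mul]
        module
    · simp only [hk, if_false, Nat.even_add_one, not_false_iff, if_true] at h2 ⊢
      refine ⟨-D.coroot a (D.root t) * y - x, y, by linarith, h1, ?_, ?_⟩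
      · nlinarith
      · rw [rho_simple, s_apply]
        simp only [map_add, map_smul, coroot_root, smul_eq_mul]
        module

-- For a finite bond the vectors met are positive roots of a system of type A₁×A₁, A₂, B₂ or G₂.
-- They stay positive only for words shorter than the order of the product, which is the role of
-- `hk`.
open CoxeterSystem in
theorem rho_alternatingWord_nonneg {a t : ι} (hat : a ≠ t) (k : ℕ) (hk : cm a t ≠ 0 → k < cm a t) :
    ∃ x y : ℤ, 0 ≤ x ∧ 0 ≤ y ∧
      D.rho (cm.toCoxeterSystem.wordProd (alternatingWord a t k)) (D.root a) =
        x • D.root a + y • D.root t := by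
  have step : ∀ k : ℕ, ∀ x y : ℤ,
      D.rho (cm.toCoxeterSystem.wordProd (alternatingWord a t k)) (D.root a) =
        x • D.root a + y • D.root t →
      D.rho (cm.toCoxeterSystem.wordProd (alternatingWord a t (k + 1))) (D.root a) =
        if Even k then x • D.root a + (-D.coroot t (D.root a) * x - y) • D.root t
        else (-D.coroot a (D.root t) * y - x) • D.root a + y • D.root t := by
    intro k x y h
    rw [alternatingWord_succ', wordProd_cons, map_mul, LinearEquiv.mul_apply, h]
    by_cases hk : Even k
    · rw [if_pos hk, if_pos hk, rho_simple, s_apply]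
      simp only [map_add, map_smul, coroot_root, smul_eq_mul]
      module
    · rw [if_neg hk, if_neg hk, rho_simple, s_apply]
      simp only [map_add, map_smul, coroot_root, smul_eq_mul]
      module
  have e0 : D.rho (cm.toCoxeterSystem.wordProd (alternatingWord a t 0)) (D.root a) =
      (1 : ℤ) • D.root a + (0 : ℤ) • D.root t := by simp [alternatingWord]
  rcases D.compat a t hat with ⟨h, h1, h2⟩ | ⟨h, h1, h2⟩ | ⟨h, h12⟩ | ⟨h, h12⟩ | ⟨h, h1, h2, h3⟩
  · have e1 := step 0 _ _ e0
    simp only [h1, h2, Even.zero, if_true] at e1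
    have hk : k < 2 := by have := hk (by omega); omega
    interval_cases k
    exacts [⟨_, _, by norm_num, by norm_num, e0⟩, ⟨_, _, by norm_num, by norm_num, e1⟩]
  · have e1 := step 0 _ _ e0
    rw [if_pos (by decide)] at e1
    have e2 := step 1 _ _ e1
    rw [if_neg (by decide)] at e2
    simp only [h1, h2] at e1 e2
    have hk : k < 3 := by have := hk (by omega); omega
    interval_cases k
    exacts [⟨_, _, by norm_num, by norm_num, e0⟩, ⟨_, _, by norm_num, by norm_num, e1⟩,
      ⟨_, _, by norm_num, by norm_num, e2⟩]
  · have e1 := step 0 _ _ e0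
    rw [if_pos (by decide)] at e1
    have e2 := step 1 _ _ e1
    rw [if_neg (by decide)] at e2
    have e3 := step 2 _ _ e2
    rw [if_pos (by decide)] at e3
    have hk : k < 4 := by have := hk (by omega); omega
    rcases h12 with ⟨h1, h2⟩ | ⟨h1, h2⟩
    all_goals
      simp only [h1, h2] at e1 e2 e3
      interval_cases k
      exacts [⟨_, _, by norm_num, by norm_num, e0⟩, ⟨_, _, by norm_num, by norm_num, e1⟩,
        ⟨_, _, by norm_num, by norm_num, e2⟩, ⟨_, _, by norm_num, by norm_num, e3⟩]
  · have e1 := step 0 _ _ e0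
    rw [if_pos (by decide)] at e1
    have e2 := step 1 _ _ e1
    rw [if_neg (by decide)] at e2
    have e3 := step 2 _ _ e2
    rw [if_pos (by decide)] at e3
    have e4 := step 3 _ _ e3
    rw [if_neg (by decide)] at e4
    have e5 := step 4 _ _ e4
    rw [if_pos (by decide)] at e5
    have hk : k < 6 := by have := hk (by omega); omega
    rcases h12 with ⟨h1, h2⟩ | ⟨h1, h2⟩
    all_goals
      simp only [h1, h2] at e1 e2 e3 e4 e5
      interval_cases k
      exacts [⟨_, _, by norm_num, by norm_num, e0⟩, ⟨_, _, by norm_num, by norm_num, e1⟩,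
        ⟨_, _, by norm_num, by norm_num, e2⟩, ⟨_, _, by norm_num, by norm_num, e3⟩,
        ⟨_, _, by norm_num, by norm_num, e4⟩, ⟨_, _, by norm_num, by norm_num, e5⟩]
  · obtain ⟨x, y, hx, hy, -, e⟩ := D.rho_alternatingWord_infinite a t h1 h2 h3 k
    exact ⟨x, y, hx, hy, e⟩

open CoxeterSystem in
theorem exists_alternatingWord_append (a t : ι) (m n : ℕ) :
    ∃ ω : List ι, ω.length = n ∧ alternatingWord a t (n + m) = ω ++ alternatingWord a t m := by
  induction n with
  | zero => exact ⟨[], rfl, by simp⟩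
  | succ n ih =>
    obtain ⟨ω, h1, h2⟩ := ih
    refine ⟨(if Even (n + m) then t else a) :: ω, by simp [h1], ?_⟩
    rw [show n + 1 + m = (n + m) + 1 by ring, alternatingWord_succ', h2]
    rfl

theorem zsmul_mem_cone {x : M} (hx : x ∈ D.cone) {n : ℤ} (hn : 0 ≤ n) : n • x ∈ D.cone := by
  lift n to ℕ using hn
  rw [natCast_zsmul]
  exact D.cone.nsmul_mem hx n

open CoxeterSystem in
/-- If `ℓ(w s_a) > ℓ(w)`, then `w` maps the simple root `a` to a positive root. -/
theorem rho_root_mem_cone (w : cm.Group) (a : ι)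
    (h : ¬ cm.toCoxeterSystem.IsRightDescent w a) : D.rho w (D.root a) ∈ D.cone := by
  set cs := cm.toCoxeterSystem with hcs
  induction hn : cs.length w using Nat.strong_induction_on generalizing w a with
  | _ n ih =>
  subst hn
  by_cases hw : w = 1
  · subst hw
    simpa using D.root_mem_cone a
  obtain ⟨t, ht⟩ := cs.exists_rightDescent_of_ne_one hw
  have hat : a ≠ t := fun e => h (e ▸ ht)
  -- `K k` splits off from the right of `w` an alternating word in `a` and `t` of length `k`, with
  -- additive lengths. For the greatest such `k` the remaining `v` is the shortest element of its
  -- coset of the dihedral subgroup.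
  let K : ℕ → Prop := fun k => ∃ v, w = v * cs.wordProd (alternatingWord a t k) ∧
    cs.length v + k = cs.length w
  have hK1 : K 1 := by
    refine ⟨w * cs.simple t, ?_, cs.isRightDescent_iff.1 ht⟩
    simp [alternatingWord]
  have hKle : ∀ k, K k → k ≤ cs.length w := by
    rintro k ⟨v, -, hv⟩; omega
  classical
  obtain ⟨k, ⟨v, hwv, hlv⟩, hkmax, hk1⟩ : ∃ k, K k ∧ ¬ K (k + 1) ∧ 1 ≤ k := by
    refine ⟨Nat.findGreatest K (cs.length w), Nat.findGreatest_spec (hKle 1 hK1) hK1, fun hc => ?_,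
      Nat.le_findGreatest (hKle 1 hK1) hK1⟩
    have := Nat.le_findGreatest (hKle _ hc) hc
    omega
  obtain ⟨k', rfl⟩ : ∃ k', k = k' + 1 := ⟨k - 1, by omega⟩
  -- Neither `a` nor `t` is a right descent of `v`: one of them would lengthen the alternating word
  -- beyond the maximum, the other would contradict the additivity of lengths.
  have hv1 : ¬ cs.IsRightDescent v (if Even (k' + 1) then t else a) := by
    intro hd
    apply hkmax
    refine ⟨v * cs.simple (if Even (k' + 1) then t else a), ?_, ?_⟩
    · rw [alternatingWord_succ' a t (k' + 1), wordProd_cons, mul_assoc,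
        simple_mul_simple_cancel_left, hwv]
    · have := cs.isRightDescent_iff.1 hd
      omega
  have hv2 : ¬ cs.IsRightDescent v (if Even k' then t else a) := by
    intro hd
    have h1 := cs.isRightDescent_iff.1 hd
    have h2 : w = (v * cs.simple (if Even k' then t else a)) *
        cs.wordProd (alternatingWord a t k') := by
      rw [hwv, alternatingWord_succ' a t k', wordProd_cons, mul_assoc]
    have h3 := cs.length_mul_le (v * cs.simple (if Even k' then t else a))
        (cs.wordProd (alternatingWord a t k'))
    have h4 := cs.length_wordProd_le (alternatingWord a t k')
    rw [length_alternatingWord] at h4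
    rw [← h2] at h3
    omega
  have hva : ¬ cs.IsRightDescent v a ∧ ¬ cs.IsRightDescent v t := by
    by_cases he : Even k'
    · rw [if_neg (by simpa [Nat.even_add_one] using he)] at hv1
      rw [if_pos he] at hv2
      exact ⟨hv1, hv2⟩
    · rw [if_pos (by simpa [Nat.even_add_one] using he)] at hv1
      rw [if_neg he] at hv2
      exact ⟨hv2, hv1⟩
  have pa := ih _ (by omega) v a hva.1 rfl
  have pt := ih _ (by omega) v t hva.2 rfl
  -- An alternating word that reaches the order of the product can be rewritten by the braid
  -- relation so as to end in `a`, which would make `a` a right descent of `w`.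
  have hkm : cm a t ≠ 0 → k' + 1 < cm a t := by
    intro hm
    by_contra hge
    obtain ⟨m, hm'⟩ : ∃ m, cm a t = m + 1 := ⟨cm a t - 1, by omega⟩
    obtain ⟨ω, hω, hsplit⟩ := exists_alternatingWord_append a t (cm a t) (k' + 1 - cm a t)
    rw [Nat.sub_add_cancel (by omega)] at hsplit
    apply h
    have e : w * cs.simple a = v * cs.wordProd (ω ++ alternatingWord a t m) := by
      rw [hwv, hsplit, wordProd_append, wordProd_append, cs.wordProd_braidWord_eq a t, braidWord,
        cm.symmetric t a, hm', alternatingWord_succ, wordProd_concat]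
      simp only [mul_assoc, simple_mul_simple_self, mul_one]
    have h3 := cs.length_mul_le v (cs.wordProd (ω ++ alternatingWord a t m))
    have h4 := cs.length_wordProd_le (ω ++ alternatingWord a t m)
    rw [List.length_append, length_alternatingWord, hω] at h4
    change cs.length _ < cs.length _
    rw [e]
    omega
  obtain ⟨x, y, hx, hy, e⟩ := D.rho_alternatingWord_nonneg hat (k' + 1) hkm
  rw [hwv, map_mul, LinearEquiv.mul_apply, e, map_add, map_smul, map_smul]
  exact D.cone.add_mem (D.zsmul_mem_cone pa hx) (D.zsmul_mem_cone pt hy)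

/-- If `ℓ(w s_a) < ℓ(w)`, then `w` maps the simple root `a` to a negative root. -/
theorem neg_rho_root_mem_cone (w : cm.Group) (a : ι)
    (h : cm.toCoxeterSystem.IsRightDescent w a) : -D.rho w (D.root a) ∈ D.cone := by
  have := D.rho_root_mem_cone (w * cm.toCoxeterSystem.simple a) a
    (cm.toCoxeterSystem.isRightDescent_iff_not_isRightDescent_mul.1 h)
  rwa [map_mul, LinearEquiv.mul_apply, rho_simple, s_root, map_neg] at this

/-! ### Functionals on the cone of positive roots, and twisted involutions -/

section Chamber

variable {R : Type*} [AddCommGroup R] [LinearOrder R] [IsOrderedAddMonoid R]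

theorem nonpos_of_mem_cone (φ : M →+ R) (hφ : ∀ a, φ (D.root a) ≤ 0) {x : M} (hx : x ∈ D.cone) :
    φ x ≤ 0 := by
  induction hx using AddSubmonoid.closure_induction with
  | mem x hx => obtain ⟨a, rfl⟩ := hx; exact hφ a
  | zero => simp
  | add x y _ _ hx hy => rw [map_add]; exact add_nonpos hx hy

theorem exists_nsmul_root_of_mem_cone (φ : M →+ R) (a : ι) (ha : φ (D.root a) = 0)
    (hφ : ∀ b, b ≠ a → φ (D.root b) < 0) {x : M} (hx : x ∈ D.cone) (h0 : φ x = 0) :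
    ∃ c : ℕ, x = c • D.root a := by
  have hφ' : ∀ b, φ (D.root b) ≤ 0 := fun b => by
    by_cases hb : b = a
    · rw [hb, ha]
    · exact (hφ b hb).le
  induction hx using AddSubmonoid.closure_induction with
  | mem x hx =>
    obtain ⟨b, rfl⟩ := hx
    by_cases hb : b = a
    · exact ⟨1, by rw [hb, one_nsmul]⟩
    · exact absurd h0 (hφ b hb).ne
  | zero => exact ⟨0, (zero_nsmul _).symm⟩
  | add x y hx hy ihx ihy =>
    rw [map_add] at h0
    have h1 := D.nonpos_of_mem_cone φ hφ' hx
    have h2 := D.nonpos_of_mem_cone φ hφ' hy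
    have hx0 : φ x = 0 := le_antisymm h1 (by
      rw [← h0]; exact add_le_of_nonpos_right h2)
    have hy0 : φ y = 0 := by rwa [hx0, zero_add] at h0
    obtain ⟨c, hc⟩ := ihx hx0
    obtain ⟨d, hd⟩ := ihy hy0
    exact ⟨c + d, by rw [hc, hd, add_nsmul]⟩

theorem eq_zero_of_mem_cone (φ : M →+ R) (hφ : ∀ b, φ (D.root b) < 0) {x : M} (hx : x ∈ D.cone)
    (h0 : 0 ≤ φ x) : x = 0 := by
  have hφ' : ∀ b, φ (D.root b) ≤ 0 := fun b => (hφ b).le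
  induction hx using AddSubmonoid.closure_induction with
  | mem x hx => obtain ⟨b, rfl⟩ := hx; exact absurd h0 (hφ b).not_ge
  | zero => rfl
  | add x y hx hy ihx ihy =>
    rw [map_add] at h0
    have h1 := D.nonpos_of_mem_cone φ hφ' hx
    have h2 := D.nonpos_of_mem_cone φ hφ' hy
    rw [ihx (h0.trans (add_le_of_nonpos_right h2)), ihy (h0.trans (add_le_of_nonpos_left h1)),
      add_zero]

/-- An element of the Coxeter group that maps a point of the open chamber into the closed chamber
is trivial. -/
theorem eq_one_of_chamber (φ : M →+ R) (hφ : ∀ a, φ (D.root a) < 0) (w : cm.Group)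
    (hw : ∀ a, φ (D.rho w (D.root a)) ≤ 0) : w = 1 := by
  by_contra hne
  obtain ⟨a, ha⟩ := cm.toCoxeterSystem.exists_rightDescent_of_ne_one hne
  have h1 := D.neg_rho_root_mem_cone w a ha
  have h2 := D.eq_zero_of_mem_cone φ hφ h1 (by rw [map_neg]; exact neg_nonneg.2 (hw a))
  rw [neg_eq_zero, LinearEquiv.map_eq_zero_iff] at h2
  exact D.root_ne_zero a h2

theorem rho_injective (φ : M →+ R) (hφ : ∀ a, φ (D.root a) < 0) : Function.Injective D.rho := by
  rw [injective_iff_map_eq_one]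
  intro w hw
  refine D.eq_one_of_chamber φ hφ w fun a => ?_
  rw [hw]
  exact (hφ a).le

/-- Let `L` be an involution that is a product of an element of the Coxeter group and an
automorphism of the simple roots. Then some conjugate of `L` is that automorphism, or negates a
simple root. -/
theorem exists_conj_eq_or_root_neg
    (hfacet : ∀ a, ∃ φ : M →+ R, φ (D.root a) = 0 ∧ ∀ b, b ≠ a → φ (D.root b) < 0)
    (t : M ≃ₗ[ℤ] M) (σ : Equiv.Perm ι) (ht : ∀ a, t (D.root a) = D.root (σ a))
    (hts : ∀ a, t * D.s a = D.s (σ a) * t) (y : cm.Group) (hinv : (D.rho y * t) * (D.rho y * t) = 1) :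
    ∃ w : cm.Group, D.rho w * (D.rho y * t) * (D.rho w)⁻¹ = t ∨
      ∃ a, (D.rho w * (D.rho y * t) * (D.rho w)⁻¹) (D.root a) = -D.root a := by
  set cs := cm.toCoxeterSystem with hcs
  induction hn : cs.length y using Nat.strong_induction_on generalizing y with
  | _ n ih =>
  subst hn
  by_cases hy : y = 1
  · exact ⟨1, Or.inl (by simp [hy])⟩
  obtain ⟨a, ha⟩ := cs.exists_leftDescent_of_ne_one hy
  have hsinv : (D.s a)⁻¹ = D.s a := inv_eq_of_mul_eq_one_right (D.s_mul_s a)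
  have hconj : D.rho (cs.simple a * y * cs.simple (σ a)) * t =
      D.s a * (D.rho y * t) * (D.s a)⁻¹ := by
    rw [map_mul, map_mul, rho_simple, rho_simple, hsinv]
    simp only [mul_assoc]
    rw [hts]
  -- Conjugating `D.rho y * t` by `D.s a` replaces `y` by its twisted conjugate. Either this is
  -- shorter and the induction applies, or `a` is already a root that gets negated.
  by_cases hlt : cs.length (cs.simple a * y * cs.simple (σ a)) < cs.length y
  · obtain ⟨w, hw⟩ := ih _ hlt (cs.simple a * y * cs.simple (σ a)) (by
      rw [hconj]
      calc _ = D.s a * ((D.rho y * t) * (D.rho y * t)) * (D.s a)⁻¹ := by group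
        _ = 1 := by rw [hinv]; group) rfl
    have e : D.rho w * (D.rho (cs.simple a * y * cs.simple (σ a)) * t) * (D.rho w)⁻¹ =
        D.rho (w * cs.simple a) * (D.rho y * t) * (D.rho (w * cs.simple a))⁻¹ := by
      rw [hconj, map_mul, rho_simple]
      group
    rw [e] at hw
    exact ⟨_, hw⟩
  -- Here both `D.s a (L (D.root a))` and `-L (D.root a)` lie in the cone. A functional that
  -- vanishes on the root of `a` and is negative on the others takes opposite values at these two,
  -- hence vanishes on both. So `-L (D.root a)` is a multiple of the root, and `L` being an
  -- involution makes the factor 1.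
  · refine ⟨1, Or.inr ⟨a, ?_⟩⟩
    rw [map_one, one_mul, inv_one, mul_one]
    set L := D.rho y * t with hL
    have hLL : ∀ x, L (L x) = x := fun x => by
      rw [← LinearEquiv.mul_apply, hinv]; rfl
    have hd := cs.isLeftDescent_iff.1 ha
    have hpos : D.s a (L (D.root a)) ∈ D.cone := by
      have := D.rho_root_mem_cone (cs.simple a * y) (σ a) (by
        intro hc
        have h1 : cs.length (cs.simple a * y * cs.simple (σ a)) < cs.length (cs.simple a * y) := hc
        omega)
      rwa [map_mul, rho_simple, LinearEquiv.mul_apply, ← ht, ← LinearEquiv.mul_apply (D.rho y)]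
        at this
    have hneg : -L (D.root a) ∈ D.cone := by
      have h1 := D.neg_rho_root_mem_cone y⁻¹ a (cs.isRightDescent_inv_iff.2 ha)
      have h2 : L (D.root a) = t⁻¹ (D.rho y⁻¹ (D.root a)) := by
        have : L = t⁻¹ * D.rho y⁻¹ := by
          rw [eq_comm, map_inv, ← mul_inv_rev, inv_eq_of_mul_eq_one_right hinv]
        rw [this]; rfl
      rw [h2, ← map_neg]
      generalize -D.rho y⁻¹ (D.root a) = z at h1
      induction h1 using AddSubmonoid.closure_induction with
      | mem x hx =>
        obtain ⟨b, rfl⟩ := hx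
        have : t⁻¹ (D.root b) = D.root (σ.symm b) := by
          apply t.injective
          rw [ht, Equiv.apply_symm_apply]
          exact t.apply_symm_apply _
        rw [this]
        exact D.root_mem_cone _
      | zero => rw [map_zero]; exact D.cone.zero_mem
      | add x y _ _ hx hy => rw [map_add]; exact D.cone.add_mem hx hy
    obtain ⟨φ, h0, hφ⟩ := hfacet a
    have hφ' : ∀ b, φ (D.root b) ≤ 0 := fun b => by
      by_cases hb : b = a
      · rw [hb, h0]
      · exact (hφ b hb).le
    have e1 : φ (D.s a (L (D.root a))) = φ (L (D.root a)) := by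
      rw [s_apply, map_sub, map_zsmul, h0, smul_zero, sub_zero]
    have e2 := D.nonpos_of_mem_cone φ hφ' hpos
    have e3 := D.nonpos_of_mem_cone φ hφ' hneg
    obtain ⟨c, hc⟩ := D.exists_nsmul_root_of_mem_cone φ a h0 hφ hneg (by
      refine le_antisymm e3 ?_
      rw [map_neg, neg_nonneg, ← e1]
      exact e2)
    have hc' : L (D.root a) = -((c : ℤ) • D.root a) := by
      rw [natCast_zsmul, ← hc, neg_neg]
    have h4 := hLL (D.root a)
    rw [hc', map_neg, map_smul, hc', smul_neg, neg_neg, smul_smul] at h4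
    have h5 := congrArg (D.coroot a) h4
    rw [map_smul, coroot_root, smul_eq_mul] at h5
    have h6 : c = 1 := by
      have : (c : ℤ) * c = 1 := by linarith
      have h7 : c * c = 1 := by exact_mod_cast this
      exact Nat.eq_one_of_mul_eq_one_right h7
    rw [hc', h6, Nat.cast_one, one_smul]

end Chamber

end CartanRealization

namespace RealCubic

/-! ### The integral model of the real lattices -/

/-- The coefficients of the diagonal form on `Λⱼ = ℤ^{5-j} ⊕ θℤ^j`. -/
def wt (j i : Fin 5) : ℤ := if i = 0 then -1 else if 5 ≤ (i : ℕ) + (j : ℕ) then 3 else 1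

/-- The form of `Λⱼ` in coordinates, with arbitrary coefficients. -/
def bil {R : Type*} [CommRing R] (j : Fin 5) (x y : Fin 5 → R) : R :=
  ∑ i, (wt j i : R) * x i * y i

section Form

variable {R : Type*} [CommRing R] (j : Fin 5)

theorem bil_comm (x y : Fin 5 → R) : bil j x y = bil j y x := by
  unfold bil; exact Finset.sum_congr rfl fun i _ => by ring

theorem bil_add_left (x y z : Fin 5 → R) : bil j (x + y) z = bil j x z + bil j y z := by
  unfold bil; rw [← Finset.sum_add_distrib]
  exact Finset.sum_congr rfl fun i _ => by rw [Pi.add_apply]; ring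

theorem bil_sub_left (x y z : Fin 5 → R) : bil j (x - y) z = bil j x z - bil j y z := by
  unfold bil; rw [← Finset.sum_sub_distrib]
  exact Finset.sum_congr rfl fun i _ => by rw [Pi.sub_apply]; ring

theorem bil_smul_left (c : R) (x z : Fin 5 → R) : bil j (c • x) z = c * bil j x z := by
  unfold bil; rw [Finset.mul_sum]
  exact Finset.sum_congr rfl fun i _ => by rw [Pi.smul_apply, smul_eq_mul]; ring

theorem bil_neg_left (x z : Fin 5 → R) : bil j (-x) z = -bil j x z := by
  rw [← neg_one_smul R x, bil_smul_left, neg_one_mul]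

theorem bil_add_right (x y z : Fin 5 → R) : bil j x (y + z) = bil j x y + bil j x z := by
  rw [bil_comm, bil_add_left, bil_comm, bil_comm j z]

theorem bil_sub_right (x y z : Fin 5 → R) : bil j x (y - z) = bil j x y - bil j x z := by
  rw [bil_comm, bil_sub_left, bil_comm, bil_comm j z]

theorem bil_smul_right (c : R) (x z : Fin 5 → R) : bil j x (c • z) = c * bil j x z := by
  rw [bil_comm, bil_smul_left, bil_comm]

theorem bil_neg_right (x z : Fin 5 → R) : bil j x (-z) = -bil j x z := by
  rw [bil_comm, bil_neg_left, bil_comm]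

theorem bil_single_right (x : Fin 5 → R) (i : Fin 5) (c : R) :
    bil j x (Pi.single i c) = (wt j i : R) * x i * c := by
  unfold bil
  rw [Finset.sum_eq_single i]
  · rw [Pi.single_eq_same]
  · intro k _ hk
    rw [Pi.single_eq_of_ne hk, mul_zero]
  · intro h; exact absurd (Finset.mem_univ i) h

end Form

theorem wt_pos (j : Fin 5) {i : Fin 5} (hi : i ≠ 0) : 1 ≤ wt j i := by
  unfold wt
  rw [if_neg hi]
  split <;> norm_num

/-! ### The Lorentzian form and its future cone -/

section Lorentz

variable {R : Type*} [CommRing R] [LinearOrder R] [IsStrictOrderedRing R] (j : Fin 5)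

/-- The spatial part of the form. -/
def spat {R : Type*} [CommRing R] (j : Fin 5) (x y : Fin 5 → R) : R :=
  (wt j 1 : R) * (x 1 * y 1) + (wt j 2 : R) * (x 2 * y 2) + (wt j 3 : R) * (x 3 * y 3)
    + (wt j 4 : R) * (x 4 * y 4)

theorem bil_eq {R : Type*} [CommRing R] (j : Fin 5) (x y : Fin 5 → R) :
    bil j x y = -(x 0 * y 0) + spat j x y := by
  unfold bil spat
  rw [Fin.sum_univ_five]
  simp only [show wt j 0 = -1 from rfl]
  push_cast
  ring

theorem wt_cast_pos {i : Fin 5} (hi : i ≠ 0) : (0 : R) < (wt j i : R) :=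
  Int.cast_pos.2 (wt_pos j hi)

theorem spat_self_nonneg (x : Fin 5 → R) : 0 ≤ spat j x x := by
  unfold spat
  have h1 := (wt_cast_pos (R := R) j (i := 1) (by decide)).le
  have h2 := (wt_cast_pos (R := R) j (i := 2) (by decide)).le
  have h3 := (wt_cast_pos (R := R) j (i := 3) (by decide)).le
  have h4 := (wt_cast_pos (R := R) j (i := 4) (by decide)).le
  have := mul_nonneg h1 (mul_self_nonneg (x 1))
  have := mul_nonneg h2 (mul_self_nonneg (x 2))
  have := mul_nonneg h3 (mul_self_nonneg (x 3))
  have := mul_nonneg h4 (mul_self_nonneg (x 4))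
  linarith

/-- By Lagrange's identity the difference of the two sides is a sum of squares with positive
coefficients. -/
theorem spat_cauchy (x y : Fin 5 → R) : spat j x y ^ 2 ≤ spat j x x * spat j y y := by
  unfold spat
  have h1 := (wt_cast_pos (R := R) j (i := 1) (by decide)).le
  have h2 := (wt_cast_pos (R := R) j (i := 2) (by decide)).le
  have h3 := (wt_cast_pos (R := R) j (i := 3) (by decide)).le
  have h4 := (wt_cast_pos (R := R) j (i := 4) (by decide)).le
  generalize (wt j 1 : R) = a at *
  generalize (wt j 2 : R) = b at *
  generalize (wt j 3 : R) = c at *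
  generalize (wt j 4 : R) = d at *
  have e12 := mul_nonneg (mul_nonneg h1 h2) (sq_nonneg (x 1 * y 2 - x 2 * y 1))
  have e13 := mul_nonneg (mul_nonneg h1 h3) (sq_nonneg (x 1 * y 3 - x 3 * y 1))
  have e14 := mul_nonneg (mul_nonneg h1 h4) (sq_nonneg (x 1 * y 4 - x 4 * y 1))
  have e23 := mul_nonneg (mul_nonneg h2 h3) (sq_nonneg (x 2 * y 3 - x 3 * y 2))
  have e24 := mul_nonneg (mul_nonneg h2 h4) (sq_nonneg (x 2 * y 4 - x 4 * y 2))
  have e34 := mul_nonneg (mul_nonneg h3 h4) (sq_nonneg (x 3 * y 4 - x 4 * y 3))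
  linear_combination e12 + e13 + e14 + e23 + e24 + e34

theorem time_ne_zero {x : Fin 5 → R} (hx : bil j x x < 0) : x 0 ≠ 0 := by
  intro h
  rw [bil_eq, h] at hx
  have := spat_self_nonneg j x
  linarith

/-- A vector of non-positive norm orthogonal to a negative vector vanishes. -/
theorem eq_zero_of_orthogonal {x n : Fin 5 → R} (hx : bil j x x < 0) (hn : bil j n n ≤ 0)
    (h : bil j x n = 0) : n = 0 := by
  have hx0 := time_ne_zero j hx
  rw [bil_eq] at hx hn h
  have hc := spat_cauchy j x n
  have hs := spat_self_nonneg j n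
  have hn0 : n 0 = 0 := by
    by_contra hne
    have h1 : spat j x n = x 0 * n 0 := by linarith
    rw [h1] at hc
    have h2 : 0 < n 0 * n 0 := mul_self_pos.2 hne
    have h3 : spat j x x * spat j n n ≤ spat j x x * (n 0 * n 0) :=
      mul_le_mul_of_nonneg_left (by linarith) (spat_self_nonneg j x)
    have h4 : spat j x x * (n 0 * n 0) < (x 0 * x 0) * (n 0 * n 0) :=
      mul_lt_mul_of_pos_right (by linarith) h2
    nlinarith
  rw [hn0] at hn
  have h0 : spat j n n = 0 := le_antisymm (by linarith) hs
  unfold spat at h0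
  have p1 := wt_cast_pos (R := R) j (i := 1) (by decide)
  have p2 := wt_cast_pos (R := R) j (i := 2) (by decide)
  have p3 := wt_cast_pos (R := R) j (i := 3) (by decide)
  have p4 := wt_cast_pos (R := R) j (i := 4) (by decide)
  have q1 := mul_nonneg p1.le (mul_self_nonneg (n 1))
  have q2 := mul_nonneg p2.le (mul_self_nonneg (n 2))
  have q3 := mul_nonneg p3.le (mul_self_nonneg (n 3))
  have q4 := mul_nonneg p4.le (mul_self_nonneg (n 4))
  have z : ∀ i : Fin 5, (0 : R) < wt j i → (wt j i : R) * (n i * n i) = 0 → n i = 0 := by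
    intro i hi h
    exact mul_self_eq_zero.1 ((mul_eq_zero.1 h).resolve_left hi.ne')
  ext i
  fin_cases i
  · exact hn0
  · exact z 1 p1 (by linarith)
  · exact z 2 p2 (by linarith)
  · exact z 3 p3 (by linarith)
  · exact z 4 p4 (by linarith)

/-- The future cone: negative vectors with positive time coordinate. -/
def Future {R : Type*} [CommRing R] [LinearOrder R] (j : Fin 5) (x : Fin 5 → R) : Prop :=
  bil j x x < 0 ∧ 0 < x 0

/-- The reversed Cauchy–Schwarz inequality: for future vectors the product of the time coordinates
dominates the spatial product. -/
theorem Future.bil_neg {x y : Fin 5 → R} (hx : Future j x) (hy : Future j y) : bil j x y < 0 := by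
  obtain ⟨hx, hx0⟩ := hx
  obtain ⟨hy, hy0⟩ := hy
  rw [bil_eq] at hx hy ⊢
  have hc := spat_cauchy j x y
  have hs := spat_self_nonneg j y
  have h1 : spat j x x * spat j y y < (x 0 * y 0) ^ 2 := by
    have h3 : spat j x x * spat j y y ≤ (x 0 * x 0) * spat j y y :=
      mul_le_mul_of_nonneg_right (by linarith) hs
    have h4 : (x 0 * x 0) * spat j y y < (x 0 * x 0) * (y 0 * y 0) :=
      mul_lt_mul_of_pos_left (by linarith) (mul_pos hx0 hx0)
    linear_combination h3 + h4
  have h2 : spat j x y < x 0 * y 0 := lt_of_pow_lt_pow_left₀ 2 (mul_pos hx0 hy0).le (hc.trans_lt h1)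
  linarith

theorem Future.of_bil_neg {x y : Fin 5 → R} (hx : Future j x) (hy : bil j y y < 0)
    (h : bil j x y < 0) : Future j y := by
  refine ⟨hy, ?_⟩
  by_contra hle
  have hlt : y 0 < 0 := lt_of_le_of_ne (not_lt.1 hle) (time_ne_zero j hy)
  have : Future j (-y) := ⟨by rw [bil_neg_left, bil_neg_right, neg_neg]; exact hy, by
    rw [Pi.neg_apply]; linarith⟩
  have h2 := hx.bil_neg j this
  rw [bil_neg_right] at h2
  linarith

theorem Future.add {x y : Fin 5 → R} (hx : Future j x) (hy : Future j y) : Future j (x + y) := by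
  refine ⟨?_, add_pos hx.2 hy.2⟩
  rw [bil_add_left, bil_add_right, bil_add_right, bil_comm j y x]
  have := hx.bil_neg j hy
  linarith [hx.1, hy.1]

theorem Future.smul {x : Fin 5 → R} (hx : Future j x) {c : R} (hc : 0 < c) :
    Future j (c • x) := by
  refine ⟨?_, mul_pos hc hx.2⟩
  rw [bil_smul_left, bil_smul_right, ← mul_assoc]
  exact mul_neg_of_pos_of_neg (mul_pos hc hc) hx.1

end Lorentz

/-! ### Roots and coroots -/

/-- The lattice `Λⱼ` in coordinates. -/
abbrev Z5 : Type := Fin 5 → ℤ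

/-- The simple roots in coordinates. -/
def rootZ : (j : Fin 5) → Fin (numNodes j) → Z5
  | 0 => ![![0, 1, -1, 0, 0], ![0, 0, 1, -1, 0], ![0, 0, 0, 1, -1], ![0, 0, 0, 0, 1],
      ![1, -1, -1, -1, 0]]
  | 1 => ![![0, 1, -1, 0, 0], ![0, 0, 1, -1, 0], ![0, 0, 0, 1, 0], ![0, 0, 0, 0, 1],
      ![1, 0, 0, 0, -1], ![1, -1, -1, -1, 0], ![3, -3, 0, 0, -1]]
  | 2 => ![![0, 1, -1, 0, 0], ![0, 0, 1, 0, 0], ![0, 0, 0, -1, 1], ![0, 0, 0, 1, 0],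
      ![1, 0, 0, 0, -1], ![1, -1, -1, 0, 0], ![3, -3, 0, -1, -1]]
  | 3 => ![![0, 1, 0, 0, 0], ![0, 0, 0, -1, 1], ![0, 0, -1, 1, 0],
      ![0, 0, 1, 0, 0], ![1, 0, 0, 0, -1], ![3, -3, 0, -1, -1],
      ![3, -1, -1, -1, -1]]
  | 4 => ![![0, 0, 0, -1, 1], ![0, 0, -1, 1, 0], ![0, -1, 1, 0, 0],
      ![0, 1, 0, 0, 0], ![1, 0, 0, 0, -1], ![3, -1, -1, -1, -1]]

theorem bil_rootZ_self (j : Fin 5) (a : Fin (numNodes j)) :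
    bil j (rootZ j a) (rootZ j a) = nodeNorm j a := by
  revert j; decide +kernel

theorem nodeNorm_pos (j : Fin 5) (a : Fin (numNodes j)) : (0 : ℤ) < nodeNorm j a := by
  revert j; decide +kernel

/-- The coefficients of the simple coroots. -/
def corootCoeff (j : Fin 5) (a : Fin (numNodes j)) (i : Fin 5) : ℤ :=
  2 * wt j i * rootZ j a i / nodeNorm j a

/-- The integer division in `corootCoeff` is exact. This is the integrality that makes the simple
reflections preserve Λⱼ. -/
theorem corootCoeff_mul (j : Fin 5) (a : Fin (numNodes j)) (i : Fin 5) :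
    corootCoeff j a i * nodeNorm j a = 2 * wt j i * rootZ j a i := by
  revert i; revert j; decide +kernel

/-- The simple coroots `x ↦ 2 (x·r)/(r·r)`. -/
def corootZ (j : Fin 5) (a : Fin (numNodes j)) : Z5 →ₗ[ℤ] ℤ where
  toFun x := ∑ i, corootCoeff j a i * x i
  map_add' x y := by simp [mul_add, Finset.sum_add_distrib]
  map_smul' c x := by
    simp only [Pi.smul_apply, smul_eq_mul, RingHom.id_apply, Finset.mul_sum]
    exact Finset.sum_congr rfl fun i _ => by ring

theorem corootZ_mul (j : Fin 5) (a : Fin (numNodes j)) (x : Z5) :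
    corootZ j a x * nodeNorm j a = 2 * bil j x (rootZ j a) := by
  change (∑ i, corootCoeff j a i * x i) * _ = 2 * ∑ i, _
  rw [Finset.sum_mul, Finset.mul_sum]
  refine Finset.sum_congr rfl fun i _ => ?_
  rw [mul_right_comm, corootCoeff_mul, Int.cast_id]
  ring

theorem cartanCompat_rootZ (j : Fin 5) (a b : Fin (numNodes j)) (h : a ≠ b) :
    CartanCompat (coxeterMatrix j a b) (∑ i, corootCoeff j a i * rootZ j b i)
      (∑ i, corootCoeff j b i * rootZ j a i) := by
  have hm : coxeterMatrix j a b = (bond j a b).order := if_neg h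
  rw [hm]
  clear hm
  revert j; decide +kernel

/-- The simple roots and coroots of `Λⱼ` realize the Coxeter matrix of the diagram. -/
def realization (j : Fin 5) : CartanRealization (coxeterMatrix j) Z5 where
  root := rootZ j
  coroot := corootZ j
  coroot_root a := by
    have h1 := corootZ_mul j a (rootZ j a)
    rw [bil_rootZ_self] at h1
    exact mul_right_cancel₀ (nodeNorm_pos j a).ne' h1
  compat a b h := cartanCompat_rootZ j a b h

/-! ### Classification of the vectors of norm `-1` in the chamber -/

/-- The first basis vector, a corner of all chambers. -/
def e0 : Z5 := ![1, 0, 0, 0, 0]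

/-- In these lemmas `a`, `b`, `c`, `d` are the spatial coordinates with reversed signs, the
inequalities are the walls of the chamber, and `hN` says that the norm is -1. Here squaring `h5`
shows that `1 ≤ b` would make the mixed products too large; then `x0 ^ 2 = 1 + a ^ 2` leaves only `a
= 0`. -/
theorem classify_zero {x0 a b c d : ℤ} (h1 : b ≤ a) (h2 : c ≤ b) (h3 : d ≤ c) (h4 : 0 ≤ d)
    (h5 : a + b + c ≤ x0) (hN : x0 ^ 2 = 1 + a ^ 2 + b ^ 2 + c ^ 2 + d ^ 2) :
    x0 = 1 ∧ a = 0 ∧ b = 0 ∧ c = 0 ∧ d = 0 := by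
  have hb : b = 0 := by
    by_contra hb
    have : 1 ≤ b := by omega
    nlinarith
  obtain rfl : c = 0 := by omega
  obtain rfl : d = 0 := by omega
  subst hb
  have ha : a = 0 := by
    by_contra ha
    have : 1 ≤ a := by omega
    have : a + 1 ≤ x0 := by nlinarith
    nlinarith
  subst ha
  refine ⟨?_, rfl, rfl, rfl, rfl⟩
  nlinarith

/-- The norm equation can be written as a sum of products of nonnegative integers equal to 1. The
summand with coefficient 3 then vanishes and at most one of the others is 1, so few cases remain. -/
theorem classify_one {x0 a b c d : ℤ} (h1 : b ≤ a) (h2 : c ≤ b) (h3 : 0 ≤ c) (h4 : 0 ≤ d)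
    (h5 : 3 * d ≤ x0) (h6 : a + b + c ≤ x0) (h7 : a + d ≤ x0)
    (hN : x0 ^ 2 = 1 + a ^ 2 + b ^ 2 + c ^ 2 + 3 * d ^ 2) :
    (x0 = 1 ∧ a = 0 ∧ b = 0 ∧ c = 0 ∧ d = 0) ∨ (x0 = 3 ∧ a = 2 ∧ b = 1 ∧ c = 0 ∧ d = 1) := by
  obtain ⟨u, hu⟩ : ∃ u, u = x0 - a := ⟨_, rfl⟩
  have e : u * ((a - b) + (x0 - 3 * d)) + (x0 - a - b - c) * b + 3 * ((x0 - a - d) * d)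
      + c * (b - c) = 1 := by subst hu; linear_combination hN
  have t1 : 0 ≤ u * ((a - b) + (x0 - 3 * d)) := mul_nonneg (by omega) (by omega)
  have t2 : 0 ≤ (x0 - a - b - c) * b := mul_nonneg (by omega) (by omega)
  have t3 : 0 ≤ (x0 - a - d) * d := mul_nonneg (by omega) (by omega)
  have t4 : 0 ≤ c * (b - c) := mul_nonneg (by omega) (by omega)
  have t3' : (x0 - a - d) * d = 0 := by omega
  have hu1 : 1 ≤ u := by
    by_contra hlt
    have hb : b = 0 := by omega
    have hc : c = 0 := by omega
    have hu0 : u = 0 := by omega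
    rw [hb, hc, hu0, t3'] at e
    norm_num at e
  rcases mul_eq_zero.1 t3' with h | h
  · have hp : (a - b) + (x0 - 3 * d) ≤ 1 := by nlinarith
    rcases eq_or_ne ((a - b) + (x0 - 3 * d)) 0 with h0 | h0
    · omega
    · have hp1 : (a - b) + (x0 - 3 * d) = 1 := by omega
      rw [hp1] at e t1
      have hu1 : u = 1 := by omega
      have hb1 : b ≤ 1 := by omega
      have hb0 : b = 0 ∨ b = 1 := by omega
      rcases hb0 with hb0 | hb0 <;> omega
  · subst h
    have hp : (a - b) + x0 ≤ 1 := by nlinarith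
    left; omega

/-- Again a sum of products of nonnegative factors equals 1; both summands with coefficient 3
vanish. The third solution is not in the orbit of `e0` and is ruled out later by parity. -/
theorem classify_two {x0 a b c d : ℤ} (h1 : b ≤ a) (h2 : 0 ≤ b) (h3 : c ≤ d) (h4 : 0 ≤ c)
    (h5 : 3 * d ≤ x0) (h6 : a + b ≤ x0) (h7 : a + c + d ≤ x0)
    (hN : x0 ^ 2 = 1 + a ^ 2 + b ^ 2 + 3 * c ^ 2 + 3 * d ^ 2) :
    (x0 = 1 ∧ a = 0 ∧ b = 0 ∧ c = 0 ∧ d = 0) ∨ (x0 = 3 ∧ a = 2 ∧ b = 1 ∧ c = 0 ∧ d = 1) ∨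
      (x0 = 3 ∧ a = 1 ∧ b = 1 ∧ c = 1 ∧ d = 1) := by
  obtain ⟨u, hu⟩ : ∃ u, u = x0 - a := ⟨_, rfl⟩
  have e : u * ((a - b) + (x0 - 3 * d)) + (x0 - a - b) * b + 3 * ((x0 - a - c - d) * d)
      + 3 * (c * (d - c)) = 1 := by subst hu; linear_combination hN
  have t1 : 0 ≤ u * ((a - b) + (x0 - 3 * d)) := mul_nonneg (by omega) (by omega)
  have t2 : 0 ≤ (x0 - a - b) * b := mul_nonneg (by omega) (by omega)
  have t3 : 0 ≤ (x0 - a - c - d) * d := mul_nonneg (by omega) (by omega)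
  have t4 : 0 ≤ c * (d - c) := mul_nonneg (by omega) (by omega)
  have t3' : (x0 - a - c - d) * d = 0 := by omega
  have t4' : c * (d - c) = 0 := by omega
  have hu1 : 1 ≤ u := by
    by_contra hlt
    have hb : b = 0 := by omega
    have hu0 : u = 0 := by omega
    rw [hb, hu0, t3', t4'] at e
    norm_num at e
  have hp : (a - b) + (x0 - 3 * d) ≤ 1 := by nlinarith
  rcases mul_eq_zero.1 t3' with h | h
  · rcases eq_or_ne ((a - b) + (x0 - 3 * d)) 0 with h0 | h0
    · have hcb : (x0 - a - b) * b = 1 := by rw [h0] at e; omega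
      have hb1 : b = 1 := Int.eq_one_of_dvd_one h2 (Dvd.intro_left _ hcb)
      rcases mul_eq_zero.1 t4' with h | h
      · omega
      · subst hb1; omega
    · have hp1 : (a - b) + (x0 - 3 * d) = 1 := by omega
      rw [hp1] at e t1
      have hu1 : u = 1 := by omega
      have hb1 : b ≤ 1 := by omega
      have hb0 : b = 0 ∨ b = 1 := by omega
      rcases hb0 with hb0 | hb0 <;> omega
  · subst h
    left; omega

theorem classify_three {x0 a b c d : ℤ} (h1 : 0 ≤ a) (h2 : c ≤ d) (h3 : b ≤ c) (h4 : 0 ≤ b)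
    (h5 : 3 * d ≤ x0) (h6 : a + c + d ≤ x0) (h7 : a + 3 * b + 3 * c + 3 * d ≤ 3 * x0)
    (hN : x0 ^ 2 = 1 + a ^ 2 + 3 * b ^ 2 + 3 * c ^ 2 + 3 * d ^ 2) :
    x0 = 1 ∧ a = 0 ∧ b = 0 ∧ c = 0 ∧ d = 0 := by
  rcases eq_or_lt_of_le (h4.trans (h3.trans h2)) with hd | hd
  · obtain rfl : c = 0 := by omega
    obtain rfl : b = 0 := by omega
    obtain rfl : d = 0 := by omega
    have ha : a = 0 := by
      by_contra ha
      have : 1 ≤ a := by omega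
      have : a + 1 ≤ x0 := by nlinarith
      nlinarith
    subst ha
    refine ⟨?_, rfl, rfl, rfl, rfl⟩
    nlinarith
  exfalso
  -- If `3 * a ≤ x0`, three times the norm equation is a sum of nonnegative products equal to 3.
  -- Otherwise one of those factors is negative and a different estimate is needed.
  rcases le_or_gt (3 * a) x0 with hA | hB
  · have e : 9 * (b * (d - b)) + 9 * (c * (d - c)) + 3 * ((x0 - 3 * d) * (b + c + d))
        + x0 * (3 * x0 - a - 3 * b - 3 * c - 3 * d) + a * (x0 - 3 * a) = 3 := by
      linear_combination 3 * hN
    have t1 : 0 ≤ b * (d - b) := mul_nonneg (by omega) (by omega)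
    have t2 : 0 ≤ c * (d - c) := mul_nonneg (by omega) (by omega)
    have t3 : 0 ≤ (x0 - 3 * d) * (b + c + d) := mul_nonneg (by omega) (by omega)
    have t4 : 0 ≤ x0 * (3 * x0 - a - 3 * b - 3 * c - 3 * d) := mul_nonneg (by omega) (by omega)
    have t5 : 0 ≤ a * (x0 - 3 * a) := mul_nonneg (by omega) (by omega)
    rcases eq_or_ne (3 * x0 - a - 3 * b - 3 * c - 3 * d) 0 with hc | hc
    · rw [hc] at e
      rcases eq_or_ne a 0 with ha | ha
      · obtain rfl : d = c := by omega
        obtain rfl : d = b := by omega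
        subst ha
        have : x0 = 3 * d := by omega
        subst this
        ring_nf at e
        omega
      · have ha3 : 3 ≤ a := by omega
        rcases eq_or_ne (x0 - 3 * a) 0 with h0 | h0
        · rw [h0] at e
          have : (x0 - 3 * d) * (b + c + d) = 1 := by omega
          have := Int.eq_one_of_dvd_one (by omega) (Dvd.intro_left _ this)
          omega
        · have : 3 ≤ a * (x0 - 3 * a) := by nlinarith [show 1 ≤ x0 - 3 * a by omega]
          have h6 : (x0 - 3 * d) * (b + c + d) = 0 := by omega
          have h7 : x0 - 3 * d = 0 := by
            rcases mul_eq_zero.1 h6 with h | h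
            · exact h
            · omega
          have h8 : x0 - 3 * a = 1 := by
            by_contra hne
            have : 2 ≤ x0 - 3 * a := by omega
            nlinarith
          omega
    · have h1 : 1 ≤ 3 * x0 - a - 3 * b - 3 * c - 3 * d := by omega
      have h2 : x0 * 1 ≤ x0 * (3 * x0 - a - 3 * b - 3 * c - 3 * d) :=
        mul_le_mul_of_nonneg_left h1 (by omega)
      have hx : x0 = 3 := by omega
      subst hx
      have : d = 1 := by omega
      subst this
      omega
  -- The long factor is `3 * (x0 + a)`, split into parts that are nonnegative in this case. Since `c
  -- + d ≤ x0 - a`, the norm equation bounds `c + d` times it from above.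
  · have hu : (c + d) * (12 * d + 4 * (x0 - 3 * d) + (3 * a - x0)) ≤
        (x0 - a) * (12 * d + 4 * (x0 - 3 * d) + (3 * a - x0)) :=
      mul_le_mul_of_nonneg_right (by omega) (by omega)
    have hF : (c + d) * (12 * d + 4 * (x0 - 3 * d) + (3 * a - x0)) ≤
        3 + 9 * b ^ 2 + 9 * c ^ 2 + 9 * d ^ 2 := by linear_combination hu + 3 * hN
    have hcd : 0 ≤ c + d := by omega
    rcases le_or_gt (3 * b + 3 * c) (5 * d) with hs | hs
    · have h8 : (c + d) * (12 * d + 1) ≤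
          (c + d) * (12 * d + 4 * (x0 - 3 * d) + (3 * a - x0)) :=
        mul_le_mul_of_nonneg_left (by omega) hcd
      have h9 : d ^ 2 + 18 * b ^ 2 + 18 * c ^ 2 ≤ 6 * d ^ 2 + 24 * (c * d) := by
        have p1 : 0 ≤ (c - b) * (5 * d - 3 * b - 3 * c) := mul_nonneg (by omega) (by omega)
        have p2 : 0 ≤ (d - c) * (5 * d - 3 * b - 3 * c) := mul_nonneg (by omega) (by omega)
        have p3 : 0 ≤ b * (5 * d - 3 * b - 3 * c) := mul_nonneg (by omega) (by omega)
        have p4 : 0 ≤ b * (c - b) := mul_nonneg (by omega) (by omega)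
        have p5 : 0 ≤ (c - b) * (d - c) := mul_nonneg (by omega) (by omega)
        have p6 : 0 ≤ b * (d - c) := mul_nonneg (by omega) (by omega)
        nlinarith
      rcases le_or_gt d 1 with hd1 | hd1
      · obtain rfl : d = 1 := by omega
        have hc : c = 0 ∨ c = 1 := by omega
        rcases hc with rfl | rfl
        · obtain rfl : b = 0 := by omega
          omega
        · obtain rfl : b = 0 := by omega
          omega
      · nlinarith
    · rcases le_or_gt d 1 with hd1 | hd1
      · obtain rfl : d = 1 := by omega
        obtain rfl : c = 1 := by omega
        obtain rfl : b = 1 := by omega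
        omega
      -- For large `b + c` the lower bound comes from the last wall `h7` combined with `x0 + 1 ≤ 3 *
      -- a`.
      · have h8 : (c + d) * (9 * b + 9 * c - 15 * d + 3) ≤
            (c + d) * (8 * (x0 - 3 * d) + 2 * (3 * a - x0)) :=
          mul_le_mul_of_nonneg_left (by omega) hcd
        have p1 : 0 ≤ b * (c - b) := mul_nonneg (by omega) (by omega)
        have p2 : (d - b) * (2 * (d - b)) ≤ (d - b) * b :=
          mul_le_mul_of_nonneg_left (by omega) (by omega)
        have p3 : (d - c) * (d - c) ≤ (d - b) * (d - b) :=
          mul_le_mul (by omega) (by omega) (by omega) (by omega)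
        have hc2 : 2 ≤ c := by omega
        nlinarith [mul_self_nonneg (d - b)]

/-- In the decomposition `e` every summand except the last carries a coefficient 3, so the last one
equals 1. -/
theorem classify_four {x0 a b c d : ℤ} (h1 : c ≤ d) (h2 : b ≤ c) (h3 : a ≤ b) (h4 : 0 ≤ a)
    (h5 : 3 * d ≤ x0) (h6 : a + b + c + d ≤ x0)
    (hN : x0 ^ 2 = 1 + 3 * a ^ 2 + 3 * b ^ 2 + 3 * c ^ 2 + 3 * d ^ 2) :
    x0 = 1 ∧ a = 0 ∧ b = 0 ∧ c = 0 ∧ d = 0 := by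
  have e : 3 * (a * (d - a)) + 3 * (b * (d - b)) + 3 * (c * (d - c))
      + 3 * (d * (x0 - a - b - c - d)) + (x0 - 3 * d) * x0 = 1 := by linear_combination hN
  have t1 : 0 ≤ a * (d - a) := mul_nonneg (by omega) (by omega)
  have t2 : 0 ≤ b * (d - b) := mul_nonneg (by omega) (by omega)
  have t3 : 0 ≤ c * (d - c) := mul_nonneg (by omega) (by omega)
  have t4 : 0 ≤ d * (x0 - a - b - c - d) := mul_nonneg (by omega) (by omega)
  have t5 : 0 ≤ (x0 - 3 * d) * x0 := mul_nonneg (by omega) (by omega)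
  have h : (x0 - 3 * d) * x0 = 1 := by omega
  have := Int.eq_one_of_dvd_one (by omega) (Dvd.intro_left _ h)
  omega

/-! ### The integral orthogonal groups -/

theorem e0_eq : e0 = Pi.single 0 1 := by decide

theorem bil_e0_right (j : Fin 5) (x : Z5) : bil j x e0 = -x 0 := by
  rw [e0_eq, bil_single_right]
  change -1 * x 0 * 1 = _
  ring

theorem bil_e0_e0 (j : Fin 5) : bil j e0 e0 = -1 := by
  rw [bil_e0_right]; rfl

theorem future_e0 (j : Fin 5) : Future j e0 := ⟨by rw [bil_e0_e0]; norm_num, by decide⟩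

/-- The isometries of `Λⱼ` that preserve the future cone. -/
def OPlus (j : Fin 5) : Subgroup (Z5 ≃ₗ[ℤ] Z5) where
  carrier := {L | (∀ x y, bil j (L x) (L y) = bil j x y) ∧ 0 < L e0 0}
  mul_mem' := by
    rintro L K ⟨hL, hL0⟩ ⟨hK, hK0⟩
    have h1 : Future j (L e0) := ⟨by rw [hL, bil_e0_e0]; norm_num, hL0⟩
    have h2 : Future j (K e0) := ⟨by rw [hK, bil_e0_e0]; norm_num, hK0⟩
    refine ⟨fun x y => by rw [LinearEquiv.mul_apply, LinearEquiv.mul_apply, hL, hK], ?_⟩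
    refine (h1.of_bil_neg j (y := (L * K) e0) ?_ ?_).2
    · rw [LinearEquiv.mul_apply, hL, hK, bil_e0_e0]; norm_num
    · rw [LinearEquiv.mul_apply, hL]
      exact (future_e0 j).bil_neg j h2
  one_mem' := ⟨fun _ _ => rfl, by decide⟩
  inv_mem' := by
    rintro L ⟨hL, hL0⟩
    have key : ∀ x, L (L⁻¹ x) = x := fun x => L.apply_symm_apply x
    have hL' : ∀ x y, bil j (L⁻¹ x) (L⁻¹ y) = bil j x y := fun x y => by rw [← hL, key, key]
    refine ⟨hL', ?_⟩
    have h1 : Future j (L e0) := ⟨by rw [hL, bil_e0_e0]; norm_num, hL0⟩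
    refine ((future_e0 j).of_bil_neg j (y := L⁻¹ e0) ?_ ?_).2
    · rw [hL', bil_e0_e0]; norm_num
    · rw [← hL, key]
      exact h1.bil_neg j (future_e0 j)

theorem OPlus.future {j : Fin 5} {L : Z5 ≃ₗ[ℤ] Z5} (hL : L ∈ OPlus j) {x : Z5}
    (hx : Future j x) : Future j (L x) := by
  have h1 : Future j (L e0) := ⟨by rw [hL.1, bil_e0_e0]; norm_num, hL.2⟩
  refine h1.of_bil_neg j ?_ ?_
  · rw [hL.1]; exact hx.1
  · rw [hL.1]; exact (future_e0 j).bil_neg j hx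

theorem s_apply_root (j : Fin 5) (a : Fin (numNodes j)) (x : Z5) :
    (realization j).s a x = x - corootZ j a x • rootZ j a := rfl

theorem s_mem_OPlus (j : Fin 5) (a : Fin (numNodes j)) : (realization j).s a ∈ OPlus j := by
  have hN := nodeNorm_pos j a
  have hiso : ∀ x y, bil j ((realization j).s a x) ((realization j).s a y) = bil j x y := by
    intro x y
    rw [s_apply_root, s_apply_root]
    simp only [bil_sub_left, bil_sub_right, bil_smul_left, bil_smul_right, bil_rootZ_self,
      bil_comm j (rootZ j a) y]
    have h1 := corootZ_mul j a x
    have h2 := corootZ_mul j a y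
    apply mul_right_cancel₀ hN.ne'
    linear_combination (corootZ j a y * nodeNorm j a - bil j y (rootZ j a)) * h1
      + bil j x (rootZ j a) * h2
  refine ⟨hiso, ((future_e0 j).of_bil_neg j ?_ ?_).2⟩
  · rw [hiso, bil_e0_e0]; norm_num
  · rw [s_apply_root, bil_sub_right, bil_smul_right, bil_e0_e0]
    have h1 := corootZ_mul j a e0
    have : 0 ≤ corootZ j a e0 * bil j e0 (rootZ j a) := by
      have h2 : corootZ j a e0 * (corootZ j a e0 * nodeNorm j a) =
          corootZ j a e0 * (2 * bil j e0 (rootZ j a)) := by rw [h1]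
      have h3 := mul_nonneg (mul_self_nonneg (corootZ j a e0)) hN.le
      linarith
    linarith

theorem rho_mem_OPlus (j : Fin 5) (w : (coxeterMatrix j).Group) :
    (realization j).rho w ∈ OPlus j := by
  induction w using (coxeterMatrix j).toCoxeterSystem.simple_induction with
  | simple a => rw [CartanRealization.rho_simple]; exact s_mem_OPlus j a
  | one => rw [map_one]; exact (OPlus j).one_mem
  | mul w w' h h' => rw [map_mul]; exact (OPlus j).mul_mem h h'

theorem mul_s_eq {j : Fin 5} {t : Z5 ≃ₗ[ℤ] Z5} (ht : t ∈ OPlus j) {a b : Fin (numNodes j)}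
    (hab : t (rootZ j a) = rootZ j b) : t * (realization j).s a = (realization j).s b * t := by
  have hN := nodeNorm_pos j a
  have hNN : (nodeNorm j a : ℤ) = nodeNorm j b := by
    rw [← bil_rootZ_self, ← bil_rootZ_self, ← hab, ht.1]
  refine LinearEquiv.ext fun x => ?_
  rw [LinearEquiv.mul_apply, LinearEquiv.mul_apply, s_apply_root, s_apply_root, map_sub, map_smul,
    hab]
  congr 2
  apply mul_right_cancel₀ hN.ne'
  rw [corootZ_mul]
  conv_rhs => rw [hNN]
  rw [corootZ_mul, ← hab, ht.1]

/-- A vector in the interior of the chamber. -/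
def interiorZ : Fin 5 → Z5
  | 0 => ![10, -4, -3, -2, -1]
  | 1 => ![9, -4, -3, -1, -2]
  | 2 => ![8, -4, -3, -1, -2]
  | 3 => ![10, -4, -1, -2, -3]
  | 4 => ![13, -1, -2, -3, -4]

theorem future_interiorZ (j : Fin 5) : Future j (interiorZ j) := by
  constructor <;> (revert j; decide +kernel)

theorem bil_interiorZ (j : Fin 5) (a : Fin (numNodes j)) : bil j (interiorZ j) (rootZ j a) < 0 := by
  revert j; decide +kernel

/-- A vector in the interior of each facet of the chamber. -/
def facetZ : (j : Fin 5) → Fin (numNodes j) → Z5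
  | 0 => ![![9, -3, -3, -2, -1], ![8, -3, -2, -2, -1], ![7, -3, -2, -1, -1], ![7, -3, -2, -1, 0],
      ![9, -4, -3, -2, -1]]
  | 1 => ![![6, -2, -2, -1, -1], ![5, -2, -1, -1, -1], ![4, -2, -1, 0, -1], ![7, -3, -2, -1, 0],
      ![9, -3, -2, -1, -3], ![6, -3, -2, -1, -1], ![13, -9, -2, -1, -4]]
  | 2 => ![![7, -1, -1, -1, -2], ![7, -1, 0, -1, -2], ![5, -2, -1, -1, -1], ![4, -2, -1, 0, -1],
      ![6, -2, -1, -1, -2], ![9, -5, -4, -1, -2], ![7, -4, -1, -1, -2]]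
  | 3 => ![![10, 0, -1, -2, -3], ![7, -1, -1, -2, -2], ![7, -1, -1, -1, -2], ![7, -1, 0, -1, -2],
      ![9, -1, -1, -2, -3], ![10, -5, -1, -2, -3], ![34, -12, -9, -10, -11]]
  | 4 => ![![10, -1, -2, -3, -3], ![10, -1, -2, -2, -3], ![10, -1, -1, -2, -3],
      ![10, 0, -1, -2, -3], ![12, -1, -2, -3, -4], ![22, -4, -5, -6, -7]]

theorem bil_facetZ (j : Fin 5) (a : Fin (numNodes j)) :
    bil j (facetZ j a) (facetZ j a) < 0 ∧ bil j (facetZ j a) (rootZ j a) = 0 ∧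
      ∀ b, b ≠ a → bil j (facetZ j a) (rootZ j b) < 0 := by
  revert j; decide +kernel

/-! ### The diagram automorphism -/

/-- The isometry of `Λ₁` and of `Λ₂` that realizes the diagram automorphism. -/
def flipLin : Z5 →ₗ[ℤ] Z5 where
  -- The simple roots span rationally, so the permutation of them determines the matrix. One matrix
  -- serves both forms because it fixes the coordinate of index 3, the only one whose coefficient
  -- differs between j = 1 and j = 2.
  toFun x := ![3 * x 0 + 2 * x 1 + x 2 + 3 * x 4, -2 * x 0 - x 1 - x 2 - 3 * x 4,
    -x 0 - x 1 - x 2, x 3, -x 0 - x 1 - x 4]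
  map_add' x y := by
    ext i; fin_cases i <;> simp <;> ring
  map_smul' c x := by
    ext i; fin_cases i <;> simp <;> ring

theorem flipLin_apply (x : Z5) : flipLin x = ![3 * x 0 + 2 * x 1 + x 2 + 3 * x 4,
    -2 * x 0 - x 1 - x 2 - 3 * x 4, -x 0 - x 1 - x 2, x 3, -x 0 - x 1 - x 4] := rfl

theorem flipLin_involutive : Function.Involutive flipLin := by
  intro x
  rw [flipLin_apply, flipLin_apply]
  ext i; fin_cases i <;> simp <;> ring

/-- The isometry realizing the non-trivial diagram automorphism, if there is one. -/
def flip : Fin 5 → Z5 ≃ₗ[ℤ] Z5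
  | 1 => LinearEquiv.ofInvolutive flipLin flipLin_involutive
  | 2 => LinearEquiv.ofInvolutive flipLin flipLin_involutive
  | _ => 1

/-- The diagram automorphism for `j = 1`. -/
def flipPermOne : Equiv.Perm (Fin 7) :=
  ⟨![4, 5, 2, 6, 0, 1, 3], ![4, 5, 2, 6, 0, 1, 3], by decide, by decide⟩

/-- The diagram automorphism for `j = 2`. -/
def flipPermTwo : Equiv.Perm (Fin 7) :=
  ⟨![4, 5, 6, 3, 0, 1, 2], ![4, 5, 6, 3, 0, 1, 2], by decide, by decide⟩

/-- The non-trivial diagram automorphism, if there is one. -/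
def flipPerm : (j : Fin 5) → Equiv.Perm (Fin (numNodes j))
  | 1 => flipPermOne
  | 2 => flipPermTwo
  | 0 => 1
  | 3 => 1
  | 4 => 1

theorem flip_mul_flip (j : Fin 5) : flip j * flip j = 1 := by
  fin_cases j
  · rfl
  · exact LinearEquiv.ext flipLin_involutive
  · exact LinearEquiv.ext flipLin_involutive
  · rfl
  · rfl

theorem flipPerm_mul_flipPerm (j : Fin 5) : flipPerm j * flipPerm j = 1 := by
  revert j; decide +kernel

theorem flip_rootZ (j : Fin 5) (a : Fin (numNodes j)) :
    flip j (rootZ j a) = rootZ j (flipPerm j a) := by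
  fin_cases j
  · rfl
  · revert a
    change ∀ a : Fin (numNodes 1), flipLin (rootZ 1 a) = rootZ 1 (flipPerm 1 a)
    decide +kernel
  · revert a
    change ∀ a : Fin (numNodes 2), flipLin (rootZ 2 a) = rootZ 2 (flipPerm 2 a)
    decide +kernel
  · rfl
  · rfl

theorem flip_mem_OPlus (j : Fin 5) : flip j ∈ OPlus j := by
  fin_cases j
  · exact (OPlus _).one_mem
  · refine ⟨fun x y => ?_, by change 0 < flipLin e0 0; decide⟩
    change bil 1 (flipLin x) (flipLin y) = _
    simp [bil, flipLin_apply, Fin.sum_univ_five, wt]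
    ring
  · refine ⟨fun x y => ?_, by change 0 < flipLin e0 0; decide⟩
    change bil 2 (flipLin x) (flipLin y) = _
    simp [bil, flipLin_apply, Fin.sum_univ_five, wt]
    ring
  · exact (OPlus _).one_mem
  · exact (OPlus _).one_mem

theorem flip_mul_s (j : Fin 5) (a : Fin (numNodes j)) :
    flip j * (realization j).s a = (realization j).s (flipPerm j a) * flip j :=
  mul_s_eq (flip_mem_OPlus j) (flip_rootZ j a)

/-! ### Transitivity -/

/-- A future vector can be moved into any face-chamber by the reflections in the walls of it. -/
theorem exists_rho_nonpos (j : Fin 5) (S : Set (Fin (numNodes j))) (x : Z5) (hx : Future j x) :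
    ∃ w, (∀ a ∈ S, bil j ((realization j).rho w x) (rootZ j a) ≤ 0) ∧
      ∀ z, (∀ a ∈ S, bil j z (rootZ j a) = 0) → (realization j).rho w z = z := by
  -- The product with the interior vector is a negative integer, and reflecting in a violated wall
  -- increases it, so the process ends. Only walls in `S` are used, whence vectors on all of these
  -- walls stay fixed.
  induction hn : (-bil j x (interiorZ j)).toNat using Nat.strong_induction_on generalizing x with
  | _ n ih =>
  subst hn
  by_cases h : ∀ a ∈ S, bil j x (rootZ j a) ≤ 0
  · exact ⟨1, by simpa using h, fun z _ => by simp⟩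
  push Not at h
  obtain ⟨a, haS, ha⟩ := h
  have hN := nodeNorm_pos j a
  have hx' := OPlus.future (s_mem_OPlus j a) hx
  have hneg := hx.bil_neg j (future_interiorZ j)
  have hneg' := hx'.bil_neg j (future_interiorZ j)
  have hlt : bil j x (interiorZ j) < bil j ((realization j).s a x) (interiorZ j) := by
    rw [s_apply_root, bil_sub_left, bil_smul_left, bil_comm j (rootZ j a)]
    have h1 := bil_interiorZ j a
    have h2 : 0 < corootZ j a x := by
      have := corootZ_mul j a x
      by_contra hc
      nlinarith
    nlinarith
  obtain ⟨w, hw1, hw2⟩ := ih _ (by omega) ((realization j).s a x) hx' rfl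
  refine ⟨w * (coxeterMatrix j).toCoxeterSystem.simple a, ?_, fun z hz => ?_⟩
  · simpa only [map_mul, LinearEquiv.mul_apply, CartanRealization.rho_simple] using hw1
  · rw [map_mul, LinearEquiv.mul_apply, CartanRealization.rho_simple, s_apply_root]
    have h0 : corootZ j a z = 0 := by
      have := corootZ_mul j a z
      rw [hz a haS, mul_zero] at this
      exact (mul_eq_zero.1 this).resolve_right hN.ne'
    rw [h0, zero_smul, sub_zero, hw2 z hz]

/-- The third alternative occurs only for j = 2, at the vector (3,-1,-1,-1,-1). Only the oddness of
its coordinates is recorded, as this is all that the exclusion of it uses. -/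
theorem eq_corner (j : Fin 5) (x : Z5) (hx : bil j x x = -1)
    (hc : ∀ a, bil j x (rootZ j a) ≤ 0) : x = e0 ∨ x = flip j e0 ∨ ∀ i, Odd (x i) := by
  have hext : ∀ y : Z5, x 0 = y 0 → x 1 = y 1 → x 2 = y 2 → x 3 = y 3 → x 4 = y 4 → x = y := by
    intro y h0 h1 h2 h3 h4
    ext i
    fin_cases i <;> assumption
  fin_cases j
  · have c0 := hc (0 : Fin 5)
    have c1 := hc (1 : Fin 5)
    have c2 := hc (2 : Fin 5)
    have c3 := hc (3 : Fin 5)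
    have c4 := hc (4 : Fin 5)
    simp [bil, Fin.sum_univ_five, wt, rootZ] at c0 c1 c2 c3 c4 hx
    have := classify_zero (x0 := x 0) (a := -x 1) (b := -x 2) (c := -x 3) (d := -x 4) (by linarith)
      (by linarith) (by linarith) (by linarith) (by linarith) (by linarith)
    left
    apply hext <;> simp [e0] <;> omega
  · have c0 := hc (0 : Fin 7)
    have c1 := hc (1 : Fin 7)
    have c2 := hc (2 : Fin 7)
    have c3 := hc (3 : Fin 7)
    have c4 := hc (4 : Fin 7)
    have c5 := hc (5 : Fin 7)
    have c6 := hc (6 : Fin 7)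
    simp [bil, Fin.sum_univ_five, wt, rootZ] at c0 c1 c2 c3 c4 c5 c6 hx
    have := classify_one (x0 := x 0) (a := -x 1) (b := -x 2) (c := -x 3) (d := -x 4) (by linarith)
      (by linarith) (by linarith) (by linarith) (by linarith) (by linarith) (by linarith)
      (by linarith)
    rcases this with h | h
    · left
      apply hext <;> simp [e0] <;> omega
    · right; left
      change x = flipLin e0
      apply hext <;> simp [e0, flipLin_apply] <;> omega
  · have c0 := hc (0 : Fin 7)
    have c1 := hc (1 : Fin 7)
    have c2 := hc (2 : Fin 7)
    have c3 := hc (3 : Fin 7)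
    have c4 := hc (4 : Fin 7)
    have c5 := hc (5 : Fin 7)
    have c6 := hc (6 : Fin 7)
    simp [bil, Fin.sum_univ_five, wt, rootZ] at c0 c1 c2 c3 c4 c5 c6 hx
    have := classify_two (x0 := x 0) (a := -x 1) (b := -x 2) (c := -x 3) (d := -x 4) (by linarith)
      (by linarith) (by linarith) (by linarith) (by linarith) (by linarith) (by linarith)
      (by linarith)
    rcases this with h | h | h
    · left
      apply hext <;> simp [e0] <;> omega
    · right; left
      change x = flipLin e0
      apply hext <;> simp [e0, flipLin_apply] <;> omega
    · right; right
      have : x = ![3, -1, -1, -1, -1] := by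
        apply hext <;> simp <;> omega
      rw [this]
      decide
  · have c0 := hc (0 : Fin 7)
    have c1 := hc (1 : Fin 7)
    have c2 := hc (2 : Fin 7)
    have c3 := hc (3 : Fin 7)
    have c4 := hc (4 : Fin 7)
    have c5 := hc (5 : Fin 7)
    have c6 := hc (6 : Fin 7)
    simp [bil, Fin.sum_univ_five, wt, rootZ] at c0 c1 c2 c3 c4 c5 c6 hx
    have := classify_three (x0 := x 0) (a := -x 1) (b := -x 2) (c := -x 3) (d := -x 4)
      (by linarith)
      (by linarith) (by linarith) (by linarith) (by linarith) (by linarith) (by linarith)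
      (by linarith)
    left
    apply hext <;> simp [e0] <;> omega
  · have c0 := hc (0 : Fin 6)
    have c1 := hc (1 : Fin 6)
    have c2 := hc (2 : Fin 6)
    have c3 := hc (3 : Fin 6)
    have c4 := hc (4 : Fin 6)
    have c5 := hc (5 : Fin 6)
    simp [bil, Fin.sum_univ_five, wt, rootZ] at c0 c1 c2 c3 c4 c5 hx
    have := classify_four (x0 := x 0) (a := -x 1) (b := -x 2) (c := -x 3) (d := -x 4)
      (by linarith) (by linarith) (by linarith) (by linarith) (by linarith) (by linarith)
      (by linarith)
    left
    apply hext <;> simp [e0] <;> omega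

/-! ### The stabilizer of the corner, and generation of the orthogonal group -/

/-- The signed basis vectors orthogonal to `e0`. -/
def sgn (p : Fin 4 × Bool) : Z5 := Pi.single p.1.succ (if p.2 then 1 else -1)

/-- Divisibility makes each nonzero coordinate contribute at least `wt j k` to the norm, so there is
only one, equal to 1 or -1. The norm alone would not suffice: for j = 1 the vector (0,1,1,1,0) also
has norm 3. -/
theorem exists_sgn (j k : Fin 5) (hk : k ≠ 0) (c : Z5) (h0 : c 0 = 0) (hc : bil j c c = wt j k)
    (hdiv : ∀ i, wt j k ∣ wt j i * c i) : ∃ p, c = sgn p := by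
  have hn := wt_pos j hk
  have hterm : ∀ i ∈ Finset.univ, 0 ≤ wt j i * c i * c i := by
    intro i _
    by_cases hi : i = 0
    · rw [hi, h0]; simp
    · rw [mul_assoc]
      exact mul_nonneg (by linarith [wt_pos j hi]) (mul_self_nonneg _)
  have hc' : ∑ i, wt j i * c i * c i = wt j k := by simpa [bil] using hc
  obtain ⟨i, hi⟩ : ∃ i, c i ≠ 0 := by
    by_contra hall
    push Not at hall
    simp only [hall, mul_zero, Finset.sum_const_zero] at hc'
    omega
  have hi0 : i ≠ 0 := fun h => hi (h ▸ h0)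
  have hwi := wt_pos j hi0
  have hle : wt j i * c i * c i ≤ wt j k := by
    rw [← hc']; exact Finset.single_le_sum hterm (Finset.mem_univ i)
  have habs : wt j k ≤ |wt j i * c i| :=
    Int.le_of_dvd (abs_pos.2 (mul_ne_zero (by omega) hi)) ((dvd_abs _ _).2 (hdiv i))
  have hsq : wt j i * c i * c i = |wt j i * c i| * |c i| := by
    rw [← abs_mul, abs_of_nonneg (hterm i (Finset.mem_univ i))]
  have hc1 : |c i| = 1 := by
    have := Int.one_le_abs hi
    by_contra hne
    have h2 : 2 ≤ |c i| := by omega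
    nlinarith
  have heq : wt j i * c i * c i = wt j k := le_antisymm hle (by rw [hsq, hc1, mul_one]; exact habs)
  have hrest : ∑ l ∈ Finset.univ.erase i, wt j l * c l * c l = 0 := by
    have := Finset.add_sum_erase Finset.univ (fun l => wt j l * c l * c l) (Finset.mem_univ i)
    omega
  have hzero : ∀ l, l ≠ i → c l = 0 := by
    intro l hl
    have h1 := (Finset.sum_eq_zero_iff_of_nonneg
      (fun l _ => hterm l (Finset.mem_univ l))).1 hrest l (Finset.mem_erase.2 ⟨hl, Finset.mem_univ l⟩)
    by_cases hl0 : l = 0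
    · rw [hl0, h0]
    · have := wt_pos j hl0
      rcases mul_eq_zero.1 h1 with h | h
      · rcases mul_eq_zero.1 h with h | h
        · omega
        · exact h
      · exact h
  obtain ⟨i', rfl⟩ := Fin.exists_succ_eq.2 hi0
  have hcs : c = Pi.single i'.succ (c i'.succ) := by
    ext l
    by_cases hl : l = i'.succ
    · subst hl; rw [Pi.single_eq_same]
    · rw [Pi.single_eq_of_ne hl, hzero l hl]
  rcases (abs_eq (by norm_num)).1 hc1 with h | h
  · exact ⟨(i', true), by rw [hcs, h]; rfl⟩
  · exact ⟨(i', false), by rw [hcs, h]; rfl⟩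

/-- The finite stabilizer of the corner moves an interior vector out of the cone of the walls
through `e0` unless it acts trivially. The conditions are interleaved with the quantifiers so that
the enumeration discards partial choices early. -/
theorem sgn_rigid (j : Fin 5) : ∀ p₁, bil j (sgn p₁) (sgn p₁) = wt j 1 →
    ∀ p₂, bil j (sgn p₂) (sgn p₂) = wt j 2 → bil j (sgn p₁) (sgn p₂) = 0 →
    ∀ p₃, bil j (sgn p₃) (sgn p₃) = wt j 3 → bil j (sgn p₁) (sgn p₃) = 0 →
      bil j (sgn p₂) (sgn p₃) = 0 →
    ∀ p₄, bil j (sgn p₄) (sgn p₄) = wt j 4 → bil j (sgn p₁) (sgn p₄) = 0 →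
      bil j (sgn p₂) (sgn p₄) = 0 → bil j (sgn p₃) (sgn p₄) = 0 →
    (∀ a, bil j e0 (rootZ j a) = 0 → bil j (interiorZ j 0 • e0 + interiorZ j 1 • sgn p₁ +
      interiorZ j 2 • sgn p₂ + interiorZ j 3 • sgn p₃ + interiorZ j 4 • sgn p₄) (rootZ j a) ≤ 0) →
    p₁ = (0, true) ∧ p₂ = (1, true) ∧ p₃ = (2, true) ∧ p₄ = (3, true) := by
  revert j; decide +kernel

theorem sum_single_eq (x : Z5) : x = x 0 • e0 + x 1 • Pi.single 1 1 + x 2 • Pi.single 2 1 +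
    x 3 • Pi.single 3 1 + x 4 • Pi.single 4 1 := by
  ext i
  simp only [e0_eq, Pi.add_apply, Pi.smul_apply, Pi.single_apply, smul_eq_mul]
  fin_cases i <;> simp

theorem linearEquiv_ext {L K : Z5 ≃ₗ[ℤ] Z5} (h : ∀ i, L (Pi.single i 1) = K (Pi.single i 1)) :
    L = K := by
  refine LinearEquiv.ext fun x => ?_
  rw [sum_single_eq x, e0_eq]
  simp only [map_add, map_smul, h]

/-- The k-th basis vector pairs with all of Λⱼ in multiples of `wt j k`, and an isometry preserves
this property. It serves both for the stabilizer of `e0` and for the extension of isometries to Λ.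
-/
theorem wt_dvd_bil {j : Fin 5} {L : Z5 ≃ₗ[ℤ] Z5} (hL : L ∈ OPlus j) (i k : Fin 5) :
    wt j k ∣ wt j i * L (Pi.single k 1) i := by
  have h1 : bil j (L (Pi.single k 1)) (Pi.single i 1) = wt j i * L (Pi.single k 1) i := by
    rw [bil_single_right, mul_one, Int.cast_id]
  have h2 : bil j (L (Pi.single k 1)) (Pi.single i 1) = wt j k * L⁻¹ (Pi.single i 1) k := by
    have : L (L⁻¹ (Pi.single i 1)) = Pi.single i 1 := L.apply_symm_apply _
    conv_lhs => rw [← this]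
    rw [hL.1, bil_comm, bil_single_right, mul_one, Int.cast_id]
  rw [← h1, h2]
  exact dvd_mul_right _ _

/-- The stabilizer of the corner `e0` is generated by simple reflections. -/
theorem exists_rho_of_fix_e0 (j : Fin 5) {L : Z5 ≃ₗ[ℤ] Z5} (hL : L ∈ OPlus j) (h0 : L e0 = e0) :
    ∃ w, L = (realization j).rho w := by
  -- Only walls through `e0` are used, so the correction by `w` still fixes `e0` while it moves the
  -- image of the interior vector back into their cone.
  obtain ⟨w, hw1, hw2⟩ := exists_rho_nonpos j {a | bil j e0 (rootZ j a) = 0} (L (interiorZ j))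
    (OPlus.future hL (future_interiorZ j))
  have hw0 := hw2 e0 fun a ha => ha
  set K := (realization j).rho w * L with hK
  have hKO : K ∈ OPlus j := (OPlus j).mul_mem (rho_mem_OPlus j w) hL
  have hK0 : K e0 = e0 := by rw [hK, LinearEquiv.mul_apply, h0, hw0]
  have hsgn : ∀ k : Fin 5, k ≠ 0 → ∃ p, K (Pi.single k 1) = sgn p := by
    intro k hk
    refine exists_sgn j k hk _ ?_ ?_ fun i => wt_dvd_bil hKO i k
    · have h1 := hKO.1 (Pi.single k 1) e0
      rw [hK0, bil_e0_right, bil_e0_right, Pi.single_eq_of_ne hk.symm] at h1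
      omega
    · rw [hKO.1, bil_single_right, Pi.single_eq_same, mul_one, mul_one, Int.cast_id]
  have horth : ∀ k l : Fin 5, k ≠ l → bil j (K (Pi.single k 1)) (K (Pi.single l 1)) = 0 := by
    intro k l hkl
    rw [hKO.1, bil_single_right, Pi.single_eq_of_ne hkl.symm, mul_zero, zero_mul]
  have hnorm : ∀ k : Fin 5, bil j (K (Pi.single k 1)) (K (Pi.single k 1)) = wt j k := by
    intro k
    rw [hKO.1, bil_single_right, Pi.single_eq_same, mul_one, mul_one, Int.cast_id]
  obtain ⟨p₁, e1⟩ := hsgn 1 (by decide)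
  obtain ⟨p₂, e2⟩ := hsgn 2 (by decide)
  obtain ⟨p₃, e3⟩ := hsgn 3 (by decide)
  obtain ⟨p₄, e4⟩ := hsgn 4 (by decide)
  have hint : K (interiorZ j) = interiorZ j 0 • e0 + interiorZ j 1 • sgn p₁ +
      interiorZ j 2 • sgn p₂ + interiorZ j 3 • sgn p₃ + interiorZ j 4 • sgn p₄ := by
    conv_lhs => rw [sum_single_eq (interiorZ j)]
    simp only [map_add, map_smul, hK0, e1, e2, e3, e4]
  obtain ⟨rfl, rfl, rfl, rfl⟩ := sgn_rigid j p₁ (by rw [← e1, hnorm]) p₂ (by rw [← e2, hnorm])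
    (by rw [← e1, ← e2]; exact horth _ _ (by decide)) p₃ (by rw [← e3, hnorm])
    (by rw [← e1, ← e3]; exact horth _ _ (by decide))
    (by rw [← e2, ← e3]; exact horth _ _ (by decide)) p₄ (by rw [← e4, hnorm])
    (by rw [← e1, ← e4]; exact horth _ _ (by decide))
    (by rw [← e2, ← e4]; exact horth _ _ (by decide))
    (by rw [← e3, ← e4]; exact horth _ _ (by decide)) (fun a ha => by
      rw [← hint]; exact hw1 a ha)
  have hK1 : K = 1 := by
    refine linearEquiv_ext fun i => ?_
    fin_cases i
    · exact e0_eq ▸ hK0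
    · exact e1
    · exact e2
    · exact e3
    · exact e4
  refine ⟨w⁻¹, ?_⟩
  rw [map_inv, eq_comm, inv_eq_of_mul_eq_one_right (by rw [← hK, hK1])]

theorem exists_flip_mul_rho (j : Fin 5) (w : (coxeterMatrix j).Group) :
    ∃ w', flip j * (realization j).rho w = (realization j).rho w' * flip j := by
  induction w using (coxeterMatrix j).toCoxeterSystem.simple_induction with
  | simple a =>
    exact ⟨(coxeterMatrix j).toCoxeterSystem.simple (flipPerm j a), by
      rw [CartanRealization.rho_simple, CartanRealization.rho_simple, flip_mul_s]⟩
  | one => exact ⟨1, by simp⟩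
  | mul w w' h h' =>
    obtain ⟨u, hu⟩ := h
    obtain ⟨u', hu'⟩ := h'
    exact ⟨u * u', by rw [map_mul, ← mul_assoc, hu, mul_assoc, hu', map_mul, mul_assoc]⟩

/-- Every isometry of `Λⱼ` is, up to a diagram automorphism, a product of simple reflections. -/
theorem exists_rho_mul_flip (j : Fin 5) {L : Z5 ≃ₗ[ℤ] Z5} (hL : L ∈ OPlus j) :
    ∃ w, L = (realization j).rho w ∨ L = (realization j).rho w * flip j := by
  obtain ⟨w, hw, -⟩ := exists_rho_nonpos j Set.univ (L e0) (OPlus.future hL (future_e0 j))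
  set K := (realization j).rho w * L with hK
  have hKO : K ∈ OPlus j := (OPlus j).mul_mem (rho_mem_OPlus j w) hL
  have hLK : L = (realization j).rho w⁻¹ * K := by rw [hK, map_inv, inv_mul_cancel_left]
  rcases eq_corner j (K e0) (by rw [hKO.1, bil_e0_e0]) (fun a => hw a (Set.mem_univ a)) with
    h | h | h
  · obtain ⟨w', hw'⟩ := exists_rho_of_fix_e0 j hKO h
    exact ⟨w⁻¹ * w', Or.inl (by rw [map_mul, ← hw', ← hLK])⟩
  · obtain ⟨w', hw'⟩ := exists_rho_of_fix_e0 j ((OPlus j).mul_mem (flip_mem_OPlus j) hKO) (by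
      rw [LinearEquiv.mul_apply, h, ← LinearEquiv.mul_apply, flip_mul_flip]; rfl)
    obtain ⟨w'', hw''⟩ := exists_flip_mul_rho j w'
    refine ⟨w⁻¹ * w'', Or.inr ?_⟩
    rw [map_mul, mul_assoc, ← hw'', ← hw', ← mul_assoc (flip j), flip_mul_flip, one_mul, ← hLK]
  -- If all coordinates of `K e0` are odd, then `K e0` is characteristic: its product with any `z`
  -- has the parity of the norm of `z`. But the image of the basis vector of index 1 is orthogonal
  -- to `K e0` and has odd norm.
  · exfalso
    have h1 := hKO.1 e0 (Pi.single 1 1)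
    have h2 := hKO.1 (Pi.single 1 1) (Pi.single 1 1)
    rw [bil_single_right] at h1 h2
    set z := K (Pi.single 1 1)
    have hpar : Even (bil j z z - bil j (K e0) z) := by
      rw [← bil_sub_left]
      unfold bil
      refine Finset.even_sum _ fun i _ => ?_
      rw [mul_assoc]
      refine Even.mul_left ?_ _
      obtain ⟨m, hm⟩ := h i
      rw [Pi.sub_apply, hm]
      rcases Int.even_or_odd (z i) with hz | hz
      · exact hz.mul_left _
      · refine Even.mul_right ?_ _
        obtain ⟨l, hl⟩ := hz
        exact ⟨l - m, by rw [hl]; ring⟩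
    rw [h1, h2] at hpar
    revert hpar
    clear * -
    revert j
    decide

/-! ### Reflections of the lattice lie in the Coxeter group -/

/-- An integral linear map that is the reflection in some vector of positive norm. -/
def IsReflZ (j : Fin 5) (L : Z5 ≃ₗ[ℤ] Z5) (n : Z5) : Prop :=
  -- Multiplying by the norm of `n` avoids denominators, so that `n` may be any integral multiple of
  -- a root.
  0 < bil j n n ∧ ∀ x, bil j n n • L x = bil j n n • x - (2 * bil j x n) • n

theorem IsReflZ.map_self {j : Fin 5} {L : Z5 ≃ₗ[ℤ] Z5} {n : Z5} (h : IsReflZ j L n) :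
    L n = -n := by
  have h1 := h.2 n
  apply smul_right_injective Z5 h.1.ne'
  change bil j n n • L n = bil j n n • (-n)
  rw [h1]
  module

theorem IsReflZ.mul_self {j : Fin 5} {L : Z5 ≃ₗ[ℤ] Z5} {n : Z5} (h : IsReflZ j L n) :
    L * L = 1 := by
  refine LinearEquiv.ext fun x => ?_
  apply smul_right_injective Z5 h.1.ne'
  change bil j n n • L (L x) = bil j n n • x
  rw [← map_smul, h.2 x, map_sub, map_smul, map_smul, h.map_self, h.2 x]
  module

theorem IsReflZ.conj {j : Fin 5} {L K : Z5 ≃ₗ[ℤ] Z5} {n : Z5} (h : IsReflZ j L n)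
    (hK : K ∈ OPlus j) : IsReflZ j (K * L * K⁻¹) (K n) := by
  refine ⟨by rw [hK.1]; exact h.1, fun x => ?_⟩
  have key : K (K⁻¹ x) = x := K.apply_symm_apply x
  have h1 := congrArg K (h.2 (K⁻¹ x))
  rw [map_smul, map_sub, map_smul, map_smul, key, ← hK.1 (K⁻¹ x), key] at h1
  rw [hK.1]
  exact h1

/-- A reflection negates only one line, so the negated simple root is proportional to `n` and the
two reflections coincide. -/
theorem IsReflZ.eq_s {j : Fin 5} {L : Z5 ≃ₗ[ℤ] Z5} {n : Z5} (h : IsReflZ j L n)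
    {a : Fin (numNodes j)} (ha : L (rootZ j a) = -rootZ j a) : L = (realization j).s a := by
  obtain ⟨hN, h⟩ := h
  have hν := nodeNorm_pos j a
  set r := rootZ j a with hr
  set N := bil j n n with hNdef
  set c := bil j r n with hc
  have h1 : ∀ i, N * r i = c * n i := by
    intro i
    have := congrFun (h r) i
    rw [ha] at this
    simp only [Pi.smul_apply, Pi.neg_apply, Pi.sub_apply, smul_eq_mul] at this
    linarith
  have h1' : N • r = c • n := funext fun i => h1 i
  refine LinearEquiv.ext fun x => ?_
  rw [s_apply_root, ← hr]
  have hf := corootZ_mul j a x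
  rw [← hr] at hf
  have h2 : N * bil j x r = c * bil j x n := by
    rw [← bil_smul_right, h1', bil_smul_right]
  have h3 : N * nodeNorm j a = c * c := by
    rw [← bil_rootZ_self, ← hr, ← bil_smul_right, h1', bil_smul_right]
  ext i
  have h4 := congrFun (h x) i
  simp only [Pi.smul_apply, Pi.sub_apply, smul_eq_mul] at h4 ⊢
  apply mul_left_cancel₀ (mul_pos (mul_pos hN hN) hν).ne'
  linear_combination N * nodeNorm j a * h4 + N * N * r i * hf + 2 * N * bil j x r * h1 i
    + 2 * c * n i * h2 - 2 * bil j x n * n i * h3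

/-- A reflection differs from the identity by a map of rank one. The minor of `flip j - 1` on the
coordinates 0 and 2 is -3, not 0. -/
theorem not_isReflZ_flip {j : Fin 5} (hj : j = 1 ∨ j = 2) (n : Z5) : ¬ IsReflZ j (flip j) n := by
  rintro ⟨hN, h⟩
  have hflip : ∀ x, flip j x = flipLin x := by
    rcases hj with rfl | rfl <;> exact fun _ => rfl
  have a0 := congrFun (h e0) 0
  have a2 := congrFun (h e0) 2
  have b0 := congrFun (h (Pi.single 2 1)) 0
  have b2 := congrFun (h (Pi.single 2 1)) 2
  rw [hflip] at a0 a2 b0 b2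
  simp [flipLin_apply, e0] at a0 a2 b0 b2
  generalize bil j n n = N at *
  generalize bil j (Pi.single 2 1) n = p at *
  generalize bil j ![1, 0, 0, 0, 0] n = q at *
  have : 3 * (N * N) = 0 := by
    linear_combination 2 * N * a0 + 2 * q * n 0 * b2 - N * b0 + 2 * p * n 0 * a2
  nlinarith

/-- Every reflection of `Λⱼ` is a product of simple reflections. -/
theorem IsReflZ.exists_rho {j : Fin 5} {L : Z5 ≃ₗ[ℤ] Z5} (hL : L ∈ OPlus j) {n : Z5}
    (h : IsReflZ j L n) : ∃ w, L = (realization j).rho w := by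
  obtain ⟨y, hy | hy⟩ := exists_rho_mul_flip j hL
  · exact ⟨y, hy⟩
  by_cases hj : j = 1 ∨ j = 2
  -- The product with an interior point of a facet is a functional that vanishes on exactly one
  -- simple root and is negative on the others.
  · have hfacet : ∀ a, ∃ φ : Z5 →+ ℤ, φ ((realization j).root a) = 0 ∧
        ∀ b, b ≠ a → φ ((realization j).root b) < 0 := by
      intro a
      obtain ⟨-, h1, h2⟩ := bil_facetZ j a
      exact ⟨⟨⟨fun x => bil j (facetZ j a) x, by simp [bil]⟩, bil_add_right j _⟩, h1, h2⟩
    obtain ⟨w, hw | ⟨a, ha⟩⟩ := (realization j).exists_conj_eq_or_root_neg hfacet (flip j)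
      (flipPerm j) (flip_rootZ j) (flip_mul_s j) y (by rw [← hy]; exact h.mul_self)
    · rw [← hy] at hw
      have := h.conj (rho_mem_OPlus j w)
      rw [hw] at this
      exact absurd this (not_isReflZ_flip hj _)
    · rw [← hy] at ha
      have := (h.conj (rho_mem_OPlus j w)).eq_s ha
      refine ⟨w⁻¹ * (coxeterMatrix j).toCoxeterSystem.simple a * w, ?_⟩
      rw [map_mul, map_mul, CartanRealization.rho_simple, ← this, map_inv]
      group
  · refine ⟨y, ?_⟩
    have : flip j = 1 := by
      push Not at hj
      fin_cases j <;> first | rfl | exact absurd rfl hj.1 | exact absurd rfl hj.2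
    rw [hy, this, mul_one]

/-! ### Eisenstein integers -/

theorem theta_eq : theta = (Real.sqrt 3 : ℂ) * Complex.I := by
  unfold theta omega
  simp only [map_div₀, map_add, map_neg, map_one, map_mul, Complex.conj_ofReal, Complex.conj_I,
    map_ofNat]
  ring

theorem conj_theta : (starRingEnd ℂ) theta = -theta := by
  rw [theta_eq]; simp

theorem theta_mul_theta : theta * theta = -3 := by
  rw [theta_eq, mul_mul_mul_comm, Complex.I_mul_I, ← Complex.ofReal_mul,
    Real.mul_self_sqrt (by norm_num)]
  push_cast; ring

theorem theta_ne_zero : theta ≠ 0 := by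
  intro h
  have := theta_mul_theta
  rw [h] at this
  norm_num at this

theorem theta_eq_omega : theta = 1 + 2 * omega := by
  rw [theta_eq]; unfold omega; ring

theorem omega_mul_omega : omega * omega = -1 - omega := by
  have h1 : omega = (theta - 1) / 2 := by rw [theta_eq_omega]; ring
  rw [h1]
  linear_combination theta_mul_theta / 4

theorem conj_omega : (starRingEnd ℂ) omega = -1 - omega := by
  have h1 : omega = (theta - 1) / 2 := by rw [theta_eq_omega]; ring
  rw [h1]
  simp only [map_div₀, map_sub, conj_theta, map_one, map_ofNat]
  ring

theorem eisenstein_int (n : ℤ) : (n : ℂ) ∈ eisenstein := ⟨n, 0, by simp⟩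

theorem eisenstein_add {x y : ℂ} (hx : x ∈ eisenstein) (hy : y ∈ eisenstein) :
    x + y ∈ eisenstein := by
  obtain ⟨a, b, rfl⟩ := hx
  obtain ⟨c, d, rfl⟩ := hy
  exact ⟨a + c, b + d, by push_cast; ring⟩

theorem eisenstein_mul {x y : ℂ} (hx : x ∈ eisenstein) (hy : y ∈ eisenstein) :
    x * y ∈ eisenstein := by
  obtain ⟨a, b, rfl⟩ := hx
  obtain ⟨c, d, rfl⟩ := hy
  refine ⟨a * c - b * d, a * d + b * c - b * d, ?_⟩
  push_cast
  linear_combination (b * d : ℂ) * omega_mul_omega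

theorem eisenstein_neg {x : ℂ} (hx : x ∈ eisenstein) : -x ∈ eisenstein := by
  obtain ⟨a, b, rfl⟩ := hx
  exact ⟨-a, -b, by push_cast; ring⟩

theorem eisenstein_omega : omega ∈ eisenstein := ⟨0, 1, by simp⟩

theorem eisenstein_theta : theta ∈ eisenstein := ⟨1, 2, by rw [theta_eq_omega]; simp⟩

theorem eisenstein_conj {x : ℂ} (hx : x ∈ eisenstein) : (starRingEnd ℂ) x ∈ eisenstein := by
  obtain ⟨a, b, rfl⟩ := hx
  refine ⟨a - b, -b, ?_⟩
  rw [map_add, map_mul, conj_omega, map_intCast, map_intCast]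
  push_cast; ring

theorem eisenstein_sum {ι : Type*} (s : Finset ι) (f : ι → ℂ) (h : ∀ i ∈ s, f i ∈ eisenstein) :
    ∑ i ∈ s, f i ∈ eisenstein := by
  classical
  induction s using Finset.induction_on with
  | empty => exact ⟨0, 0, by simp⟩
  | insert i s hi ih =>
    rw [Finset.sum_insert hi]
    exact eisenstein_add (h i (Finset.mem_insert_self i s))
      (ih fun k hk => h k (Finset.mem_insert_of_mem hk))

theorem eisenstein_real {x : ℂ} (hx : x ∈ eisenstein) (h : (starRingEnd ℂ) x = x) :
    ∃ n : ℤ, x = n := by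
  obtain ⟨a, b, rfl⟩ := hx
  rw [map_add, map_mul, conj_omega, map_intCast, map_intCast] at h
  have h1 : (b : ℂ) * theta = 0 := by rw [theta_eq_omega]; linear_combination -h
  refine ⟨a, ?_⟩
  rw [(mul_eq_zero.1 h1).resolve_right theta_ne_zero, zero_mul, add_zero]

theorem eisenstein_imag {x : ℂ} (hx : x ∈ eisenstein) (h : (starRingEnd ℂ) x = -x) :
    ∃ n : ℤ, x = n * theta := by
  obtain ⟨a, b, rfl⟩ := hx
  rw [map_add, map_mul, conj_omega, map_intCast, map_intCast] at h
  have h1 : (b : ℂ) = 2 * a := by linear_combination -h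
  exact ⟨a, by rw [theta_eq_omega, h1]; ring⟩

/-! ### The real form of the complex space -/

/-- The coordinate factors of `Λⱼ = ℤ^{5-j} ⊕ θℤ^j`. -/
noncomputable def unitFactor (j i : Fin 5) : ℂ := if 5 ≤ (i : ℕ) + (j : ℕ) then theta else 1

theorem unitFactor_ne_zero (j i : Fin 5) : unitFactor j i ≠ 0 := by
  unfold unitFactor; split
  · exact theta_ne_zero
  · exact one_ne_zero

theorem unitFactor_zero (j : Fin 5) : unitFactor j 0 = 1 := by
  unfold unitFactor
  rw [if_neg]
  have := j.2
  simp only [Fin.val_zero]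
  omega

theorem unitFactor_mul_conj (j : Fin 5) {i : Fin 5} (hi : i ≠ 0) :
    unitFactor j i * (starRingEnd ℂ) (unitFactor j i) = wt j i := by
  unfold unitFactor wt
  rw [if_neg hi]
  split
  · rw [conj_theta, mul_neg, theta_mul_theta]; norm_num
  · simp

theorem conj_unitFactor (j i : Fin 5) : (starRingEnd ℂ) (unitFactor j i) =
    if 5 ≤ (i : ℕ) + (j : ℕ) then -unitFactor j i else unitFactor j i := by
  unfold unitFactor
  split
  · exact conj_theta
  · exact map_one _

/-- The real vectors in coordinates. -/
noncomputable def emb (j : Fin 5) : (Fin 5 → ℝ) →ₗ[ℝ] V where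
  toFun x i := (x i : ℂ) * unitFactor j i
  map_add' x y := by ext i; simp [add_mul]
  map_smul' c x := by ext i; simp [mul_assoc]

theorem emb_apply (j : Fin 5) (x : Fin 5 → ℝ) (i : Fin 5) :
    emb j x i = (x i : ℂ) * unitFactor j i := rfl

theorem emb_zero_coord (j : Fin 5) (x : Fin 5 → ℝ) : emb j x 0 = x 0 := by
  rw [emb_apply, unitFactor_zero, mul_one]

theorem emb_injective (j : Fin 5) : Function.Injective (emb j) := by
  intro x y h
  ext i
  have := congrFun h i
  rw [emb_apply, emb_apply] at this
  exact_mod_cast mul_right_cancel₀ (unitFactor_ne_zero j i) this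

theorem herm_emb (j : Fin 5) (x y : Fin 5 → ℝ) : herm (emb j x) (emb j y) = (bil j x y : ℝ) := by
  rw [bil_eq]
  unfold herm spat
  simp only [emb_apply, map_mul, Complex.conj_ofReal, unitFactor_zero, map_one]
  push_cast
  have h1 := unitFactor_mul_conj j (i := 1) (by decide)
  have h2 := unitFactor_mul_conj j (i := 2) (by decide)
  have h3 := unitFactor_mul_conj j (i := 3) (by decide)
  have h4 := unitFactor_mul_conj j (i := 4) (by decide)
  linear_combination (x 1 * y 1 : ℂ) * h1 + (x 2 * y 2 : ℂ) * h2 + (x 3 * y 3 : ℂ) * h3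
    + (x 4 * y 4 : ℂ) * h4

theorem ip_emb (j : Fin 5) (x y : Fin 5 → ℝ) : ip (emb j x) (emb j y) = bil j x y := by
  rw [ip, herm_emb, Complex.ofReal_re]

theorem xi_apply (j : Fin 5) (v : V) (i : Fin 5) : xi j v i =
    if 5 ≤ (i : ℕ) + (j : ℕ) then -(starRingEnd ℂ) (v i) else (starRingEnd ℂ) (v i) := rfl

theorem emb_mem_VR (j : Fin 5) (x : Fin 5 → ℝ) : emb j x ∈ VR j := by
  change xi j _ = _
  ext i
  rw [xi_apply, emb_apply, map_mul, conj_unitFactor, Complex.conj_ofReal]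
  split <;> ring

theorem exists_emb_of_mem_VR {j : Fin 5} {v : V} (hv : v ∈ VR j) : ∃ x, v = emb j x := by
  refine ⟨fun i => (v i / unitFactor j i).re, ?_⟩
  ext i
  have h1 : (starRingEnd ℂ) (v i / unitFactor j i) = v i / unitFactor j i := by
    have h2 : xi j v i = v i := congrFun hv i
    rw [xi_apply] at h2
    rw [map_div₀, conj_unitFactor]
    split_ifs at h2 ⊢
    · rw [← neg_div_neg_eq, h2, neg_neg]
    · rw [h2]
  rw [emb_apply, Complex.conj_eq_iff_re.1 h1, div_mul_cancel₀ _ (unitFactor_ne_zero j i)]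

/-- Integral vectors as real vectors. -/
noncomputable def toR : Z5 →+ (Fin 5 → ℝ) where
  toFun z i := z i
  map_zero' := by ext i; simp
  map_add' x y := by ext i; simp

theorem toR_apply (z : Z5) (i : Fin 5) : toR z i = z i := rfl

theorem toR_injective : Function.Injective toR := by
  intro x y h
  ext i
  have := congrFun h i
  rw [toR_apply, toR_apply] at this
  exact_mod_cast this

theorem bil_toR (j : Fin 5) (x y : Z5) : bil j (toR x) (toR y) = ((bil j x y : ℤ) : ℝ) := by
  unfold bil
  simp only [toR_apply]
  push_cast
  rfl

theorem future_toR {j : Fin 5} {x : Z5} (hx : Future j x) : Future j (toR x) :=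
  ⟨by rw [bil_toR]; exact_mod_cast hx.1, by rw [toR_apply]; exact_mod_cast hx.2⟩

/-- Integral vectors as elements of `Λⱼ`. -/
noncomputable def embZ (j : Fin 5) (z : Z5) : V := emb j (toR z)

theorem embZ_apply (j : Fin 5) (z : Z5) (i : Fin 5) :
    embZ j z i = (z i : ℂ) * unitFactor j i := by
  rw [embZ, emb_apply, toR_apply]; norm_cast

theorem eisenstein_unitFactor (j i : Fin 5) : unitFactor j i ∈ eisenstein := by
  unfold unitFactor; split
  · exact eisenstein_theta
  · exact_mod_cast eisenstein_int 1

theorem embZ_mem_LamR (j : Fin 5) (z : Z5) : embZ j z ∈ LamR j := by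
  refine ⟨fun i => ?_, emb_mem_VR j _⟩
  rw [embZ_apply]
  exact eisenstein_mul (eisenstein_int _) (eisenstein_unitFactor j i)

theorem exists_embZ_of_mem_LamR {j : Fin 5} {v : V} (hv : v ∈ LamR j) : ∃ z, v = embZ j z := by
  obtain ⟨hL, hR⟩ := hv
  have : ∀ i, ∃ n : ℤ, v i = n * unitFactor j i := by
    intro i
    have h2 : xi j v i = v i := congrFun hR i
    rw [xi_apply] at h2
    unfold unitFactor
    split_ifs at h2 ⊢
    · exact eisenstein_imag (hL i) (neg_eq_iff_eq_neg.1 h2)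
    · obtain ⟨n, hn⟩ := eisenstein_real (hL i) h2
      exact ⟨n, by rw [hn, mul_one]⟩
  choose z hz using this
  exact ⟨z, funext fun i => by rw [embZ_apply, hz]⟩

theorem simpleRoot_eq (j : Fin 5) (a : Fin (numNodes j)) : simpleRoot j a = embZ j (rootZ j a) := by
  ext i
  rw [embZ_apply]
  fin_cases j
  · change Fin 5 at a
    fin_cases a <;> fin_cases i <;> simp [simpleRoot, rootZ, unitFactor]
  · change Fin 7 at a
    fin_cases a <;> fin_cases i <;> simp [simpleRoot, rootZ, unitFactor]
  · change Fin 7 at a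
    fin_cases a <;> fin_cases i <;> simp [simpleRoot, rootZ, unitFactor]
  · change Fin 7 at a
    fin_cases a <;> fin_cases i <;> simp [simpleRoot, rootZ, unitFactor]
  · change Fin 6 at a
    fin_cases a <;> fin_cases i <;> simp [simpleRoot, rootZ, unitFactor]

/-! ### The Hermitian form -/

theorem herm_add_left (x y z : V) : herm (x + y) z = herm x z + herm y z := by
  simp [herm]; ring

theorem herm_smul_left (c : ℂ) (x z : V) : herm (c • x) z = c * herm x z := by
  simp [herm]; ring

theorem herm_add_right (x y z : V) : herm x (y + z) = herm x y + herm x z := by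
  simp [herm]; ring

theorem herm_smul_right (c : ℂ) (x z : V) : herm x (c • z) = (starRingEnd ℂ) c * herm x z := by
  simp [herm]; ring

theorem herm_zero_left (z : V) : herm 0 z = 0 := by simp [herm]

theorem herm_zero_right (z : V) : herm z 0 = 0 := by simp [herm]

theorem herm_sum_sum {ι : Type*} (s : Finset ι) (a b : ι → ℂ) (e f : ι → V) :
    herm (∑ k ∈ s, a k • e k) (∑ l ∈ s, b l • f l) =
      ∑ k ∈ s, ∑ l ∈ s, a k * (starRingEnd ℂ) (b l) * herm (e k) (f l) := by
  classical
  have h1 : ∀ (t : Finset ι) (y : V), herm (∑ k ∈ t, a k • e k) y =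
      ∑ k ∈ t, a k * herm (e k) y := by
    intro t y
    induction t using Finset.induction_on with
    | empty => simp [herm_zero_left]
    | insert i t hi ih =>
      rw [Finset.sum_insert hi, Finset.sum_insert hi, herm_add_left, herm_smul_left, ih]
  have h2 : ∀ (t : Finset ι) (x : V), herm x (∑ l ∈ t, b l • f l) =
      ∑ l ∈ t, (starRingEnd ℂ) (b l) * herm x (f l) := by
    intro t x
    induction t using Finset.induction_on with
    | empty => simp [herm_zero_right]
    | insert i t hi ih =>
      rw [Finset.sum_insert hi, Finset.sum_insert hi, herm_add_right, herm_smul_right, ih]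
  rw [h1]
  refine Finset.sum_congr rfl fun k _ => ?_
  rw [h2, Finset.mul_sum]
  exact Finset.sum_congr rfl fun l _ => by ring

theorem herm_smul_self (c : ℂ) (x : V) : herm (c • x) (c • x) = (Complex.normSq c : ℂ) * herm x x := by
  rw [herm_smul_left, herm_smul_right, ← mul_assoc, Complex.mul_conj]

theorem herm_embZ (j : Fin 5) (x y : Z5) : herm (embZ j x) (embZ j y) = ((bil j x y : ℤ) : ℂ) := by
  rw [embZ, embZ, herm_emb, bil_toR]
  norm_cast

theorem embZ_add (j : Fin 5) (x y : Z5) : embZ j (x + y) = embZ j x + embZ j y := by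
  rw [embZ, map_add, map_add]; rfl

theorem embZ_smul (j : Fin 5) (c : ℤ) (x : Z5) : embZ j (c • x) = (c : ℂ) • embZ j x := by
  ext i
  rw [embZ_apply, Pi.smul_apply, Pi.smul_apply, embZ_apply]
  simp [mul_assoc]

theorem embZ_neg (j : Fin 5) (x : Z5) : embZ j (-x) = -embZ j x := by
  rw [embZ, map_neg, map_neg]; rfl

theorem embZ_injective (j : Fin 5) : Function.Injective (embZ j) :=
  (emb_injective j).comp toR_injective

theorem eq_sum_embZ (j : Fin 5) (v : V) :
    v = ∑ k, (v k / unitFactor j k) • embZ j (Pi.single k 1) := by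
  ext i
  rw [Finset.sum_apply, Finset.sum_eq_single i]
  · rw [Pi.smul_apply, embZ_apply, Pi.single_eq_same, Int.cast_one, one_mul, smul_eq_mul,
      div_mul_cancel₀ _ (unitFactor_ne_zero j i)]
  · intro k _ hk
    rw [Pi.smul_apply, embZ_apply, Pi.single_eq_of_ne hk.symm, Int.cast_zero, zero_mul, smul_zero]
  · intro h; exact absurd (Finset.mem_univ i) h

/-! ### Extending isometries of `Λⱼ` to `Λ` -/

/-- An element of `Γ` restricts to a given automorphism of `Λⱼ`. -/
def IsLift (j : Fin 5) (G : Gam) (L : Z5 ≃ₗ[ℤ] Z5) : Prop :=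
  ∀ z, G.1 (embZ j z) = embZ j (L z)

/-- The complex linear extension of an automorphism of `Λⱼ`. -/
noncomputable def extC (j : Fin 5) (L : Z5 ≃ₗ[ℤ] Z5) : V →ₗ[ℂ] V where
  toFun v := ∑ k, (v k / unitFactor j k) • embZ j (L (Pi.single k 1))
  map_add' v w := by
    simp only [Pi.add_apply, add_div, add_smul, Finset.sum_add_distrib]
  map_smul' c v := by
    simp only [Pi.smul_apply, smul_eq_mul, mul_div_assoc, mul_smul, Finset.smul_sum,
      RingHom.id_apply]

theorem extC_apply (j : Fin 5) (L : Z5 ≃ₗ[ℤ] Z5) (v : V) :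
    extC j L v = ∑ k, (v k / unitFactor j k) • embZ j (L (Pi.single k 1)) := rfl

theorem extC_embZ (j : Fin 5) (L : Z5 ≃ₗ[ℤ] Z5) (z : Z5) : extC j L (embZ j z) = embZ j (L z) := by
  have hz : z = ∑ k, z k • (Pi.single k 1 : Z5) := pi_eq_sum_univ' z
  rw [extC_apply]
  conv_rhs => rw [hz, map_sum]
  have hsum : ∀ (s : Finset (Fin 5)) (f : Fin 5 → Z5), embZ j (∑ k ∈ s, f k) =
      ∑ k ∈ s, embZ j (f k) := by
    intro s f
    simp only [embZ, map_sum]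
  rw [hsum]
  refine Finset.sum_congr rfl fun k _ => ?_
  rw [map_smul, embZ_smul, embZ_apply, mul_div_cancel_right₀ _ (unitFactor_ne_zero j k)]

theorem extC_extC (j : Fin 5) (L K : Z5 ≃ₗ[ℤ] Z5) (h : ∀ z, K (L z) = z) (v : V) :
    extC j K (extC j L v) = v := by
  rw [extC_apply j L, map_sum]
  conv_rhs => rw [eq_sum_embZ j v]
  refine Finset.sum_congr rfl fun k _ => ?_
  rw [map_smul, extC_embZ, h]

theorem herm_extC {j : Fin 5} {L : Z5 ≃ₗ[ℤ] Z5} (hL : L ∈ OPlus j) (v w : V) :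
    herm (extC j L v) (extC j L w) = herm v w := by
  conv_rhs => rw [eq_sum_embZ j v, eq_sum_embZ j w]
  rw [extC_apply, extC_apply, herm_sum_sum, herm_sum_sum]
  simp only [herm_embZ, hL.1]

/-- The only denominators are factors θ, at matrix entries from one of the last j coordinates to an
earlier one. There `wt_dvd_bil` makes the entry divisible by 3 = -θ². -/
theorem extC_mem_Lam {j : Fin 5} {L : Z5 ≃ₗ[ℤ] Z5} (hL : L ∈ OPlus j) {v : V} (hv : v ∈ Lam) :
    extC j L v ∈ Lam := by
  intro i
  rw [extC_apply, Finset.sum_apply]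
  refine eisenstein_sum _ _ fun k _ => ?_
  rw [Pi.smul_apply, smul_eq_mul, embZ_apply]
  have hd := wt_dvd_bil hL i k
  have key : ∃ c ∈ eisenstein, (L (Pi.single k 1) i : ℂ) * unitFactor j i / unitFactor j k = c := by
    refine ⟨_, ?_, rfl⟩
    generalize L (Pi.single k 1) i = m at *
    unfold unitFactor
    by_cases hk : 5 ≤ (k : ℕ) + (j : ℕ)
    · by_cases hi : 5 ≤ (i : ℕ) + (j : ℕ)
      · rw [if_pos hk, if_pos hi, mul_div_cancel_right₀ _ theta_ne_zero]
        exact eisenstein_int m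
      · have hk0 : k ≠ 0 := by
          rintro rfl
          have := j.2
          simp only [Fin.val_zero] at hk
          omega
        have h3 : (3 : ℤ) ∣ m := by
          unfold wt at hd
          rw [if_neg hk0, if_pos hk, if_neg hi] at hd
          split at hd <;> omega
        obtain ⟨l, rfl⟩ := h3
        rw [if_pos hk, if_neg hi, mul_one]
        have : ((3 * l : ℤ) : ℂ) / theta = -(l * theta) := by
          rw [div_eq_iff theta_ne_zero]
          push_cast
          linear_combination (l : ℂ) * theta_mul_theta
        rw [this]
        exact eisenstein_neg (eisenstein_mul (eisenstein_int l) eisenstein_theta)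
    · rw [if_neg hk, div_one]
      refine eisenstein_mul (eisenstein_int m) ?_
      exact eisenstein_unitFactor j i
  obtain ⟨c, hc, hc'⟩ := key
  have : v k / unitFactor j k * ((L (Pi.single k 1) i : ℂ) * unitFactor j i) = v k * c := by
    rw [← hc']; ring
  rw [this]
  exact eisenstein_mul (hv k) hc

/-- Every isometry of `Λⱼ` extends to `Λ`. -/
theorem exists_isLift {j : Fin 5} {L : Z5 ≃ₗ[ℤ] Z5} (hL : L ∈ OPlus j) : ∃ G : Gam, IsLift j G L := by
  have h1 : ∀ v, extC j L⁻¹ (extC j L v) = v := extC_extC j L L⁻¹ fun z => L.symm_apply_apply z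
  have h2 : ∀ v, extC j L (extC j L⁻¹ v) = v := extC_extC j L⁻¹ L fun z => L.apply_symm_apply z
  refine ⟨⟨LinearEquiv.ofLinearMap (extC j L) (extC j L⁻¹) (LinearMap.ext h2) (LinearMap.ext h1),
    fun x y => herm_extC hL x y, fun x => ⟨fun h => ?_, fun h => extC_mem_Lam hL h⟩⟩,
    fun z => extC_embZ j L z⟩
  have := extC_mem_Lam ((OPlus j).inv_mem hL) (v := extC j L x) h
  rwa [h1] at this

theorem IsLift.mul {j : Fin 5} {G K : Gam} {L M : Z5 ≃ₗ[ℤ] Z5} (h : IsLift j G L)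
    (h' : IsLift j K M) : IsLift j (G * K) (L * M) := by
  intro z
  change G.1 (K.1 (embZ j z)) = _
  rw [h', h]
  rfl

theorem IsLift.eq_extC {j : Fin 5} {G : Gam} {L : Z5 ≃ₗ[ℤ] Z5} (h : IsLift j G L) (v : V) :
    G.1 v = extC j L v := by
  conv_lhs => rw [eq_sum_embZ j v]
  rw [map_sum, extC_apply]
  refine Finset.sum_congr rfl fun k _ => ?_
  rw [map_smul, h]

theorem IsLift.unique_left {j : Fin 5} {G K : Gam} {L : Z5 ≃ₗ[ℤ] Z5} (h : IsLift j G L)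
    (h' : IsLift j K L) : G = K := by
  apply Subtype.ext
  refine LinearEquiv.ext fun v => ?_
  rw [h.eq_extC, h'.eq_extC]

/-- The real linear extension of an automorphism of `Λⱼ`. -/
noncomputable def extR (L : Z5 ≃ₗ[ℤ] Z5) (x : Fin 5 → ℝ) : Fin 5 → ℝ :=
  ∑ k, x k • toR (L (Pi.single k 1))

theorem IsLift.emb {j : Fin 5} {G : Gam} {L : Z5 ≃ₗ[ℤ] Z5} (h : IsLift j G L) (x : Fin 5 → ℝ) :
    G.1 (emb j x) = emb j (extR L x) := by
  rw [h.eq_extC, extC_apply, extR, map_sum]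
  refine Finset.sum_congr rfl fun k _ => ?_
  rw [map_smul, emb_apply, mul_div_cancel_right₀ _ (unitFactor_ne_zero j k)]
  rfl

theorem IsLift.bil_extR {j : Fin 5} {G : Gam} {L : Z5 ≃ₗ[ℤ] Z5} (h : IsLift j G L)
    (x y : Fin 5 → ℝ) : bil j (extR L x) (extR L y) = bil j x y := by
  rw [← ip_emb, ← ip_emb, ← h.emb, ← h.emb, ip, ip, G.2.1]

theorem extR_toR (L : Z5 ≃ₗ[ℤ] Z5) (z : Z5) : extR L (toR z) = toR (L z) := by
  conv_rhs => rw [pi_eq_sum_univ' z, map_sum, map_sum]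
  refine Finset.sum_congr rfl fun k _ => ?_
  rw [map_smul, map_zsmul, toR_apply, ← Int.cast_smul_eq_zsmul ℝ]

theorem IsLift.future {j : Fin 5} {G : Gam} {L : Z5 ≃ₗ[ℤ] Z5} (h : IsLift j G L)
    (hL : L ∈ OPlus j) {x : Fin 5 → ℝ} (hx : Future j x) : Future j (extR L x) := by
  have h1 := future_toR (OPlus.future hL (future_e0 j))
  refine h1.of_bil_neg j ?_ ?_
  · rw [h.bil_extR]; exact hx.1
  · rw [← extR_toR, h.bil_extR]
    exact (future_toR (future_e0 j)).bil_neg j hx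

/-! ### The points of real hyperbolic space -/

theorem emb_ne_zero {j : Fin 5} {x : Fin 5 → ℝ} (hx : Future j x) : emb j x ≠ 0 := by
  intro h
  have := congrFun h 0
  rw [emb_zero_coord, Pi.zero_apply] at this
  exact hx.2.ne' (by exact_mod_cast this)

theorem xi_smul (j : Fin 5) (c : ℂ) (v : V) : xi j (c • v) = (starRingEnd ℂ) c • xi j v :=
  LinearMap.map_smulₛₗ _ c v

/-- Hilbert 90 for ℂ over ℝ: the scalar has absolute value 1, so `(1 + c) • v` is fixed by ξⱼ; if `c
= -1`, the multiple by the imaginary unit is. -/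
theorem exists_smul_mem_VR {j : Fin 5} {v : V} (hv : v ≠ 0) {c : ℂ} (hc : xi j v = c • v) :
    ∃ a : ℂ, a ≠ 0 ∧ a • v ∈ VR j := by
  have hcc : (starRingEnd ℂ) c * c = 1 := by
    have h1 := xi_xi j v
    rw [hc, xi_smul, hc, smul_smul] at h1
    have h2 : ((starRingEnd ℂ) c * c - 1) • v = 0 := by rw [sub_smul, h1, one_smul, sub_self]
    exact sub_eq_zero.1 ((smul_eq_zero.1 h2).resolve_right hv)
  by_cases h : 1 + c = 0
  · refine ⟨Complex.I, Complex.I_ne_zero, ?_⟩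
    change xi j _ = _
    rw [xi_smul, hc, smul_smul, Complex.conj_I, eq_neg_of_add_eq_zero_right h]
    congr 1; ring
  · refine ⟨1 + c, h, ?_⟩
    change xi j _ = _
    rw [xi_smul, hc, smul_smul, map_add, map_one, add_mul, hcc]
    congr 1; ring

theorem exists_future_of_neg {j : Fin 5} {x : Fin 5 → ℝ} (hx : bil j x x < 0) :
    Future j x ∨ Future j (-x) := by
  rcases lt_or_gt_of_ne (time_ne_zero j hx) with h | h
  · right
    refine ⟨by rw [bil_neg_left, bil_neg_right, neg_neg]; exact hx, ?_⟩
    rw [Pi.neg_apply]; linarith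
  · exact Or.inl ⟨hx, h⟩

/-- This brings H⁴ⱼ into real coordinates; by `mk_emb_eq_iff` the future representative is unique up
to a positive factor. -/
theorem mem_H4_iff {j : Fin 5} {p : ℙ ℂ V} :
    p ∈ H4 j ↔ ∃ (x : Fin 5 → ℝ) (hx : Future j x),
      p = Projectivization.mk ℂ (emb j x) (emb_ne_zero hx) := by
  constructor
  · rintro ⟨hneg, hxi⟩
    change (herm p.rep p.rep).re < 0 at hneg
    have hv := p.rep_nonzero
    have hp := p.mk_rep
    set v := p.rep with hvdef
    rw [← hp, Projectivization.map_mk, Projectivization.mk_eq_mk_iff'] at hxi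
    obtain ⟨c, hc⟩ := hxi
    obtain ⟨a, ha, hav⟩ := exists_smul_mem_VR hv hc.symm
    obtain ⟨x, hx⟩ := exists_emb_of_mem_VR hav
    have hx' : bil j x x < 0 := by
      rw [← ip_emb, ← hx, ip, herm_smul_self, Complex.re_ofReal_mul]
      exact mul_neg_of_pos_of_neg (Complex.normSq_pos.2 ha) hneg
    rcases exists_future_of_neg hx' with h | h
    · refine ⟨x, h, ?_⟩
      rw [← hp, Projectivization.mk_eq_mk_iff']
      exact ⟨a⁻¹, by rw [← hx, smul_smul, inv_mul_cancel₀ ha, one_smul]⟩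
    · refine ⟨-x, h, ?_⟩
      rw [← hp, Projectivization.mk_eq_mk_iff']
      exact ⟨-a⁻¹, by rw [map_neg, ← hx, smul_neg, neg_smul, neg_neg, smul_smul,
        inv_mul_cancel₀ ha, one_smul]⟩
  · rintro ⟨x, hx, rfl⟩
    refine ⟨?_, ?_⟩
    · change (herm _ _).re < 0
      obtain ⟨a, ha⟩ := Projectivization.exists_smul_eq_mk_rep ℂ (emb j x) (emb_ne_zero hx)
      rw [← ha, Units.smul_def, herm_smul_self, Complex.re_ofReal_mul, herm_emb, Complex.ofReal_re]
      exact mul_neg_of_pos_of_neg (Complex.normSq_pos.2 a.ne_zero) hx.1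
    · rw [Projectivization.map_mk]
      congr 1
      exact emb_mem_VR j x

theorem act_mk (G : Gam) (v : V) (hv : v ≠ 0) :
    act (G : PGam) (Projectivization.mk ℂ v hv) =
      Projectivization.mk ℂ (G.1 v) (by rwa [Ne, LinearEquiv.map_eq_zero_iff]) := by
  change G.1 • Projectivization.mk ℂ v hv = _
  rw [Projectivization.smul_mk]
  rfl

theorem mk_emb_eq_iff {j : Fin 5} {x y : Fin 5 → ℝ} (hx : Future j x) (hy : Future j y) :
    Projectivization.mk ℂ (emb j x) (emb_ne_zero hx) =
      Projectivization.mk ℂ (emb j y) (emb_ne_zero hy) ↔ ∃ c : ℝ, 0 < c ∧ x = c • y := by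
  rw [Projectivization.mk_eq_mk_iff']
  constructor
  · rintro ⟨c, hc⟩
    have h0 := congrFun hc 0
    rw [Pi.smul_apply, emb_zero_coord, emb_zero_coord, smul_eq_mul] at h0
    have hy0 : (y 0 : ℂ) ≠ 0 := by exact_mod_cast hy.2.ne'
    have hcr : c = ((x 0 / y 0 : ℝ) : ℂ) := by
      push_cast
      rw [eq_div_iff hy0, h0]
    refine ⟨x 0 / y 0, div_pos hx.2 hy.2, ?_⟩
    apply emb_injective j
    rw [map_smul, ← hc, hcr]
    rfl
  · rintro ⟨c, -, rfl⟩
    exact ⟨(c : ℂ), by rw [map_smul]; rfl⟩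

theorem IsLift.act_emb {j : Fin 5} {G : Gam} {L : Z5 ≃ₗ[ℤ] Z5} (h : IsLift j G L)
    (hL : L ∈ OPlus j) {x : Fin 5 → ℝ} (hx : Future j x) :
    act (G : PGam) (Projectivization.mk ℂ (RealCubic.emb j x) (emb_ne_zero hx)) =
      Projectivization.mk ℂ (RealCubic.emb j (extR L x)) (emb_ne_zero (h.future hL hx)) := by
  rw [act_mk]
  congr 1
  exact h.emb x

theorem isLift_one (j : Fin 5) : IsLift j 1 1 := fun _ => rfl

theorem IsLift.inv {j : Fin 5} {G : Gam} {L : Z5 ≃ₗ[ℤ] Z5} (h : IsLift j G L) :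
    IsLift j G⁻¹ L⁻¹ := by
  intro z
  change G.1.symm (embZ j z) = _
  rw [LinearEquiv.symm_apply_eq, h]
  congr 1
  exact (L.apply_symm_apply z).symm

theorem IsLift.mem_PGamR {j : Fin 5} {G : Gam} {L : Z5 ≃ₗ[ℤ] Z5} (h : IsLift j G L)
    (hL : L ∈ OPlus j) : (G : PGam) ∈ PGamR j := by
  have key : ∀ {G : Gam} {L : Z5 ≃ₗ[ℤ] Z5}, IsLift j G L → L ∈ OPlus j → ∀ p ∈ H4 j,
      act (G : PGam) p ∈ H4 j := by
    intro G L h hL p hp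
    obtain ⟨x, hx, rfl⟩ := mem_H4_iff.1 hp
    rw [h.act_emb hL hx]
    exact mem_H4_iff.2 ⟨_, h.future hL hx, rfl⟩
  change act _ '' H4 j = H4 j
  apply Set.Subset.antisymm
  · rintro _ ⟨p, hp, rfl⟩
    exact key h hL p hp
  · intro p hp
    refine ⟨_, key h.inv ((OPlus j).inv_mem hL) p hp, ?_⟩
    rw [← Equiv.Perm.mul_apply, ← map_mul, QuotientGroup.mk_inv, mul_inv_cancel, map_one]
    rfl

/-! ### Lifting the stabilizer of real hyperbolic space -/

/-- The norm form takes the value 1 at six units only. As ω is the square of ω², each of them is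
plus or minus a square. -/
theorem eisenstein_unit {u : ℂ} (hu : u ∈ eisenstein) (h : u * (starRingEnd ℂ) u = 1) :
    ∃ ε ∈ eisenstein, ε * (starRingEnd ℂ) ε = 1 ∧ (u = ε * ε ∨ u = -(ε * ε)) := by
  obtain ⟨a, b, rfl⟩ := hu
  rw [map_add, map_mul, conj_omega, map_intCast, map_intCast] at h
  have h1 : ((a * a - a * b + b * b : ℤ) : ℂ) = 1 := by
    push_cast
    linear_combination h + (b * b : ℂ) * omega_mul_omega
  have h2 : a * a - a * b + b * b = 1 := by exact_mod_cast h1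
  have hom := omega_mul_omega
  have hone : (1 : ℂ) ∈ eisenstein := by exact_mod_cast eisenstein_int 1
  have n1 : (1 : ℂ) * (starRingEnd ℂ) 1 = 1 := by simp
  have n2 : omega * (starRingEnd ℂ) omega = 1 := by
    rw [conj_omega]; linear_combination -hom
  have n3 : (-1 - omega) * (starRingEnd ℂ) (-1 - omega) = 1 := by
    rw [← conj_omega, Complex.conj_conj, mul_comm]; exact n2
  have hb : b = -1 ∨ b = 0 ∨ b = 1 := by
    have : b ≤ 1 := by nlinarith [sq_nonneg (2 * a - b)]
    have : -1 ≤ b := by nlinarith [sq_nonneg (2 * a - b)]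
    omega
  rcases hb with rfl | rfl | rfl
  · have ha : a = 0 ∨ a = -1 := by
      have : a * (a + 1) = 0 := by linarith
      rcases mul_eq_zero.1 this with h | h
      · left; exact h
      · right; omega
    rcases ha with rfl | rfl
    · refine ⟨-1 - omega, ?_, n3, Or.inr ?_⟩
      · rw [← conj_omega]; exact eisenstein_conj eisenstein_omega
      · push_cast; linear_combination hom
    · refine ⟨omega, eisenstein_omega, n2, Or.inl ?_⟩
      push_cast; linear_combination -hom
  · have ha : a = 1 ∨ a = -1 := by
      have : (a - 1) * (a + 1) = 0 := by linarith
      rcases mul_eq_zero.1 this with h | h <;> omega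
    rcases ha with rfl | rfl
    · exact ⟨1, hone, n1, Or.inl (by simp)⟩
    · exact ⟨1, hone, n1, Or.inr (by simp)⟩
  · have ha : a = 0 ∨ a = 1 := by
      have : a * (a - 1) = 0 := by linarith
      rcases mul_eq_zero.1 this with h | h
      · left; exact h
      · right; omega
    rcases ha with rfl | rfl
    · refine ⟨-1 - omega, ?_, n3, Or.inl ?_⟩
      · rw [← conj_omega]; exact eisenstein_conj eisenstein_omega
      · push_cast; linear_combination -hom
    · refine ⟨omega, eisenstein_omega, n2, Or.inr ?_⟩
      push_cast; linear_combination hom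

theorem exists_scalar {ε : ℂ} (hε : ε ∈ eisenstein) (h : ε * (starRingEnd ℂ) ε = 1) :
    ∃ Z : Gam, (∀ v, Z.1 v = ε • v) ∧ (Z : PGam) = 1 := by
  have h0 : ε ≠ 0 := by
    rintro rfl
    simp at h
  refine ⟨⟨LinearEquiv.smulOfNeZero ℂ V ε h0, fun x y => ?_, fun x => ⟨fun hx i => ?_,
    fun hx i => ?_⟩⟩, fun v => rfl, ?_⟩
  · change herm (ε • x) (ε • y) = _
    rw [herm_smul_left, herm_smul_right, ← mul_assoc, h, one_mul]
  · have := eisenstein_mul (eisenstein_conj hε) (hx i)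
    change (starRingEnd ℂ) ε * (ε * x i) ∈ _ at this
    rwa [← mul_assoc, mul_comm _ ε, h, one_mul] at this
  · exact eisenstein_mul hε (hx i)
  · rw [QuotientGroup.eq_one_iff]
    exact ⟨ε, fun v => rfl⟩

theorem future_two_e0_add (j k : Fin 5) : Future j (2 • e0 + Pi.single k 1 : Z5) := by
  constructor <;> revert k <;> revert j <;> decide

/-- The future cone spans: it contains `e0` and the sums of `2 • e0` with the basis vectors. -/
theorem eq_top_of_future_mem (j : Fin 5) (S : Submodule ℝ (Fin 5 → ℝ))
    (h : ∀ x, Future j x → x ∈ S) (x : Fin 5 → ℝ) : x ∈ S := by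
  have h0 : Future j (toR e0) := future_toR (future_e0 j)
  have hk : ∀ k : Fin 5, (Pi.single k 1 : Fin 5 → ℝ) ∈ S := by
    intro k
    have hf : Future j (toR (2 • e0 + Pi.single k 1)) := future_toR (future_two_e0_add j k)
    have h1 := S.sub_mem (h _ hf) (S.smul_mem (2 : ℝ) (h _ h0))
    convert h1 using 1
    ext i
    simp [toR_apply, Pi.single_apply]
  rw [pi_eq_sum_univ' x]
  exact S.sum_mem fun k _ => S.smul_mem _ (hk k)

/-- A lift of an element of the stabilizer of `H⁴ⱼ` multiplies the real vectors by a common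
scalar. -/
theorem exists_scalar_emb {j : Fin 5} {G : Gam} (hG : (G : PGam) ∈ PGamR j) :
    ∃ c : ℂ, c ≠ 0 ∧ ∀ x, ∃ y, G.1 (emb j x) = c • emb j y := by
  have hfut : ∀ x, Future j x → ∃ (c : ℂ) (y : Fin 5 → ℝ), c ≠ 0 ∧ Future j y ∧
      G.1 (emb j x) = c • emb j y := by
    intro x hx
    have h1 : act (G : PGam) (Projectivization.mk ℂ (emb j x) (emb_ne_zero hx)) ∈ H4 j := by
      rw [← show act (G : PGam) '' H4 j = H4 j from hG]
      exact ⟨_, mem_H4_iff.2 ⟨x, hx, rfl⟩, rfl⟩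
    obtain ⟨y, hy, h2⟩ := mem_H4_iff.1 h1
    rw [act_mk, Projectivization.mk_eq_mk_iff'] at h2
    obtain ⟨c, hc⟩ := h2
    refine ⟨c, y, ?_, hy, hc.symm⟩
    rintro rfl
    rw [zero_smul, eq_comm, LinearEquiv.map_eq_zero_iff] at hc
    exact emb_ne_zero hx hc
  have h0 : Future j (toR e0) := future_toR (future_e0 j)
  obtain ⟨c, y0, hc, hy0, hGe⟩ := hfut _ h0
  refine ⟨c, hc, fun x => ?_⟩
  let S : Submodule ℝ (Fin 5 → ℝ) :=
    { carrier := {x | ∃ y, G.1 (emb j x) = c • emb j y}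
      add_mem' := by
        rintro x x' ⟨y, hy⟩ ⟨y', hy'⟩
        exact ⟨y + y', by rw [map_add, map_add, hy, hy', map_add, smul_add]⟩
      zero_mem' := ⟨0, by rw [map_zero, map_zero, smul_zero]⟩
      smul_mem' := by
        rintro r x ⟨y, hy⟩
        refine ⟨r • y, ?_⟩
        rw [(emb j).map_smul, (emb j).map_smul, ← Complex.coe_smul, ← Complex.coe_smul, map_smul,
          hy, smul_comm] }
  refine eq_top_of_future_mem j S (fun x hx => ?_) x
  obtain ⟨d, y, hd, hy, hGx⟩ := hfut x hx
  -- A priori each future vector has its own scalar. The Hermitian product with the image of `e0`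
  -- stays real, so `d` times the conjugate of `c` is real and `d` is a real multiple of `c`.
  have h1 := G.2.1 (emb j x) (emb j (toR e0))
  rw [hGx, hGe, herm_smul_left, herm_smul_right, herm_emb, herm_emb] at h1
  have hb := (hy.bil_neg j hy0).ne
  have hb' : ((bil j y y0 : ℝ) : ℂ) ≠ 0 := by exact_mod_cast hb
  have hcc : (starRingEnd ℂ) c ≠ 0 := by simpa using hc
  have hN : (Complex.normSq c : ℂ) ≠ 0 := by exact_mod_cast (Complex.normSq_pos.2 hc).ne'
  have hdc : d = c * ((bil j x (toR e0) / (bil j y y0 * Complex.normSq c) : ℝ) : ℂ) := by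
    push_cast
    rw [mul_div_assoc', eq_div_iff (mul_ne_zero hb' hN), ← Complex.mul_conj]
    linear_combination c * h1
  refine ⟨(bil j x (toR e0) / (bil j y y0 * Complex.normSq c)) • y, ?_⟩
  rw [hGx, map_smul, ← Complex.coe_smul, smul_smul, hdc]

theorem eisenstein_prod {ι : Type*} (s : Finset ι) (f : ι → ℂ) (h : ∀ i ∈ s, f i ∈ eisenstein) :
    ∏ i ∈ s, f i ∈ eisenstein := by
  classical
  induction s using Finset.induction_on with
  | empty => simpa using eisenstein_int 1
  | insert i s hi ih =>
    rw [Finset.prod_insert hi]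
    exact eisenstein_mul (h i (Finset.mem_insert_self _ _))
      (ih fun k hk => h k (Finset.mem_insert_of_mem hk))

theorem eisenstein_det {M : Matrix (Fin 5) (Fin 5) ℂ} (hM : ∀ i k, M i k ∈ eisenstein) :
    M.det ∈ eisenstein := by
  rw [Matrix.det_apply]
  refine eisenstein_sum _ _ fun σ _ => ?_
  have h := eisenstein_prod Finset.univ (fun i => M (σ i) i) fun i _ => hM _ _
  rw [Units.smul_def, zsmul_eq_mul]
  exact eisenstein_mul (eisenstein_int _) h

/-- The sign by which `ξⱼ` multiplies the conjugate of a coordinate. -/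
noncomputable def xiSign (j i : Fin 5) : ℂ := if 5 ≤ (i : ℕ) + (j : ℕ) then -1 else 1

theorem xiSign_mul_self (j i : Fin 5) : xiSign j i * xiSign j i = 1 := by
  unfold xiSign; split <;> simp

theorem xi_apply_sign (j : Fin 5) (v : V) (i : Fin 5) :
    xi j v i = xiSign j i * (starRingEnd ℂ) (v i) := by
  rw [xi_apply, xiSign]; split <;> simp

theorem xi_single (j k : Fin 5) :
    xi j (Pi.single k 1 : V) = xiSign j k • (Pi.single k 1 : V) := by
  ext i
  rw [xi_apply_sign, Pi.smul_apply, smul_eq_mul]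
  by_cases h : i = k
  · subst h; simp
  · simp [Pi.single_eq_of_ne h]

theorem xi_mem_Lam {j : Fin 5} {v : V} (hv : v ∈ Lam) : xi j v ∈ Lam := by
  intro i
  rw [xi_apply]
  split
  · exact eisenstein_neg (eisenstein_conj (hv i))
  · exact eisenstein_conj (hv i)

theorem single_mem_Lam (k : Fin 5) : (Pi.single k 1 : V) ∈ Lam := by
  intro i
  by_cases h : i = k
  · subst h; rw [Pi.single_eq_same]; exact_mod_cast eisenstein_int 1
  · rw [Pi.single_eq_of_ne h]; exact_mod_cast eisenstein_int 0

/-- If an element of `Γ` anticommutes with `ξⱼ`, then its determinant is an imaginary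
Eisenstein integer. -/
theorem exists_det_eq {j : Fin 5} {G : Gam} (h : ∀ v, xi j (G.1 v) = -G.1 (xi j v)) :
    ∃ n : ℤ, LinearMap.det (G.1 : V →ₗ[ℂ] V) = n * theta := by
  set M := LinearMap.toMatrix' (G.1 : V →ₗ[ℂ] V) with hM
  have hMapply : ∀ i k, M i k = G.1 (Pi.single k 1) i := by
    intro i k
    rw [hM, LinearMap.toMatrix'_apply]
    rfl
  have hdet : LinearMap.det (G.1 : V →ₗ[ℂ] V) = M.det := (LinearMap.det_toMatrix' _).symm
  rw [hdet]
  refine eisenstein_imag (eisenstein_det fun i k => ?_) ?_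
  · rw [hMapply]
    exact ((G.2.2 _).2 (single_mem_Lam k)) i
  -- ξⱼ is conjugation followed by a diagonal sign matrix. Anticommuting with it makes the conjugate
  -- of `M` similar to `-M`, and in rank 5 the determinant changes sign.
  · have hconj : (starRingEnd ℂ).mapMatrix M =
        Matrix.diagonal (xiSign j) * -M * Matrix.diagonal (xiSign j) := by
      ext i k
      rw [Matrix.mul_diagonal, Matrix.diagonal_mul, RingHom.mapMatrix_apply, Matrix.map_apply,
        Matrix.neg_apply, hMapply]
      have h1 := congrFun (h (Pi.single k 1)) i
      rw [xi_single, xi_apply_sign, map_smul, Pi.neg_apply, Pi.smul_apply, smul_eq_mul] at h1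
      linear_combination xiSign j i * h1 -
        (starRingEnd ℂ) (G.1 (Pi.single k 1) i) * xiSign_mul_self j i
    have hsq : (∏ i, xiSign j i) * ∏ i, xiSign j i = 1 := by
      rw [← Finset.prod_mul_distrib]
      exact Finset.prod_eq_one fun i _ => xiSign_mul_self j i
    rw [RingHom.map_det, hconj, Matrix.det_mul, Matrix.det_mul, Matrix.det_diagonal,
      Matrix.det_neg, Fintype.card_fin]
    linear_combination -M.det * hsq

/-- The determinants of `G` and of its inverse would both be integer multiples of θ, but their
product is 1, which is not divisible by 3. -/
theorem not_anticommute {j : Fin 5} {G : Gam} (h : ∀ v, xi j (G.1 v) = -G.1 (xi j v)) : False := by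
  have h' : ∀ v, xi j ((G⁻¹).1 v) = -(G⁻¹).1 (xi j v) := by
    intro v
    change xi j (G.1.symm v) = -G.1.symm (xi j v)
    have := h (G.1.symm v)
    rw [LinearEquiv.apply_symm_apply] at this
    rw [this, map_neg, neg_neg, LinearEquiv.symm_apply_apply]
  obtain ⟨m, hm⟩ := exists_det_eq h
  obtain ⟨n, hn⟩ := exists_det_eq h'
  have h1 : LinearMap.det (G.1 : V →ₗ[ℂ] V) * LinearMap.det ((G⁻¹).1 : V →ₗ[ℂ] V) = 1 := by
    rw [← LinearMap.det_comp]
    have : (G.1 : V →ₗ[ℂ] V) ∘ₗ ((G⁻¹).1 : V →ₗ[ℂ] V) = LinearMap.id :=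
      LinearMap.ext fun v => G.1.apply_symm_apply v
    rw [this, LinearMap.det_id]
  rw [hm, hn] at h1
  have h2 : ((-3 * (m * n) : ℤ) : ℂ) = (1 : ℤ) := by
    push_cast
    linear_combination h1 - (m * n : ℂ) * theta_mul_theta
  have h3 : -3 * (m * n) = 1 := by exact_mod_cast h2
  omega

theorem xi_comm_of_emb {j : Fin 5} {G : Gam} {u : ℂ}
    (h : ∀ x, xi j (G.1 (emb j x)) = u • G.1 (emb j x)) (v : V) :
    xi j (G.1 v) = u • G.1 (xi j v) := by
  rw [eq_sum_embZ j v]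
  simp only [map_sum, Finset.smul_sum]
  refine Finset.sum_congr rfl fun k _ => ?_
  rw [map_smul, xi_smul, xi_smul, map_smul, embZ, h,
    show xi j (emb j (toR (Pi.single k 1))) = _ from emb_mem_VR j _, smul_comm]

/-- Every element of the stabilizer of `H⁴ⱼ` has a lift to `Γ` that commutes with `ξⱼ`. -/
theorem exists_commuting_lift {j : Fin 5} {g : PGam} (hg : g ∈ PGamR j) :
    ∃ G : Gam, (G : PGam) = g ∧ ∀ v, xi j (G.1 v) = G.1 (xi j v) := by
  obtain ⟨G, rfl⟩ := QuotientGroup.mk_surjective g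
  obtain ⟨c, hc, hcG⟩ := exists_scalar_emb hg
  have hcc : (starRingEnd ℂ) c ≠ 0 := by simpa using hc
  -- `u` measures the failure of `G` to commute with ξⱼ. Rescaling the lift by a unit ε multiplies
  -- `u` by the square of the conjugate of ε.
  set u := (starRingEnd ℂ) c / c with hu
  have hxi : ∀ v, xi j (G.1 v) = u • G.1 (xi j v) := by
    refine xi_comm_of_emb fun x => ?_
    obtain ⟨y, hy⟩ := hcG x
    rw [hy, xi_smul, show xi j (emb j y) = _ from emb_mem_VR j y, smul_smul, hu,
      div_mul_cancel₀ _ hc]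
  have hu1 : u * (starRingEnd ℂ) u = 1 := by
    rw [hu, map_div₀, Complex.conj_conj]
    field_simp
  -- `G` maps `u` times the first basis vector to a vector of Λ, so that multiple lies in Λ itself.
  have hue : u ∈ eisenstein := by
    have h1 : xi j (G.1 (Pi.single 0 1)) ∈ Lam := xi_mem_Lam ((G.2.2 _).2 (single_mem_Lam 0))
    rw [hxi, ← map_smul, G.2.2, xi_single, smul_smul] at h1
    have h2 := h1 0
    rw [Pi.smul_apply, Pi.single_eq_same, smul_eq_mul, mul_one, xiSign, if_neg] at h2
    · rwa [mul_one] at h2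
    · have := j.2
      simp only [Fin.val_zero]
      omega
  obtain ⟨ε, hε, hε1, hεu⟩ := eisenstein_unit hue hu1
  obtain ⟨Z, hZ, hZ1⟩ := exists_scalar hε hε1
  have hZG : ∀ v, (Z * G).1 v = ε • G.1 v := fun v => hZ _
  have hcomm : ∀ v, xi j ((Z * G).1 v) = ((starRingEnd ℂ) ε * u) • G.1 (xi j v) := by
    intro v
    rw [hZG, xi_smul, hxi, smul_smul]
  refine ⟨Z * G, by rw [QuotientGroup.mk_mul, hZ1, one_mul], ?_⟩
  rcases hεu with h | h
  · intro v
    rw [hcomm, hZG, h, ← mul_assoc, mul_comm ((starRingEnd ℂ) ε) ε, hε1, one_mul]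
  · refine (not_anticommute (G := Z * G) (j := j) fun v => ?_).elim
    rw [hcomm, hZG, h, mul_neg, ← mul_assoc, mul_comm ((starRingEnd ℂ) ε) ε, hε1, one_mul, neg_smul]

theorem exists_isLift_of_commute {j : Fin 5} {G : Gam} (h : ∀ v, xi j (G.1 v) = G.1 (xi j v)) :
    ∃ L : Z5 ≃ₗ[ℤ] Z5, IsLift j G L := by
  have key : ∀ {G : Gam}, (∀ v, xi j (G.1 v) = G.1 (xi j v)) → ∀ z, ∃ z', G.1 (embZ j z) = embZ j z' := by
    intro G h z
    obtain ⟨h1, h2⟩ := embZ_mem_LamR j z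
    refine exists_embZ_of_mem_LamR ⟨(G.2.2 _).2 h1, ?_⟩
    change xi j _ = _
    rw [h, show xi j _ = _ from h2]
  have h' : ∀ v, xi j ((G⁻¹).1 v) = (G⁻¹).1 (xi j v) := by
    intro v
    change xi j (G.1.symm v) = G.1.symm (xi j v)
    rw [LinearEquiv.eq_symm_apply, ← h, LinearEquiv.apply_symm_apply]
  choose f hf using key h
  choose f' hf' using key h'
  let A : Z5 ≃+ Z5 :=
    { toFun := f
      invFun := f'
      left_inv := fun z => embZ_injective j (by
        rw [← hf', ← hf]; exact G.1.symm_apply_apply _)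
      right_inv := fun z => embZ_injective j (by
        rw [← hf, ← hf']; exact G.1.apply_symm_apply _)
      map_add' := fun x y => embZ_injective j (by
        rw [embZ_add, ← hf, ← hf, ← hf, embZ_add, map_add]) }
  exact ⟨A.toIntLinearEquiv, hf⟩

/-- Every element of the stabilizer of `H⁴ⱼ` comes from an isometry of `Λⱼ`. -/
theorem exists_lift {j : Fin 5} {g : PGam} (hg : g ∈ PGamR j) :
    ∃ (G : Gam) (L : Z5 ≃ₗ[ℤ] Z5), (G : PGam) = g ∧ L ∈ OPlus j ∧ IsLift j G L := by
  obtain ⟨G, hG, hcomm⟩ := exists_commuting_lift hg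
  obtain ⟨L, hL⟩ := exists_isLift_of_commute hcomm
  have hiso : ∀ x y, bil j (L x) (L y) = bil j x y := by
    intro x y
    have := G.2.1 (embZ j x) (embZ j y)
    rw [hL, hL, herm_embZ, herm_embZ] at this
    exact_mod_cast this
  have hne : L e0 0 ≠ 0 := time_ne_zero j (by rw [hiso]; exact (future_e0 j).1)
  rcases lt_or_gt_of_ne hne with h | h
  -- The isometry and its negative give the same projective element; the sign is chosen to preserve
  -- the future cone.
  · obtain ⟨Z, hZ, hZ1⟩ := exists_scalar (ε := -1) (by simpa using eisenstein_int (-1)) (by simp)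
    refine ⟨Z * G, LinearEquiv.neg ℤ * L, by rw [QuotientGroup.mk_mul, hZ1, one_mul, hG],
      ⟨fun x y => ?_, ?_⟩, fun z => ?_⟩
    · change bil j (-L x) (-L y) = _
      rw [bil_neg_left, bil_neg_right, neg_neg, hiso]
    · change 0 < -L e0 0
      omega
    · change Z.1 (G.1 _) = embZ j (-L z)
      rw [hZ, hL, embZ_neg, neg_one_smul]
  · exact ⟨G, L, hG, ⟨hiso, h⟩, hL⟩

/-! ### The stabilizer of `H⁴ⱼ` as an integral orthogonal group -/

theorem IsLift.eq_one {j : Fin 5} {G : Gam} {L : Z5 ≃ₗ[ℤ] Z5} (h : IsLift j G L)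
    (hL : L ∈ OPlus j) (hG : (G : PGam) = 1) : L = 1 := by
  obtain ⟨c, hc⟩ := (QuotientGroup.eq_one_iff G).1 hG
  have h0 : ((L e0 0 : ℤ) : ℂ) = c := by
    have := congrFun ((h e0).symm.trans (hc _)) 0
    rw [embZ_apply, Pi.smul_apply, embZ_apply, unitFactor_zero] at this
    simpa [e0] using this
  have h1 : L e0 0 = 1 := by
    have h2 := hL.1 e0 e0
    have h3 : L e0 = L e0 0 • e0 := embZ_injective j (by
      rw [embZ_smul, h0, ← hc, h])
    rw [h3, bil_smul_left, bil_smul_right, bil_e0_e0] at h2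
    have h4 := hL.2
    nlinarith
  refine LinearEquiv.ext fun z => embZ_injective j ?_
  rw [← h, hc, ← h0, h1, Int.cast_one, one_smul]
  rfl

/-- A chosen lift to `Γ` of an isometry of `Λⱼ`. -/
noncomputable def liftGam {j : Fin 5} (L : OPlus j) : Gam := (exists_isLift L.2).choose

theorem isLift_liftGam {j : Fin 5} (L : OPlus j) : IsLift j (liftGam L) L.1 :=
  (exists_isLift L.2).choose_spec

/-- Isometries of `Λⱼ` act on `H⁴ⱼ`. -/
noncomputable def toPGamR (j : Fin 5) : OPlus j →* PGamR j where
  toFun L := ⟨(liftGam L : PGam), (isLift_liftGam L).mem_PGamR L.2⟩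
  map_one' := Subtype.ext (by
    have : liftGam (1 : OPlus j) = 1 := (isLift_liftGam 1).unique_left (isLift_one j)
    change ((liftGam (1 : OPlus j) : Gam) : PGam) = 1
    rw [this]; rfl)
  map_mul' L K := Subtype.ext (by
    have : liftGam (L * K) = liftGam L * liftGam K :=
      (isLift_liftGam (L * K)).unique_left ((isLift_liftGam L).mul (isLift_liftGam K))
    change ((liftGam (L * K) : Gam) : PGam) = _
    rw [this]; rfl)

theorem toPGamR_injective (j : Fin 5) : Function.Injective (toPGamR j) := by
  rw [injective_iff_map_eq_one]
  intro L hL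
  exact Subtype.ext ((isLift_liftGam L).eq_one L.2 (congrArg Subtype.val hL))

theorem toPGamR_surjective (j : Fin 5) : Function.Surjective (toPGamR j) := by
  rintro ⟨g, hg⟩
  obtain ⟨G, L, rfl, hL, hGL⟩ := exists_lift hg
  refine ⟨⟨L, hL⟩, Subtype.ext ?_⟩
  change ((liftGam ⟨L, hL⟩ : Gam) : PGam) = G
  rw [(isLift_liftGam ⟨L, hL⟩).unique_left hGL]

/-- The point of `H⁴ⱼ` represented by a future vector. -/
noncomputable def pt {j : Fin 5} {x : Fin 5 → ℝ} (hx : Future j x) : ℙ ℂ V :=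
  Projectivization.mk ℂ (emb j x) (emb_ne_zero hx)

theorem pt_mem {j : Fin 5} {x : Fin 5 → ℝ} (hx : Future j x) : pt hx ∈ H4 j :=
  mem_H4_iff.2 ⟨x, hx, rfl⟩

theorem pt_eq_iff {j : Fin 5} {x y : Fin 5 → ℝ} (hx : Future j x) (hy : Future j y)
    (h : bil j x x = bil j y y) : pt hx = pt hy ↔ x = y := by
  constructor
  · intro hp
    obtain ⟨c, hc, rfl⟩ := (mk_emb_eq_iff hx hy).1 hp
    rw [bil_smul_left, bil_smul_right] at h
    have hy1 := hy.1
    have h1 : (c * c - 1) * bil j y y = 0 := by linarith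
    have h2 : c * c - 1 = 0 := (mul_eq_zero.1 h1).resolve_right hy1.ne
    have : c = 1 := by nlinarith
    rw [this, one_smul]
  · rintro rfl; rfl

theorem future_extR {j : Fin 5} (L : OPlus j) {x : Fin 5 → ℝ} (hx : Future j x) :
    Future j (extR L.1 x) := (isLift_liftGam L).future L.2 hx

theorem bil_extR {j : Fin 5} (L : OPlus j) (x y : Fin 5 → ℝ) :
    bil j (extR L.1 x) (extR L.1 y) = bil j x y := (isLift_liftGam L).bil_extR x y

theorem act_toPGamR {j : Fin 5} (L : OPlus j) {x : Fin 5 → ℝ} (hx : Future j x) :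
    act (toPGamR j L).1 (pt hx) = pt (future_extR L hx) :=
  (isLift_liftGam L).act_emb L.2 hx

/-! ### Reflections -/

theorem refl_apply (r x : V) : refl r x = x - (2 * herm x r / herm r r) • r := rfl

theorem IsReflZ.refl_embZ {j : Fin 5} {L : Z5 ≃ₗ[ℤ] Z5} {n : Z5} (h : IsReflZ j L n) (z : Z5) :
    refl (embZ j n) (embZ j z) = embZ j (L z) := by
  have hN : ((bil j n n : ℤ) : ℂ) ≠ 0 := by exact_mod_cast h.1.ne'
  have h1 := congrArg (embZ j) (h.2 z)
  rw [sub_eq_add_neg, embZ_add, embZ_neg, embZ_smul, embZ_smul, embZ_smul] at h1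
  rw [refl_apply, herm_embZ, herm_embZ]
  apply smul_right_injective V hN
  change ((bil j n n : ℤ) : ℂ) • _ = ((bil j n n : ℤ) : ℂ) • embZ j (L z)
  rw [h1, smul_sub, smul_smul, mul_div_cancel₀ _ hN]
  push_cast
  exact sub_eq_add_neg _ _

theorem IsReflZ.refl_eq {j : Fin 5} {L : Z5 ≃ₗ[ℤ] Z5} {n : Z5} (h : IsReflZ j L n) {G : Gam}
    (hG : IsLift j G L) (v : V) : G.1 v = refl (embZ j n) v := by
  rw [eq_sum_embZ j v, map_sum, map_sum]
  refine Finset.sum_congr rfl fun k _ => ?_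
  rw [map_smul, map_smul, hG, h.refl_embZ]

theorem IsReflZ.actsAsReflection {j : Fin 5} {L : OPlus j} {n : Z5} (h : IsReflZ j L.1 n) :
    ActsAsReflection j (embZ j n) (toPGamR j L) := by
  intro p hp
  obtain ⟨x, hx, rfl⟩ := mem_H4_iff.1 hp
  change act ((liftGam L : Gam) : PGam) _ = _
  rw [act_mk, reflP, Projectivization.map_mk]
  congr 1
  exact h.refl_eq (isLift_liftGam L) _

theorem isReflZ_s (j : Fin 5) (a : Fin (numNodes j)) :
    IsReflZ j ((realization j).s a) (rootZ j a) := by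
  rw [IsReflZ, bil_rootZ_self]
  refine ⟨nodeNorm_pos j a, fun x => ?_⟩
  rw [s_apply_root, smul_sub, smul_smul, mul_comm _ (corootZ j a x), corootZ_mul]

theorem extR_add (L : Z5 ≃ₗ[ℤ] Z5) (x y : Fin 5 → ℝ) : extR L (x + y) = extR L x + extR L y := by
  simp only [extR, Pi.add_apply, add_smul, Finset.sum_add_distrib]

theorem extR_smul (L : Z5 ≃ₗ[ℤ] Z5) (c : ℝ) (x : Fin 5 → ℝ) : extR L (c • x) = c • extR L x := by
  simp only [extR, Pi.smul_apply, smul_eq_mul, mul_smul, Finset.smul_sum]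

/-- Equality on lines becomes equality on future vectors because both maps preserve the norm and the
future cone, and then on all vectors by linearity. The reflecting vector may be irrational, but for
a basis vector `z` not orthogonal to it, `z - L.1 z` is an integral vector on the same line. -/
theorem exists_isReflZ {j : Fin 5} {L : OPlus j} (h : IsReflection j (toPGamR j L)) :
    ∃ n, IsReflZ j L.1 n := by
  obtain ⟨r, hr, hpos, hact⟩ := h
  obtain ⟨ρ, rfl⟩ := exists_emb_of_mem_VR hr
  rw [ip_emb] at hpos
  set N := bil j ρ ρ with hN
  have hNC : (N : ℂ) ≠ 0 := by exact_mod_cast hpos.ne'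
  have hrefl : ∀ x, refl (emb j ρ) (emb j x) = emb j (x - (2 * bil j x ρ / N) • ρ) := by
    intro x
    rw [refl_apply, herm_emb, herm_emb, map_sub, map_smul, ← Complex.coe_smul]
    push_cast
    rfl
  have hfut : ∀ x, Future j x → extR L.1 x = x - (2 * bil j x ρ / N) • ρ := by
    intro x hx
    have hiso : bil j (x - (2 * bil j x ρ / N) • ρ) (x - (2 * bil j x ρ / N) • ρ) = bil j x x := by
      simp only [bil_sub_left, bil_sub_right, bil_smul_left, bil_smul_right, ← hN,
        bil_comm j ρ x]
      field_simp
      ring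
    have hx' : Future j (x - (2 * bil j x ρ / N) • ρ) := by
      refine hx.of_bil_neg j (by rw [hiso]; exact hx.1) ?_
      rw [bil_sub_right, bil_smul_right]
      have : 0 ≤ 2 * bil j x ρ / N * bil j x ρ := by
        rw [div_mul_eq_mul_div, mul_assoc]
        exact div_nonneg (mul_nonneg (by norm_num) (mul_self_nonneg _)) hpos.le
      have := hx.1
      linarith
    refine (pt_eq_iff (future_extR L hx) hx' (by rw [bil_extR, hiso])).1 ?_
    rw [← act_toPGamR L hx, hact _ (pt_mem hx), pt, reflP, Projectivization.map_mk]
    exact (Projectivization.mk_eq_mk_iff' ..).2 ⟨1, by rw [one_smul, hrefl]⟩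
  have hall : ∀ x, extR L.1 x = x - (2 * bil j x ρ / N) • ρ := by
    let S : Submodule ℝ (Fin 5 → ℝ) :=
      { carrier := {x | extR L.1 x = x - (2 * bil j x ρ / N) • ρ}
        add_mem' := by
          intro x y hx hy
          change extR L.1 (x + y) = _
          rw [extR_add, show extR L.1 x = _ from hx, show extR L.1 y = _ from hy, bil_add_left,
            mul_add, add_div, add_smul]
          abel
        zero_mem' := by
          change extR L.1 0 = _
          have := extR_smul L.1 0 0
          rw [zero_smul, zero_smul] at this
          have h0 : bil j (0 : Fin 5 → ℝ) ρ = 0 := by simp [bil]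
          rw [this, h0, mul_zero, zero_div, zero_smul, sub_zero]
        smul_mem' := by
          intro c x hx
          change extR L.1 (c • x) = _
          rw [extR_smul, show extR L.1 x = _ from hx, bil_smul_left, smul_sub, smul_smul]
          congr 2
          ring }
    exact fun x => eq_top_of_future_mem j S hfut x
  obtain ⟨i, hi⟩ : ∃ i, ρ i ≠ 0 := by
    by_contra hc
    push Not at hc
    rw [show ρ = 0 from funext hc] at hN
    rw [hN] at hpos
    simp [bil] at hpos
  have hwt : (wt j i : ℝ) ≠ 0 := by
    have : wt j i ≠ 0 := by
      clear * -
      revert i; revert j; decide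
    exact_mod_cast this
  set z : Z5 := Pi.single i 1 with hz
  have hzρ : bil j (toR z) ρ ≠ 0 := by
    have : bil j (toR z) ρ = wt j i * ρ i := by
      have h1 : toR z = Pi.single i 1 := by
        ext k; simp [toR_apply, hz, Pi.single_apply]
      rw [bil_comm, h1, bil_single_right, mul_one]
    rw [this]
    exact mul_ne_zero hwt hi
  set k := 2 * bil j (toR z) ρ / N with hk
  have hk0 : k ≠ 0 := div_ne_zero (mul_ne_zero two_ne_zero hzρ) hpos.ne'
  have hn : toR (z - L.1 z) = k • ρ := by
    rw [map_sub, ← extR_toR, hall, sub_sub_cancel]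
  have hbn : ((bil j (z - L.1 z) (z - L.1 z) : ℤ) : ℝ) = k * k * N := by
    rw [← bil_toR, hn, bil_smul_left, bil_smul_right]; ring
  refine ⟨z - L.1 z, ?_, fun x => toR_injective ?_⟩
  · have : (0 : ℝ) < k * k * N := mul_pos (mul_self_pos.2 hk0) hpos
    rw [← hbn] at this
    exact_mod_cast this
  · rw [map_sub, map_zsmul, map_zsmul, map_zsmul, ← extR_toR, hall, hn,
      ← Int.cast_smul_eq_zsmul ℝ, ← Int.cast_smul_eq_zsmul ℝ, ← Int.cast_smul_eq_zsmul ℝ, hbn]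
    push_cast
    rw [← bil_toR, hn, bil_smul_right, smul_sub, smul_smul, smul_smul]
    congr 2
    field_simp

/-! ### The reflection group -/

/-- The Coxeter group of the diagram acts on `Λⱼ`. -/
noncomputable def rhoO (j : Fin 5) : (coxeterMatrix j).Group →* OPlus j :=
  (realization j).rho.codRestrict (OPlus j) (rho_mem_OPlus j)

/-- The Coxeter group of the diagram acts on `H⁴ⱼ`. -/
noncomputable def kappa (j : Fin 5) : (coxeterMatrix j).Group →* PGamR j :=
  (toPGamR j).comp (rhoO j)

/-- The functional of a vector inside the chamber. -/
noncomputable def chamberFun (j : Fin 5) (x : Fin 5 → ℝ) : Z5 →+ ℝ where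
  toFun m := bil j x (toR m)
  map_zero' := by simp [bil]
  map_add' m n := by rw [map_add, bil_add_right]

theorem chamberFun_interiorZ (j : Fin 5) (a : Fin (numNodes j)) :
    chamberFun j (toR (interiorZ j)) (rootZ j a) < 0 := by
  change bil j _ _ < 0
  rw [bil_toR]
  exact_mod_cast bil_interiorZ j a

theorem kappa_injective (j : Fin 5) : Function.Injective (kappa j) := by
  refine (toPGamR_injective j).comp fun w w' h => ?_
  exact (realization j).rho_injective (chamberFun j (toR (interiorZ j)))
    (chamberFun_interiorZ j) (congrArg Subtype.val h)

theorem exists_kappa_of_isReflZ {j : Fin 5} {L : OPlus j} {n : Z5} (h : IsReflZ j L.1 n) :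
    ∃ w, kappa j w = toPGamR j L := by
  obtain ⟨w, hw⟩ := h.exists_rho L.2
  exact ⟨w, congrArg (toPGamR j) (Subtype.ext hw.symm)⟩

theorem kappa_simple_actsAsReflection (j : Fin 5) (a : Fin (numNodes j)) :
    ActsAsReflection j (simpleRoot j a)
      (kappa j ((coxeterMatrix j).toCoxeterSystem.simple a)) := by
  rw [simpleRoot_eq]
  refine IsReflZ.actsAsReflection (L := rhoO j _) ?_
  change IsReflZ j ((realization j).rho _) _
  rw [CartanRealization.rho_simple]
  exact isReflZ_s j a

theorem simpleRoot_mem_VR (j : Fin 5) (a : Fin (numNodes j)) : simpleRoot j a ∈ VR j := by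
  rw [simpleRoot_eq]; exact emb_mem_VR j _

theorem ip_simpleRoot (j : Fin 5) (a b : Fin (numNodes j)) :
    ip (simpleRoot j a) (simpleRoot j b) = ((bil j (rootZ j a) (rootZ j b) : ℤ) : ℝ) := by
  rw [simpleRoot_eq, simpleRoot_eq, ip, herm_embZ, Complex.intCast_re]

theorem ip_simpleRoot_self (j : Fin 5) (a : Fin (numNodes j)) :
    ip (simpleRoot j a) (simpleRoot j a) = nodeNorm j a := by
  rw [ip_simpleRoot, bil_rootZ_self]; norm_cast

theorem kappa_simple_isReflection (j : Fin 5) (a : Fin (numNodes j)) :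
    IsReflection j (kappa j ((coxeterMatrix j).toCoxeterSystem.simple a)) :=
  ⟨_, simpleRoot_mem_VR j a, by
    rw [ip_simpleRoot_self]; exact_mod_cast nodeNorm_pos j a, kappa_simple_actsAsReflection j a⟩

/-- A generator of Wⱼ is only known to act as some real reflection: `exists_isReflZ` makes it an
integral one, and `IsReflZ.exists_rho` places it in the Coxeter group. -/
theorem W_eq_range (j : Fin 5) : W j = (kappa j).range := by
  apply le_antisymm
  · refine (Subgroup.closure_le _).2 fun g hg => ?_
    obtain ⟨L, rfl⟩ := toPGamR_surjective j g
    obtain ⟨n, hn⟩ := exists_isReflZ hg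
    exact exists_kappa_of_isReflZ hn
  · rintro _ ⟨w, rfl⟩
    induction w using (coxeterMatrix j).toCoxeterSystem.simple_induction with
    | simple a => exact Subgroup.subset_closure (kappa_simple_isReflection j a)
    | one => rw [map_one]; exact (W j).one_mem
    | mul w w' h h' => rw [map_mul]; exact (W j).mul_mem h h'

theorem kappa_mem_W (j : Fin 5) (w : (coxeterMatrix j).Group) : kappa j w ∈ W j := by
  rw [W_eq_range]; exact ⟨w, rfl⟩

theorem W_normal (j : Fin 5) : (W j).Normal where
  conj_mem := by
    intro g hg t
    rw [W_eq_range] at hg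
    obtain ⟨w, rfl⟩ := hg
    obtain ⟨K, rfl⟩ := toPGamR_surjective j t
    induction w using (coxeterMatrix j).toCoxeterSystem.simple_induction with
    | simple a =>
      obtain ⟨w, hw⟩ := exists_kappa_of_isReflZ
        (L := K * rhoO j ((coxeterMatrix j).toCoxeterSystem.simple a) * K⁻¹)
        (n := K.1 (rootZ j a)) (by
          have := (isReflZ_s j a).conj K.2
          rw [← CartanRealization.rho_simple] at this
          exact this)
      rw [map_mul, map_mul, map_inv] at hw
      rw [show kappa j _ = toPGamR j (rhoO j _) from rfl, ← hw]
      exact kappa_mem_W j w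
    | one => rw [map_one, mul_one, mul_inv_cancel]; exact (W j).one_mem
    | mul w w' h h' =>
      have := (W j).mul_mem h h'
      rw [map_mul]
      convert this using 1
      group

/-- The Coxeter group of the diagram is isomorphic to `Wⱼ`. -/
noncomputable def kappaEquiv (j : Fin 5) : (coxeterMatrix j).Group ≃* W j :=
  MulEquiv.ofBijective ((kappa j).codRestrict (W j) (kappa_mem_W j))
    ⟨fun w w' h => kappa_injective j (congrArg Subtype.val h), by
      rintro ⟨g, hg⟩
      rw [W_eq_range] at hg
      obtain ⟨w, rfl⟩ := hg
      exact ⟨w, rfl⟩⟩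

/-! ### Diagram automorphisms -/

/-- The bond between two nodes, given by their numbers. -/
def natBond (j : Fin 5) (a b : ℕ) : Bond :=
  match (edges j).find? (fun e =>
    decide ((e.1 = a + 1 ∧ e.2.1 = b + 1) ∨ (e.1 = b + 1 ∧ e.2.1 = a + 1))) with
  | some e => e.2.2
  | Option.none => Bond.none

/-- In each diagram the type of the bond at which the trace starts occurs once. Following bonds from
it determines the images of all nodes, so only partial matches are enumerated instead of all
permutations. -/
theorem aut_zero : ∀ a b : Fin 5, natBond 0 a b = .double → ∀ c : Fin 5, natBond 0 c a = .single →
    ∀ d : Fin 5, natBond 0 d a = .single ∧ d ≠ c → ∀ e : Fin 5, natBond 0 e d = .single ∧ e ≠ a →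
    ![e, d, a, b, c] = id := by
  decide +kernel

theorem aut_one : ∀ a b : Fin 7, natBond 1 a b = .strong → ∀ c : Fin 7, natBond 1 c a = .weak →
    ∀ d : Fin 7, natBond 1 d c = .single → ∀ e : Fin 7, natBond 1 e d = .double →
    ∀ f : Fin 7, natBond 1 f e = .double → f ≠ d → ∀ g : Fin 7, natBond 1 g f = .single →
    ![g, f, e, a, c, d, b] = id ∨ ![g, f, e, a, c, d, b] = flipPermOne := by
  decide +kernel

theorem aut_two : ∀ a b : Fin 7, natBond 2 a b = .strong → ∀ c : Fin 7, natBond 2 c a = .double →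
    ∀ d : Fin 7, natBond 2 d c = .triple → ∀ e : Fin 7, natBond 2 e d = .double →
    ∀ f : Fin 7, natBond 2 f b = .double → ∀ g : Fin 7, natBond 2 g f = .triple →
    ![f, b, d, e, c, a, g] = id ∨ ![f, b, d, e, c, a, g] = flipPermTwo := by
  decide +kernel

theorem aut_three : ∀ a b : Fin 7, natBond 3 a b = .triple → ∀ c : Fin 7, natBond 3 c b = .single →
    ∀ d : Fin 7, natBond 3 d c = .double → ∀ e : Fin 7, natBond 3 e d = .weak →
    ∀ f : Fin 7, natBond 3 f e = .strong → ∀ g : Fin 7, natBond 3 g f = .weak →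
    ![f, b, c, d, a, g, e] = id := by
  decide +kernel

theorem aut_four : ∀ a b : Fin 6, natBond 4 a b = .triple → ∀ c : Fin 6, natBond 4 c b = .single →
    ∀ d : Fin 6, natBond 4 d c = .single → d ≠ b → ∀ e : Fin 6, natBond 4 e d = .double →
    ∀ f : Fin 6, natBond 4 f e = .strong → ![b, c, d, e, a, f] = id := by
  decide +kernel

theorem eq_one_or_eq_flipPerm {j : Fin 5} {σ : Equiv.Perm (Fin (numNodes j))}
    (hσ : σ ∈ DiagramAut j) : σ = 1 ∨ σ = flipPerm j := by
  have h : ∀ a b t, bond j a b = t → bond j (σ a) (σ b) = t := fun a b t ht => (hσ a b).trans ht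
  have hne : ∀ {a b : Fin (numNodes j)}, a ≠ b → σ a ≠ σ b := fun hab => σ.injective.ne hab
  fin_cases j
  · left
    refine Equiv.coe_fn_injective ?_
    have e := aut_zero (σ (2 : Fin 5)) (σ (3 : Fin 5)) (h _ _ _ rfl) (σ (4 : Fin 5)) (h _ _ _ rfl)
      (σ (1 : Fin 5)) ⟨h _ _ _ rfl, hne (show (1 : Fin 5) ≠ 4 by decide)⟩ (σ (0 : Fin 5))
      ⟨h _ _ _ rfl, hne (show (0 : Fin 5) ≠ 2 by decide)⟩
    refine Eq.trans ?_ e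
    exact (FinVec.etaExpand_eq (m := 5) σ).symm
  · have e := aut_one (σ (3 : Fin 7)) (σ (6 : Fin 7)) (h _ _ _ rfl) (σ (4 : Fin 7)) (h _ _ _ rfl)
      (σ (5 : Fin 7)) (h _ _ _ rfl) (σ (2 : Fin 7)) (h _ _ _ rfl) (σ (1 : Fin 7)) (h _ _ _ rfl)
      (hne (show (1 : Fin 7) ≠ 5 by decide)) (σ (0 : Fin 7)) (h _ _ _ rfl)
    exact e.imp (fun e => Equiv.coe_fn_injective ((FinVec.etaExpand_eq (m := 7) σ).symm.trans e))
      fun e => Equiv.coe_fn_injective ((FinVec.etaExpand_eq (m := 7) σ).symm.trans e)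
  · have e := aut_two (σ (5 : Fin 7)) (σ (1 : Fin 7)) (h _ _ _ rfl) (σ (4 : Fin 7)) (h _ _ _ rfl)
      (σ (2 : Fin 7)) (h _ _ _ rfl) (σ (3 : Fin 7)) (h _ _ _ rfl) (σ (0 : Fin 7)) (h _ _ _ rfl)
      (σ (6 : Fin 7)) (h _ _ _ rfl)
    exact e.imp (fun e => Equiv.coe_fn_injective ((FinVec.etaExpand_eq (m := 7) σ).symm.trans e))
      fun e => Equiv.coe_fn_injective ((FinVec.etaExpand_eq (m := 7) σ).symm.trans e)
  · have e := aut_three (σ (4 : Fin 7)) (σ (1 : Fin 7)) (h _ _ _ rfl) (σ (2 : Fin 7)) (h _ _ _ rfl)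
      (σ (3 : Fin 7)) (h _ _ _ rfl) (σ (6 : Fin 7)) (h _ _ _ rfl) (σ (0 : Fin 7)) (h _ _ _ rfl)
      (σ (5 : Fin 7)) (h _ _ _ rfl)
    exact Or.inl (Equiv.coe_fn_injective ((FinVec.etaExpand_eq (m := 7) σ).symm.trans e))
  · have e := aut_four (σ (4 : Fin 6)) (σ (0 : Fin 6)) (h _ _ _ rfl) (σ (1 : Fin 6)) (h _ _ _ rfl)
      (σ (2 : Fin 6)) (h _ _ _ rfl) (hne (show (2 : Fin 6) ≠ 0 by decide)) (σ (3 : Fin 6)) (h _ _ _ rfl)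
      (σ (5 : Fin 6)) (h _ _ _ rfl)
    exact Or.inl (Equiv.coe_fn_injective ((FinVec.etaExpand_eq (m := 6) σ).symm.trans e))

theorem flipPerm_mem (j : Fin 5) : flipPerm j ∈ DiagramAut j := by
  change ∀ a b, bond j (flipPerm j a) (flipPerm j b) = bond j a b
  revert j; decide +kernel

theorem flipPerm_ne_one {j : Fin 5} (hj : j = 1 ∨ j = 2) : flipPerm j ≠ 1 := by
  revert j; decide +kernel

theorem flipPerm_eq_one {j : Fin 5} (hj : ¬(j = 1 ∨ j = 2)) : flipPerm j = 1 := by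
  revert j; decide +kernel

theorem diagramAut_mulEquiv {j : Fin 5} (hj : j = 1 ∨ j = 2) :
    Nonempty (DiagramAut j ≃* Multiplicative (ZMod 2)) := by
  have hcard : Nat.card (DiagramAut j) = 2 := by
    refine Nat.card_eq_two_iff.2 ⟨1, ⟨flipPerm j, flipPerm_mem j⟩, fun h => ?_, ?_⟩
    · exact flipPerm_ne_one hj (congrArg Subtype.val h).symm
    · refine Set.eq_univ_of_forall fun σ => ?_
      exact (eq_one_or_eq_flipPerm σ.2).imp (fun h => Subtype.ext h) fun h => Subtype.ext h
  have : Fact (Nat.Prime 2) := ⟨Nat.prime_two⟩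
  exact ⟨mulEquivOfPrimeCardEq (p := 2) hcard (by simp)⟩

theorem diagramAut_subsingleton {j : Fin 5} (hj : ¬(j = 1 ∨ j = 2)) :
    Subsingleton (DiagramAut j) := by
  have h : ∀ σ : DiagramAut j, σ = 1 := fun σ => Subtype.ext (by
    have := eq_one_or_eq_flipPerm σ.2
    rwa [flipPerm_eq_one hj, or_self] at this)
  exact ⟨fun σ τ => by rw [h σ, h τ]⟩

/-- The isometry of `Λⱼ` that realizes a diagram automorphism. -/
noncomputable def autIsom (j : Fin 5) : DiagramAut j →* OPlus j where
  toFun σ := if σ = 1 then 1 else ⟨flip j, flip_mem_OPlus j⟩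
  map_one' := if_pos rfl
  map_mul' σ τ := by
    by_cases hσ : σ = 1
    · rw [hσ, one_mul, if_pos rfl, one_mul]
    by_cases hτ : τ = 1
    · rw [hτ, mul_one, if_pos rfl, mul_one]
    have h1 := (eq_one_or_eq_flipPerm σ.2).resolve_left fun h => hσ (Subtype.ext h)
    have h2 := (eq_one_or_eq_flipPerm τ.2).resolve_left fun h => hτ (Subtype.ext h)
    have h3 : σ * τ = 1 := Subtype.ext (by
      change σ.1 * τ.1 = 1
      rw [h1, h2, flipPerm_mul_flipPerm])
    rw [h3, if_pos rfl, if_neg hσ, if_neg hτ]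
    exact Subtype.ext (flip_mul_flip j).symm

theorem autIsom_rootZ {j : Fin 5} (σ : DiagramAut j) (a : Fin (numNodes j)) :
    (autIsom j σ).1 (rootZ j a) = rootZ j (σ.1 a) := by
  change (if σ = 1 then (1 : OPlus j) else ⟨flip j, flip_mem_OPlus j⟩).1 _ = _
  split
  · next h => rw [h]; rfl
  · next h =>
    rw [(eq_one_or_eq_flipPerm σ.2).resolve_left fun h' => h (Subtype.ext h')]
    exact flip_rootZ j a

theorem exists_autIsom_eq_flip (j : Fin 5) : ∃ σ, (autIsom j σ).1 = flip j := by
  by_cases hj : j = 1 ∨ j = 2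
  · refine ⟨⟨flipPerm j, flipPerm_mem j⟩, ?_⟩
    change (if _ then (1 : OPlus j) else ⟨flip j, flip_mem_OPlus j⟩).1 = _
    rw [if_neg]
    exact fun h => flipPerm_ne_one hj (congrArg Subtype.val h)
  · refine ⟨1, ?_⟩
    rw [map_one]
    push Not at hj
    fin_cases j <;> first | rfl | exact absurd rfl hj.1 | exact absurd rfl hj.2

theorem rootZ_injective (j : Fin 5) : Function.Injective (rootZ j) := by
  have : ∀ a b, rootZ j a = rootZ j b → a = b := by revert j; decide +kernel
  exact fun a b h => this a b h

/-- Diagram automorphisms act on `H⁴ⱼ`. -/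
noncomputable def autP (j : Fin 5) : DiagramAut j →* PGamR j := (toPGamR j).comp (autIsom j)

theorem autP_mul_kappa_simple {j : Fin 5} (σ : DiagramAut j) (a : Fin (numNodes j)) :
    autP j σ * kappa j ((coxeterMatrix j).toCoxeterSystem.simple a) =
      kappa j ((coxeterMatrix j).toCoxeterSystem.simple (σ.1 a)) * autP j σ := by
  have h := mul_s_eq (autIsom j σ).2 (autIsom_rootZ σ a)
  rw [← CartanRealization.rho_simple, ← CartanRealization.rho_simple] at h
  have h' : autIsom j σ * rhoO j ((coxeterMatrix j).toCoxeterSystem.simple a) =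
      rhoO j ((coxeterMatrix j).toCoxeterSystem.simple (σ.1 a)) * autIsom j σ := Subtype.ext h
  have h2 := congrArg (toPGamR j) h'
  rwa [map_mul, map_mul] at h2

instance (j : Fin 5) : (W j).Normal := W_normal j

/-- The action of the diagram automorphisms on `Wⱼ` by conjugation. -/
noncomputable def autAction (j : Fin 5) : DiagramAut j →* MulAut (W j) :=
  MulAut.conjNormal.comp (autP j)

theorem autAction_simple {j : Fin 5} (σ : DiagramAut j) (a : Fin (numNodes j)) :
    autAction j σ (kappaEquiv j ((coxeterMatrix j).toCoxeterSystem.simple a)) =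
      kappaEquiv j ((coxeterMatrix j).toCoxeterSystem.simple (σ.1 a)) := by
  refine Subtype.ext ?_
  change autP j σ * kappa j _ * (autP j σ)⁻¹ = kappa j _
  rw [autP_mul_kappa_simple, mul_inv_cancel_right]

/-- The natural map from the semidirect product to the stabilizer of `H⁴ⱼ`. -/
noncomputable def semidirectHom (j : Fin 5) : W j ⋊[autAction j] DiagramAut j →* PGamR j :=
  SemidirectProduct.lift (W j).subtype (autP j) (fun _ => MonoidHom.ext fun _ => rfl)

/-- If the product is trivial, the Coxeter factor permutes the simple roots, hence preserves the
chamber and is 1; the diagram automorphism then fixes every simple root. -/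
theorem semidirectHom_injective (j : Fin 5) : Function.Injective (semidirectHom j) := by
  rw [injective_iff_map_eq_one]
  rintro ⟨w, σ⟩ h
  change w.1 * autP j σ = 1 at h
  obtain ⟨y, hy⟩ := (kappaEquiv j).surjective w
  have hw : w.1 = toPGamR j (rhoO j y) := by rw [← hy]; rfl
  have h1 : rhoO j y * autIsom j σ = 1 := by
    apply toPGamR_injective j
    rw [map_mul, ← hw, map_one]
    exact h
  have h2 : ∀ a, (realization j).rho y (rootZ j (σ.1 a)) = rootZ j a := by
    intro a
    have := congrArg (fun L : OPlus j => L.1 (rootZ j a)) h1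
    rw [← autIsom_rootZ]
    exact this
  have hy1 : y = 1 := by
    refine (realization j).eq_one_of_chamber (chamberFun j (toR (interiorZ j)))
      (chamberFun_interiorZ j) y fun a => ?_
    have := h2 (σ.1⁻¹ a)
    rw [show σ.1 (σ.1⁻¹ a) = a from σ.1.apply_symm_apply a] at this
    change chamberFun j _ ((realization j).rho y (rootZ j a)) ≤ 0
    rw [this]
    exact (chamberFun_interiorZ j _).le
  have hσ : σ = 1 := Subtype.ext (Equiv.ext fun a => rootZ_injective j (by
    refine Eq.trans ?_ (h2 a)
    rw [hy1, map_one]; rfl))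
  rw [hσ, ← hy, hy1, map_one]
  rfl

theorem semidirectHom_surjective (j : Fin 5) : Function.Surjective (semidirectHom j) := by
  intro g
  obtain ⟨L, rfl⟩ := toPGamR_surjective j g
  obtain ⟨σ, hσ⟩ := exists_autIsom_eq_flip j
  obtain ⟨w, hw | hw⟩ := exists_rho_mul_flip j L.2
  · refine ⟨⟨kappaEquiv j w, 1⟩, ?_⟩
    change kappa j w * autP j 1 = _
    rw [map_one, mul_one]
    exact congrArg (toPGamR j) (Subtype.ext hw.symm)
  · refine ⟨⟨kappaEquiv j w, σ⟩, ?_⟩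
    change toPGamR j (rhoO j w) * toPGamR j (autIsom j σ) = _
    rw [← map_mul]
    refine congrArg (toPGamR j) (Subtype.ext ?_)
    rw [hw, ← hσ]
    rfl

/-- `PΓⱼᴿ` is the semidirect product of `Wⱼ` and the diagram automorphisms. -/
noncomputable def semidirectEquiv (j : Fin 5) : W j ⋊[autAction j] DiagramAut j ≃* PGamR j :=
  MulEquiv.ofBijective (semidirectHom j) ⟨semidirectHom_injective j, semidirectHom_surjective j⟩

theorem semidirectEquiv_inl (j : Fin 5) (w : W j) :
    semidirectEquiv j (SemidirectProduct.inl w) = w := by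
  change w.1 * autP j 1 = w
  rw [map_one, mul_one]

theorem semidirectEquiv_inr (j : Fin 5) (σ : DiagramAut j) :
    semidirectEquiv j (SemidirectProduct.inr σ) = autP j σ := by
  change 1 * autP j σ = _
  rw [one_mul]

/-! ### The polyhedron of the simple roots -/

/-- The coefficients of the corner `(1, 0, 0, 0, 0)` of the chamber in the simple roots. -/
def cornerCoeff : (j : Fin 5) → Fin (numNodes j) → ℕ
  | 0 => ![1, 2, 3, 3, 1]
  | 1 => ![0, 0, 0, 1, 1, 0, 0]
  | 2 => ![0, 0, 1, 1, 1, 0, 0]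
  | 3 => ![0, 1, 1, 1, 1, 0, 0]
  | 4 => ![1, 1, 1, 1, 1, 0]

theorem sum_cornerCoeff (j : Fin 5) : ∑ a, (cornerCoeff j a : ℤ) • rootZ j a = e0 := by
  revert j; decide +kernel

/-- The polyhedron does not prescribe the sign of its representatives. It is forced because `e0` is
a nonnegative combination of simple roots. -/
theorem future_of_nonpos {j : Fin 5} {x : Fin 5 → ℝ} (hx : bil j x x < 0)
    (h : ∀ a, bil j x (toR (rootZ j a)) ≤ 0) : Future j x := by
  refine ⟨hx, lt_of_le_of_ne ?_ (time_ne_zero j hx).symm⟩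
  have h1 : chamberFun j x e0 ≤ 0 := by
    rw [← sum_cornerCoeff j, map_sum]
    refine Finset.sum_nonpos fun a _ => ?_
    rw [map_zsmul, natCast_zsmul]
    exact nsmul_nonpos (h a) _
  have h2 : chamberFun j x e0 = -x 0 := by
    change bil j x (toR e0) = _
    have : toR e0 = Pi.single 0 1 := by
      rw [e0_eq]
      ext i
      simp [toR_apply, Pi.single_apply]
    rw [this, bil_single_right]
    simp [wt]
  linarith

theorem ip_emb_simpleRoot (j : Fin 5) (x : Fin 5 → ℝ) (a : Fin (numNodes j)) :
    ip (emb j x) (simpleRoot j a) = bil j x (toR (rootZ j a)) := by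
  rw [simpleRoot_eq, embZ, ip_emb]

/-- The part of the polyhedron of the simple roots on the walls with indices in `S`. -/
def faceSet (j : Fin 5) (S : Set (Fin (numNodes j))) : Set (ℙ ℂ V) :=
  {p | ∃ (x : Fin 5 → ℝ) (hx : Future j x), p = pt hx ∧
    (∀ a, bil j x (toR (rootZ j a)) ≤ 0) ∧ ∀ a ∈ S, bil j x (toR (rootZ j a)) = 0}

theorem polyhedron_eq (j : Fin 5) : polyhedron j (simpleRoot j) = faceSet j ∅ := by
  ext p
  constructor
  · rintro ⟨v, hv, rfl, hR, hneg, hle⟩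
    obtain ⟨x, rfl⟩ := exists_emb_of_mem_VR hR
    rw [ip_emb] at hneg
    simp only [ip_emb_simpleRoot] at hle
    exact ⟨x, future_of_nonpos hneg hle, rfl, hle, fun a ha => ha.elim⟩
  · rintro ⟨x, hx, rfl, hle, -⟩
    refine ⟨emb j x, emb_ne_zero hx, rfl, emb_mem_VR j x, by rw [ip_emb]; exact hx.1, fun a => ?_⟩
    rw [ip_emb_simpleRoot]
    exact hle a

theorem face_eq (j : Fin 5) (a : Fin (numNodes j)) : face j (simpleRoot j) a = faceSet j {a} := by
  ext p
  constructor
  · rintro ⟨v, hv, rfl, hR, hneg, hle, h0⟩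
    obtain ⟨x, rfl⟩ := exists_emb_of_mem_VR hR
    rw [ip_emb] at hneg
    simp only [ip_emb_simpleRoot] at hle h0
    refine ⟨x, future_of_nonpos hneg hle, rfl, hle, ?_⟩
    rintro b rfl
    exact h0
  · rintro ⟨x, hx, rfl, hle, h0⟩
    refine ⟨emb j x, emb_ne_zero hx, rfl, emb_mem_VR j x, by rw [ip_emb]; exact hx.1, fun a => ?_,
      ?_⟩
    · rw [ip_emb_simpleRoot]
      exact hle a
    · rw [ip_emb_simpleRoot]
      exact h0 a rfl

theorem autP_image_subset {j : Fin 5} (σ : DiagramAut j) (S : Set (Fin (numNodes j))) :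
    act (autP j σ).1 '' faceSet j S ⊆ faceSet j (σ.1 '' S) := by
  rintro _ ⟨_, ⟨x, hx, rfl, hle, h0⟩, rfl⟩
  have key : ∀ a, bil j (extR (autIsom j σ).1 x) (toR (rootZ j (σ.1 a))) =
      bil j x (toR (rootZ j a)) := by
    intro a
    rw [← autIsom_rootZ, ← extR_toR, bil_extR]
  refine ⟨_, future_extR (autIsom j σ) hx, act_toPGamR _ hx, fun a => ?_, ?_⟩
  · obtain ⟨b, rfl⟩ := σ.1.surjective a
    rw [key]
    exact hle b
  · rintro _ ⟨a, ha, rfl⟩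
    rw [key]
    exact h0 a ha

theorem autP_image {j : Fin 5} (σ : DiagramAut j) (S : Set (Fin (numNodes j))) :
    act (autP j σ).1 '' faceSet j S = faceSet j (σ.1 '' S) := by
  refine (autP_image_subset σ S).antisymm fun p hp => ?_
  have h := autP_image_subset σ⁻¹ (σ.1 '' S) ⟨p, hp, rfl⟩
  have h1 : (σ⁻¹ : DiagramAut j).1 '' (σ.1 '' S) = S := by
    rw [← Set.image_comp]
    have : (σ⁻¹ : DiagramAut j).1 ∘ σ.1 = id := funext fun a => σ.1.symm_apply_apply a
    rw [this, Set.image_id]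
  rw [h1] at h
  refine ⟨_, h, ?_⟩
  rw [← Equiv.Perm.mul_apply, ← map_mul, map_inv]
  change act ((autP j σ).1 * (autP j σ).1⁻¹) p = p
  rw [mul_inv_cancel, map_one]
  rfl

/-! ### The topology of the Weyl chamber -/

/-- A function on lines whose sign at a real point is that of the inner product of a future
representative with `r`. -/
noncomputable def signForm (r v : V) : ℝ := (herm v r * (starRingEnd ℂ) (v 0)).re

theorem signForm_smul (r v : V) (c : ℂ) : signForm r (c • v) = Complex.normSq c * signForm r v := by
  have : herm (c • v) r * (starRingEnd ℂ) ((c • v) 0) =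
      (Complex.normSq c : ℂ) * (herm v r * (starRingEnd ℂ) (v 0)) := by
    rw [herm_smul_left, Pi.smul_apply, smul_eq_mul, map_mul, ← Complex.mul_conj]
    ring
  rw [signForm, this, Complex.re_ofReal_mul, signForm]

theorem exists_signForm_rep (r : V) {v : V} (hv : v ≠ 0) :
    ∃ c : ℝ, 0 < c ∧ signForm r (Projectivization.mk ℂ v hv).rep = c * signForm r v := by
  obtain ⟨a, ha⟩ := Projectivization.exists_smul_eq_mk_rep ℂ v hv
  refine ⟨Complex.normSq a, Complex.normSq_pos.2 a.ne_zero, ?_⟩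
  rw [← ha, Units.smul_def, signForm_smul]

theorem continuous_signForm (r : V) : Continuous (signForm r) := by
  unfold signForm herm
  fun_prop

theorem isOpen_signForm_neg (r : V) : IsOpen {p : ℙ ℂ V | signForm r p.rep < 0} := by
  rw [isOpen_coinduced]
  convert (isOpen_Iio (a := (0 : ℝ))).preimage
    ((continuous_signForm r).comp continuous_subtype_val) using 1
  ext v
  obtain ⟨c, hc, h⟩ := exists_signForm_rep r v.2
  change signForm r (Projectivization.mk ℂ v.1 v.2).rep < 0 ↔ signForm r v.1 < 0
  rw [h]
  exact ⟨fun h => neg_of_mul_neg_right h hc.le, mul_neg_of_pos_of_neg hc⟩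

theorem isOpen_signForm_pos (r : V) : IsOpen {p : ℙ ℂ V | 0 < signForm r p.rep} := by
  rw [isOpen_coinduced]
  convert (isOpen_Ioi (a := (0 : ℝ))).preimage
    ((continuous_signForm r).comp continuous_subtype_val) using 1
  ext v
  obtain ⟨c, hc, h⟩ := exists_signForm_rep r v.2
  change 0 < signForm r (Projectivization.mk ℂ v.1 v.2).rep ↔ 0 < signForm r v.1
  rw [h]
  exact mul_pos_iff_of_pos_left hc

theorem exists_signForm_pt {j : Fin 5} {x : Fin 5 → ℝ} (hx : Future j x) (a : Fin (numNodes j)) :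
    ∃ c : ℝ, 0 < c ∧ signForm (simpleRoot j a) (pt hx).rep = c * bil j x (toR (rootZ j a)) := by
  obtain ⟨c, hc, h⟩ := exists_signForm_rep (simpleRoot j a) (emb_ne_zero hx)
  refine ⟨c * x 0, mul_pos hc hx.2, ?_⟩
  rw [pt, h, signForm, emb_zero_coord, simpleRoot_eq, embZ, herm_emb, Complex.conj_ofReal,
    ← Complex.ofReal_mul, Complex.ofReal_re]
  ring

/-- The real vectors inside the chamber. -/
def openCone (j : Fin 5) : Set (Fin 5 → ℝ) :=
  {x | Future j x ∧ ∀ a, bil j x (toR (rootZ j a)) < 0}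

theorem interiorZ_mem_openCone (j : Fin 5) : toR (interiorZ j) ∈ openCone j :=
  ⟨future_toR (future_interiorZ j), chamberFun_interiorZ j⟩

theorem convex_openCone (j : Fin 5) : Convex ℝ (openCone j) := by
  intro x hx y hy s t hs ht hst
  rcases hs.eq_or_lt with rfl | hs
  · rw [zero_add] at hst
    rw [hst, zero_smul, one_smul, zero_add]; exact hy
  rcases ht.eq_or_lt with rfl | ht
  · rw [add_zero] at hst
    rw [hst, zero_smul, one_smul, add_zero]; exact hx
  refine ⟨(hx.1.smul j hs).add j (hy.1.smul j ht), fun a => ?_⟩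
  rw [bil_add_left, bil_smul_left, bil_smul_left]
  exact add_neg (mul_neg_of_pos_of_neg hs (hx.2 a)) (mul_neg_of_pos_of_neg ht (hy.2 a))

/-- The open chamber. -/
def openChamber (j : Fin 5) : Set (ℙ ℂ V) := {p | ∃ (x : Fin 5 → ℝ) (hx : x ∈ openCone j), p = pt hx.1}

theorem continuous_emb (j : Fin 5) : Continuous (emb j) :=
  (emb j).continuous_of_finiteDimensional

theorem continuous_pt (j : Fin 5) : Continuous fun x : {x // Future j x} => pt x.2 := by
  have h1 : Continuous (Projectivization.mk' ℂ : {v : V // v ≠ 0} → ℙ ℂ V) :=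
    continuous_coinduced_rng
  exact h1.comp (Continuous.subtype_mk ((continuous_emb j).comp continuous_subtype_val)
    fun x => emb_ne_zero x.2)

theorem isPreconnected_openChamber (j : Fin 5) : IsPreconnected (openChamber j) := by
  have : PreconnectedSpace (openCone j) :=
    Subtype.preconnectedSpace (convex_openCone j).isPreconnected
  have h : Continuous fun x : openCone j => pt x.2.1 :=
    (continuous_pt j).comp (Continuous.subtype_mk continuous_subtype_val fun x => x.2.1)
  convert isPreconnected_range h using 1
  ext p
  exact ⟨fun ⟨x, hx, e⟩ => ⟨⟨x, hx⟩, e.symm⟩, fun ⟨x, e⟩ => ⟨x.1, x.2, e.symm⟩⟩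

theorem not_isReflZ_one (j : Fin 5) (n : Z5) : ¬ IsReflZ j 1 n := by
  intro h
  have h1 : n = -n := h.map_self
  have h2 : n = 0 := by
    ext i
    have := congrFun h1 i
    rw [Pi.neg_apply] at this
    change n i = 0
    omega
  have := h.1
  rw [h2] at this
  simp [bil] at this

/-- A reflection fixing such a point also fixes its future vector, as norms agree. It comes from the
Coxeter group and is therefore trivial by `eq_one_of_chamber`. -/
theorem openChamber_subset (j : Fin 5) : openChamber j ⊆ H4 j \ mirrors j := by
  rintro _ ⟨x, hx, rfl⟩
  refine ⟨pt_mem hx.1, ?_⟩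
  rintro ⟨-, g, hgW, hgR, hfix⟩
  obtain ⟨L, rfl⟩ := toPGamR_surjective j g
  obtain ⟨n, hn⟩ := exists_isReflZ hgR
  obtain ⟨w, hw⟩ := hn.exists_rho L.2
  rw [act_toPGamR, pt_eq_iff _ _ (bil_extR L x x)] at hfix
  have hw1 : w = 1 := by
    refine (realization j).eq_one_of_chamber (chamberFun j x) hx.2 w fun a => ?_
    rw [← hw]
    change bil j x (toR (L.1 (rootZ j a))) ≤ 0
    rw [← extR_toR]
    conv_lhs => rw [← hfix]
    rw [bil_extR]
    exact (hx.2 a).le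
  rw [hw1, map_one] at hw
  rw [hw] at hn
  exact not_isReflZ_one j n hn

theorem mem_mirrors_of_bil_eq_zero {j : Fin 5} {x : Fin 5 → ℝ} (hx : Future j x)
    {a : Fin (numNodes j)} (h : bil j x (toR (rootZ j a)) = 0) : pt hx ∈ mirrors j := by
  refine ⟨pt_mem hx, _, kappa_mem_W j _, kappa_simple_isReflection j a, ?_⟩
  rw [kappa_simple_actsAsReflection j a _ (pt_mem hx), pt, reflP, Projectivization.map_mk]
  congr 1
  rw [refl_apply, simpleRoot_eq, embZ, herm_emb, h]
  simp

/-- Away from the mirrors no sign form of a simple root vanishes, so each keeps its sign on the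
component. Conversely, the open chamber is connected and avoids the mirrors. -/
theorem connectedComponentIn_eq (j : Fin 5) :
    connectedComponentIn (H4 j \ mirrors j) (pt (interiorZ_mem_openCone j).1) =
      openChamber j := by
  have hmem : pt (interiorZ_mem_openCone j).1 ∈ openChamber j :=
    ⟨_, interiorZ_mem_openCone j, rfl⟩
  apply Set.Subset.antisymm
  · set K := connectedComponentIn (H4 j \ mirrors j) (pt (interiorZ_mem_openCone j).1) with hK
    have hKsub : K ⊆ H4 j \ mirrors j := connectedComponentIn_subset _ _
    have hneg : ∀ a, K ⊆ {p | signForm (simpleRoot j a) p.rep < 0} := by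
      intro a
      refine IsPreconnected.subset_left_of_subset_union (isOpen_signForm_neg _)
        (isOpen_signForm_pos (simpleRoot j a)) ?_ ?_ ?_ isPreconnected_connectedComponentIn
      · rw [Set.disjoint_left]
        intro p h1 h2
        exact lt_asymm (show signForm _ _ < 0 from h1) h2
      · intro p hp
        obtain ⟨h4, hm⟩ := hKsub hp
        obtain ⟨x, hx, rfl⟩ := mem_H4_iff.1 h4
        change signForm (simpleRoot j a) _ < 0 ∨ 0 < signForm (simpleRoot j a) _
        refine lt_or_gt_of_ne fun h0 => hm ?_
        obtain ⟨c, hc, e⟩ := exists_signForm_pt hx a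
        rw [pt, h0] at e
        exact mem_mirrors_of_bil_eq_zero hx ((mul_eq_zero.1 e.symm).resolve_left hc.ne')
      · refine ⟨_, mem_connectedComponentIn (openChamber_subset j hmem), ?_⟩
        obtain ⟨c, hc, e⟩ := exists_signForm_pt (interiorZ_mem_openCone j).1 a
        change signForm _ _ < 0
        rw [e]
        exact mul_neg_of_pos_of_neg hc ((interiorZ_mem_openCone j).2 a)
    intro p hp
    obtain ⟨x, hx, rfl⟩ := mem_H4_iff.1 (hKsub hp).1
    refine ⟨x, ⟨hx, fun a => ?_⟩, rfl⟩
    obtain ⟨c, hc, e⟩ := exists_signForm_pt hx a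
    have := hneg a hp
    change signForm _ (pt hx).rep < 0 at this
    rw [e] at this
    exact neg_of_mul_neg_right this hc.le
  · exact (isPreconnected_openChamber j).subset_connectedComponentIn hmem (openChamber_subset j)

theorem closure_openChamber (j : Fin 5) : closure (openChamber j) ∩ H4 j = faceSet j ∅ := by
  ext p
  constructor
  · rintro ⟨hp, h4⟩
    obtain ⟨x, hx, rfl⟩ := mem_H4_iff.1 h4
    refine ⟨x, hx, rfl, fun a => ?_, fun a ha => ha.elim⟩
    have hclosed : IsClosed {p : ℙ ℂ V | signForm (simpleRoot j a) p.rep ≤ 0} := by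
      have := (isOpen_signForm_pos (simpleRoot j a)).isClosed_compl
      convert this using 1
      ext q
      exact (not_lt (a := (0 : ℝ))).symm
    have hsub : openChamber j ⊆ {p : ℙ ℂ V | signForm (simpleRoot j a) p.rep ≤ 0} := by
      rintro _ ⟨y, hy, rfl⟩
      obtain ⟨c, hc, e⟩ := exists_signForm_pt hy.1 a
      change signForm _ _ ≤ 0
      rw [e]
      exact (mul_neg_of_pos_of_neg hc (hy.2 a)).le
    have h1 : signForm (simpleRoot j a) (pt hx).rep ≤ 0 :=
      closure_minimal hsub hclosed hp
    obtain ⟨c, hc, e⟩ := exists_signForm_pt hx a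
    rw [e] at h1
    exact nonpos_of_mul_nonpos_right h1 hc
  · rintro ⟨x, hx, rfl, hle, -⟩
    refine ⟨?_, pt_mem hx⟩
    have hy := interiorZ_mem_openCone j
    set y := toR (interiorZ j) with hydef
    -- A point of the closed chamber is approached along the segment towards an interior vector.
    have hpos : ∀ n : ℕ, (0 : ℝ) < 1 / ((n : ℝ) + 1) := fun n => by positivity
    have hfut : ∀ n : ℕ, Future j (x + (1 / ((n : ℝ) + 1)) • y) := fun n =>
      hx.add j (hy.1.smul j (hpos n))
    have hlim : Filter.Tendsto (fun n : ℕ => x + (1 / ((n : ℝ) + 1)) • y) Filter.atTop (nhds x) := by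
      have := (tendsto_one_div_add_atTop_nhds_zero_nat (𝕜 := ℝ)).smul_const y
      rw [zero_smul] at this
      simpa using this.const_add x
    have hlim' : Filter.Tendsto (fun n : ℕ => (⟨_, hfut n⟩ : {x // Future j x})) Filter.atTop
        (nhds ⟨x, hx⟩) := tendsto_subtype_rng.2 hlim
    refine mem_closure_of_tendsto (((continuous_pt j).tendsto _).comp hlim')
      (Filter.Eventually.of_forall fun n => ?_)
    refine ⟨_, ⟨hfut n, fun a => ?_⟩, rfl⟩
    rw [bil_add_left, bil_smul_left]
    exact add_neg_of_nonpos_of_neg (hle a) (mul_neg_of_pos_of_neg (hpos n) (hy.2 a))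

theorem isWeylChamber_polyhedron (j : Fin 5) : IsWeylChamber j (polyhedron j (simpleRoot j)) := by
  refine ⟨pt (interiorZ_mem_openCone j).1,
    openChamber_subset j ⟨_, interiorZ_mem_openCone j, rfl⟩, ?_⟩
  rw [connectedComponentIn_eq, closure_openChamber, polyhedron_eq]

/-! ### Simple roots -/

/-- A coordinate that is a unit shows that the root is primitive. -/
theorem exists_rootZ_unit (j : Fin 5) (a : Fin (numNodes j)) :
    ∃ i, rootZ j a i = 1 ∨ rootZ j a i = -1 := by
  revert j; decide +kernel

theorem isRoot_simpleRoot (j : Fin 5) (a : Fin (numNodes j)) : IsRoot j (simpleRoot j a) := by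
  refine ⟨by rw [simpleRoot_eq]; exact embZ_mem_LamR j _, fun m s hs h => ?_, ?_, fun x hx => ?_⟩
  · obtain ⟨t, rfl⟩ := exists_embZ_of_mem_LamR hs
    rw [simpleRoot_eq, ← embZ_smul] at h
    obtain ⟨i, hi⟩ := exists_rootZ_unit j a
    rw [embZ_injective j h, Pi.smul_apply, smul_eq_mul, ← Int.isUnit_iff] at hi
    exact isUnit_of_mul_isUnit_left hi
  · rw [ip_simpleRoot_self]
    exact_mod_cast nodeNorm_pos j a
  · obtain ⟨t, rfl⟩ := exists_embZ_of_mem_LamR hx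
    rw [simpleRoot_eq, (isReflZ_s j a).refl_embZ]
    exact embZ_mem_LamR j _

theorem bil_rootZ_nonpos (j : Fin 5) (a b : Fin (numNodes j)) (h : a ≠ b) :
    bil j (rootZ j a) (rootZ j b) ≤ 0 := by
  revert j; decide +kernel

theorem isSimpleSystem_simpleRoot (j : Fin 5) : IsSimpleSystem j (simpleRoot j) := by
  refine ⟨isRoot_simpleRoot j, fun a b h => ?_, isWeylChamber_polyhedron j⟩
  rw [ip_simpleRoot]
  exact_mod_cast bil_rootZ_nonpos j a b h

theorem ip_embZ_simpleRoot (j : Fin 5) (z : Z5) (a : Fin (numNodes j)) :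
    ip (embZ j z) (simpleRoot j a) = ((bil j z (rootZ j a) : ℤ) : ℝ) := by
  rw [simpleRoot_eq, ip, herm_embZ, Complex.intCast_re]

theorem ip_embZ_self (j : Fin 5) (z : Z5) : ip (embZ j z) (embZ j z) = ((bil j z z : ℤ) : ℝ) := by
  rw [ip, herm_embZ, Complex.intCast_re]

theorem definesFacet_simpleRoot (j : Fin 5) (a : Fin (numNodes j)) :
    DefinesFacet j (simpleRoot j) a := by
  obtain ⟨h1, h2, h3⟩ := bil_facetZ j a
  refine ⟨embZ j (facetZ j a), emb_mem_VR j _, ?_, ?_, fun b hb => ?_⟩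
  · rw [ip_embZ_self]; exact_mod_cast h1
  · rw [ip_embZ_simpleRoot]; exact_mod_cast h2
  · rw [ip_embZ_simpleRoot]; exact_mod_cast h3 b hb

/-! ### Bonds -/

/-- Vectors in the chamber, on or inside the light cone, in which the facets meet. -/
def vertices : Fin 5 → List Z5
  | 0 => [![1, 0, 0, 0, 0], ![2, -1, -1, 0, 0], ![3, -1, -1, -1, 0]]
  | 1 => [![1, 0, 0, 0, 0], ![3, -2, -1, 0, -1], ![3, -1, -1, -1, -1], ![1, -1, 0, 0, 0],
      ![2, -1, -1, 0, 0], ![3, -2, 0, 0, -1]]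
  | 2 => [![1, 0, 0, 0, 0], ![3, -2, -1, 0, -1], ![3, -1, 0, -1, -1], ![4, -2, -2, -1, -1],
      ![1, -1, 0, 0, 0], ![3, 0, 0, 0, -1]]
  | 3 => [![1, 0, 0, 0, 0], ![9, -3, -2, -3, -3], ![3, -2, 0, 0, -1], ![3, 0, 0, 0, -1],
      ![3, 0, -1, -1, -1], ![7, -3, -2, -2, -2]]
  | 4 => [![1, 0, 0, 0, 0], ![6, -1, -1, -2, -2], ![3, 0, 0, 0, -1], ![3, 0, -1, -1, -1],
      ![4, -1, -1, -1, -1]]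

/-- Restricting the search to the finite list of vertices makes the existence of a common point
decidable. -/
theorem exists_meeting_point (j : Fin 5) (a b : Fin (numNodes j)) (hab : a ≠ b)
    (h : (bond j a b).order ≠ 0) : ∃ z ∈ vertices j, bil j z z < 0 ∧
      (∀ c, bil j z (rootZ j c) ≤ 0) ∧ bil j z (rootZ j a) = 0 ∧ bil j z (rootZ j b) = 0 := by
  revert j; decide +kernel

theorem exists_cusp (j : Fin 5) (a b : Fin (numNodes j)) (h : bond j a b = .strong) :
    ∃ z ∈ vertices j, z ≠ 0 ∧ bil j z z = 0 ∧
      (∀ c, bil j z (rootZ j c) ≤ 0) ∧ bil j z (rootZ j a) = 0 ∧ bil j z (rootZ j b) = 0 := by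
  revert j; decide +kernel

/-- The number `4 cos² φ` for the angle `φ` of a bond; `4` for parallel walls, and a lower
bound for ultraparallel ones. -/
def cosCoeff : Bond → ℤ
  | .none => 0
  | .single => 1
  | .double => 2
  | .triple => 3
  | .strong => 4
  | .weak => 5

theorem four_mul_bil_sq (j : Fin 5) (a b : Fin (numNodes j)) (hab : a ≠ b)
    (h : bond j a b ≠ .weak) : 4 * bil j (rootZ j a) (rootZ j b) ^ 2 =
      cosCoeff (bond j a b) * (nodeNorm j a * nodeNorm j b) := by
  revert j; decide +kernel

theorem lt_bil_sq (j : Fin 5) (a b : Fin (numNodes j)) (h : bond j a b = .weak) :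
    (nodeNorm j a * nodeNorm j b : ℤ) < bil j (rootZ j a) (rootZ j b) ^ 2 := by
  revert j; decide +kernel

theorem rootZ_not_parallel (j : Fin 5) (a b : Fin (numNodes j)) (hab : a ≠ b) :
    (nodeNorm j b : ℤ) • rootZ j a - bil j (rootZ j a) (rootZ j b) • rootZ j b ≠ 0 := by
  revert j; decide +kernel

theorem meetAtAngle_of_cos {j : Fin 5} {a b : Fin (numNodes j)} (hab : a ≠ b)
    (h : (bond j a b).order ≠ 0) {φ : ℝ} (h0 : 0 ≤ φ) (hπ : φ ≤ Real.pi)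
    (hφ : Real.cos φ = Real.sqrt (cosCoeff (bond j a b)) / 2) :
    MeetAtAngle j (simpleRoot j) a b φ := by
  constructor
  · obtain ⟨z, -, hneg, hle, ha, hb⟩ := exists_meeting_point j a b hab h
    have hle' : ∀ c, bil j (toR z) (toR (rootZ j c)) ≤ 0 := fun c => by
      rw [bil_toR]; exact_mod_cast hle c
    have hfut := future_of_nonpos (by rw [bil_toR]; exact_mod_cast hneg) hle'
    rw [face_eq, face_eq]
    refine ⟨pt hfut, ⟨_, hfut, rfl, hle', ?_⟩, ⟨_, hfut, rfl, hle', ?_⟩⟩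
    · rintro _ rfl
      rw [bil_toR, ha, Int.cast_zero]
    · rintro _ rfl
      rw [bil_toR, hb, Int.cast_zero]
  · have hw : bond j a b ≠ .weak := by
      intro hc; rw [hc] at h; exact h rfl
    have h1 := four_mul_bil_sq j a b hab hw
    have h2 := bil_rootZ_nonpos j a b hab
    rw [ip_simpleRoot_self, ip_simpleRoot_self, ip_simpleRoot]
    have hN : (0 : ℝ) < nodeNorm j a * nodeNorm j b :=
      mul_pos (by exact_mod_cast nodeNorm_pos j a) (by exact_mod_cast nodeNorm_pos j b)
    have hq0 : ((bil j (rootZ j a) (rootZ j b) : ℤ) : ℝ) ≤ 0 := by exact_mod_cast h2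
    have hq2 : 4 * ((bil j (rootZ j a) (rootZ j b) : ℤ) : ℝ) ^ 2 =
        cosCoeff (bond j a b) * (nodeNorm j a * nodeNorm j b : ℝ) := by
      exact_mod_cast h1
    generalize ((bil j (rootZ j a) (rootZ j b) : ℤ) : ℝ) = q at hq0 hq2
    have hk : (0 : ℝ) ≤ cosCoeff (bond j a b) := by
      by_contra hc
      push Not at hc
      nlinarith [sq_nonneg q]
    have hval : -q / Real.sqrt (nodeNorm j a * nodeNorm j b) =
        Real.sqrt (cosCoeff (bond j a b)) / 2 := by
      rw [div_eq_div_iff (Real.sqrt_pos.2 hN).ne' two_ne_zero, ← Real.sqrt_mul hk, ← hq2,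
        show 4 * q ^ 2 = (-q * 2) ^ 2 by ring, Real.sqrt_sq (by linarith)]
    rw [hval, ← hφ, Real.arccos_cos h0 hπ]

theorem bil_normal (j : Fin 5) (x r s : Fin 5 → ℝ) :
    bil j x (bil j s s • r - bil j r s • s) = bil j s s * bil j x r - bil j r s * bil j x s := by
  rw [bil_sub_right, bil_smul_right, bil_smul_right]

/-- This vector is a multiple of the projection of `r` off `s`, and its norm is that of `s` times a
Gram determinant. A vector orthogonal to `r` and `s` is orthogonal to it. For a negative determinant
it is negative, so `eq_zero_of_orthogonal` excludes common points even at infinity. For determinant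
zero it is isotropic and nonzero by `rootZ_not_parallel`, which excludes common negative vectors. -/
theorem bil_normal_self (j : Fin 5) (r s : Fin 5 → ℝ) :
    bil j (bil j s s • r - bil j r s • s) (bil j s s • r - bil j r s • s) =
      bil j s s * (bil j r r * bil j s s - bil j r s ^ 2) := by
  rw [bil_normal, bil_sub_left, bil_sub_left, bil_smul_left, bil_smul_left, bil_smul_left,
    bil_smul_left, bil_comm j s r]
  ring

theorem parallel_of_strong {j : Fin 5} {a b : Fin (numNodes j)} (hab : a ≠ b)
    (h : bond j a b = .strong) : Parallel j (simpleRoot j) a b := by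
  constructor
  · rintro ⟨v, hv, hneg, ha, hb⟩
    obtain ⟨x, rfl⟩ := exists_emb_of_mem_VR hv
    rw [ip_emb] at hneg
    rw [ip_emb_simpleRoot] at ha hb
    have hsq := four_mul_bil_sq j a b hab (by rw [h]; decide)
    rw [h, ← bil_rootZ_self, ← bil_rootZ_self] at hsq
    have hsq' : bil j (rootZ j a) (rootZ j a) * bil j (rootZ j b) (rootZ j b) -
        bil j (rootZ j a) (rootZ j b) ^ 2 = 0 := by
      change _ = 4 * _ at hsq
      linarith
    have hn := eq_zero_of_orthogonal j hneg
      (n := bil j (toR (rootZ j b)) (toR (rootZ j b)) • toR (rootZ j a) -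
        bil j (toR (rootZ j a)) (toR (rootZ j b)) • toR (rootZ j b))
      (by
        rw [bil_normal_self]
        simp only [bil_toR]
        refine le_of_eq (mul_eq_zero_of_right _ ?_)
        exact_mod_cast hsq')
      (by rw [bil_normal, ha, hb, mul_zero, mul_zero, sub_zero])
    refine rootZ_not_parallel j a b hab (toR_injective ?_)
    rw [map_sub, map_zsmul, map_zsmul, map_zero, ← Int.cast_smul_eq_zsmul ℝ,
      ← Int.cast_smul_eq_zsmul ℝ, ← bil_rootZ_self, ← bil_toR, ← bil_toR]
    exact hn
  · obtain ⟨z, -, hz, hiso, hle, ha, hb⟩ := exists_cusp j a b h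
    refine ⟨embZ j z, emb_mem_VR j _, fun h0 => hz (embZ_injective j ?_), ?_, ?_, ?_, fun c => ?_⟩
    · rw [h0, embZ, map_zero, map_zero]
    · rw [ip_embZ_self, hiso, Int.cast_zero]
    · rw [ip_embZ_simpleRoot, ha, Int.cast_zero]
    · rw [ip_embZ_simpleRoot, hb, Int.cast_zero]
    · rw [ip_embZ_simpleRoot]; exact_mod_cast hle c

theorem ultraparallel_of_weak {j : Fin 5} {a b : Fin (numNodes j)}
    (h : bond j a b = .weak) : Ultraparallel j (simpleRoot j) a b := by
  rintro ⟨v, hv, hv0, hneg, ha, hb⟩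
  obtain ⟨x, rfl⟩ := exists_emb_of_mem_VR hv
  rw [ip_emb] at hneg
  rw [ip_emb_simpleRoot] at ha hb
  have hsq := lt_bil_sq j a b h
  rw [← bil_rootZ_self, ← bil_rootZ_self] at hsq
  have hpos := nodeNorm_pos j b
  rw [← bil_rootZ_self] at hpos
  refine hv0 ?_
  rw [eq_zero_of_orthogonal j (x := bil j (toR (rootZ j b)) (toR (rootZ j b)) • toR (rootZ j a) -
        bil j (toR (rootZ j a)) (toR (rootZ j b)) • toR (rootZ j b)) ?_ hneg ?_, map_zero]
  · rw [bil_normal_self]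
    simp only [bil_toR]
    refine mul_neg_of_pos_of_neg (by exact_mod_cast hpos) ?_
    rw [sub_neg]
    exact_mod_cast hsq
  · rw [bil_comm, bil_normal, ha, hb, mul_zero, mul_zero, sub_zero]

theorem realizes_simpleRoot (j : Fin 5) (a b : Fin (numNodes j)) (hab : a ≠ b) :
    Realizes j (simpleRoot j) a b (bond j a b) := by
  have hπ := Real.pi_pos
  have key : ∀ φ, 0 ≤ φ → φ ≤ Real.pi → (bond j a b).order ≠ 0 →
      Real.cos φ = Real.sqrt (cosCoeff (bond j a b)) / 2 → MeetAtAngle j (simpleRoot j) a b φ :=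
    fun φ h0 hφ h hc => meetAtAngle_of_cos hab h h0 hφ hc
  cases h : bond j a b with
  | none =>
    refine key _ (by positivity) (by linarith) (by rw [h]; decide) ?_
    rw [h, Real.cos_pi_div_two]; simp [cosCoeff]
  | single =>
    refine key _ (by positivity) (by linarith) (by rw [h]; decide) ?_
    rw [h, Real.cos_pi_div_three]; simp [cosCoeff]
  | double =>
    refine key _ (by positivity) (by linarith) (by rw [h]; decide) ?_
    rw [h, Real.cos_pi_div_four]; simp [cosCoeff]
  | triple =>
    refine key _ (by positivity) (by linarith) (by rw [h]; decide) ?_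
    rw [h, Real.cos_pi_div_six]; simp [cosCoeff]
  | strong => exact parallel_of_strong hab h
  | weak => exact ultraparallel_of_weak h

end RealCubic

theorem theorem5p3 (j : Fin 5) :
    -- the vectors of the diagram are simple roots for `W j`, of the indicated norms,
    -- and the nodes are the facets of the Weyl chamber, joined as drawn
    IsSimpleSystem j (simpleRoot j) ∧
    (∀ a, ip (simpleRoot j a) (simpleRoot j a) = nodeNorm j a) ∧
    (∀ a, DefinesFacet j (simpleRoot j) a) ∧
    (∀ a b, a ≠ b → Realizes j (simpleRoot j) a b (bond j a b)) ∧
    -- the reflections in the simple roots lie in `W j` and make it a Coxeter group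
    (∃ s : Fin (numNodes j) → W j,
      (∀ a, ActsAsReflection j (simpleRoot j a) (s a)) ∧
      (∃ cs : CoxeterSystem (coxeterMatrix j) (W j), ∀ a, cs.simple a = s a) ∧
      -- `PGamR j` is the semidirect product of `W j` by the diagram automorphisms, which act
      -- on `W j` by permuting the simple reflections, and on the chamber by symmetries
      (∃ (α : DiagramAut j →* MulAut (W j)) (e : W j ⋊[α] DiagramAut j ≃* PGamR j),
        (∀ w : W j, e (SemidirectProduct.inl w) = w) ∧
        (∀ (σ : DiagramAut j) (a : Fin (numNodes j)), α σ (s a) = s (σ.1 a)) ∧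
        (∀ σ : DiagramAut j,
          act (e (SemidirectProduct.inr σ)).1 '' polyhedron j (simpleRoot j) =
            polyhedron j (simpleRoot j)) ∧
        (∀ (σ : DiagramAut j) (a : Fin (numNodes j)),
          act (e (SemidirectProduct.inr σ)).1 '' face j (simpleRoot j) a =
            face j (simpleRoot j) (σ.1 a)))) ∧
    -- the group of diagram automorphisms
    ((j = 1 ∨ j = 2) → Nonempty (DiagramAut j ≃* Multiplicative (ZMod 2))) ∧
    (¬ (j = 1 ∨ j = 2) → Subsingleton (DiagramAut j)) := by
  refine ⟨isSimpleSystem_simpleRoot j, ip_simpleRoot_self j, definesFacet_simpleRoot j,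
    realizes_simpleRoot j,
    ⟨fun a => kappaEquiv j ((coxeterMatrix j).toCoxeterSystem.simple a),
      kappa_simple_actsAsReflection j, ⟨⟨(kappaEquiv j).symm⟩, fun a => rfl⟩,
      autAction j, semidirectEquiv j, fun w => ?_, autAction_simple, fun σ => ?_, fun σ a => ?_⟩,
    diagramAut_mulEquiv, diagramAut_subsingleton⟩
  · exact semidirectEquiv_inl j w
  · rw [semidirectEquiv_inr, polyhedron_eq, autP_image, Set.image_empty]
  · rw [semidirectEquiv_inr, face_eq, face_eq, autP_image, Set.image_singleton]
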